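/- \textbf{Conventions.} Manifolds are smooth ($C^\infty$) real Banach manifolds; different components may be modelled on different Banach spaces, and no separation or countability axiom is imposed. A submersion is a smooth map which near every point is, in suitable charts, a projection $E\times F\to E$. Limits of manifolds are taken as limits of the represented presheaves on the category of manifolds; a map from a manifold $M$ to such a presheaf is a surjective submersion if the presheaf is represented by a manifold $L$ and the map $M\to L$ is a surjective submersion. For a simplicial set $A$ and a simplicial manifold $X$, $\hom(A,X)$ is the presheaf $T\mapsto \hom(A,C^\infty(T,X_\bullet))$; for $A\to B$ and a simplicial map $f:K\to Y$, $\hom(A\to B,K\to Y)=\hom(A,K)\times_{\hom(A,Y)}\hom(B,Y)$. A Lie $n$-groupoid is a simplicial manifold $X$ such that $X_m=\hom(\Delta[m],X)\to\hom(\Lambda[m,j],X)$ is a surjective submersion for all $m\ge 1$, $0\le j\le m$, and an isomorphism for all $m>n$, $0\le j\le m$. A hypercover of Lie $n$-groupoids is a simplicial map $Z\to X$ such that $Z_k\to\hom(\partial\Delta[k]\to\Delta[k],Z\to X)$ is a surjective submersion for $0\le k<n$ and an isomorphism for $k=n$. Lie $n$-groupoids $X,Y$ are Morita equivalent if there are a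 Lie $n$-groupoid $Z$ and hypercovers $X\leftarrow Z\to Y$. For a Lie 2-groupoid $Y$ let $b(Y_2)=d_2^{-1}(s_0(Y_0))\subset Y_2$ (bigons); a bigon $\beta$ is regarded as an arrow from $d_1\beta$ to $d_0\beta$, both in $Y_1$. For maps $g,h:T\to Y_1$ and $\alpha:T\to b(Y_2)$ we write $g=\alpha\cdot h$ if $d_1\circ\alpha=h$ and $d_0\circ\alpha=g$. \textbf{Statement.} Let $f:K\to Y$ be a simplicial morphism of Lie 2-groupoids. (I) Suppose that (1) $f_0:K_0\to Y_0$ is an isomorphism; (2) there are a manifold $Z_1$ and surjective submersions $K_1\xleftarrow{g_1}Z_1\xrightarrow{h_1}Y_1$; (3) there is a smooth map $\alpha:Z_1\to b(Y_2)$ with $f_1\circ g_1=\alpha\cdot h_1$; (4) the natural map $K_2\to\hom(\partial\Delta[2]\to\Delta[2],K\to Y)$ is an isomorphism. Then $K$ and $Y$ are Morita equivalent. (II) Suppose that (1$'$) $f_0:K_0\to Y_0$ is an isomorphism, and $X_1$ is a manifold with a smooth map $i:X_1\to K_1$ (for instance, the inclusion of a submanifold) such that $f_1\circ i:X_1\to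 Y_1$ is a submersion; (2$'$) with $P:=\hom(\Lambda[2,1],K)\times_{\hom(\Lambda[2,1],Y)}Y_2$, the composite $h_1':P\to Y_2\xrightarrow{d_1}Y_1$ is a surjective submersion; (3$'$) there are morphisms $\mu:\hom(\Lambda[2,1],K)\to K_1$ and $\alpha':P\to b(Y_2)$ such that the composite $g_1':P\to\hom(\Lambda[2,1],K)\xrightarrow{\mu}K_1$ satisfies $f_1\circ g_1'=\alpha'\cdot h_1'$; (4$'$) with $Q:=X_1\times_{f_1\circ i,\,Y_1,\,d_0}b(Y_2)$ and $Z_1:=P\sqcup Q$, the map $g_1:=g_1'\sqcup (i\circ pr_{X_1}):Z_1\to K_1$ is a surjective submersion; (5$'$) the natural map $K_2\to\hom(\partial\Delta[2]\to\Delta[2],K\to Y)$ is an isomorphism. Then $Z_1$, $g_1$, $h_1:=h_1'\sqcup(d_1\circ pr_{b(Y_2)})$ and $\alpha:=\alpha'\sqcup pr_{b(Y_2)}$ satisfy conditions (1)--(4) of (I) (so $K$ and $Y$ are Morita equivalent). -/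

import Mathlib

open CategoryTheory Opposite Simplicial
open scoped ContDiff Topology

universe u

/-! ### Banach manifolds -/

/-- A chart of a topological space `M` with values in some real Banach space. The Banach space may
vary from chart to chart. -/
structure BanachChart (M : Type u) [TopologicalSpace M] : Type (u + 1) where
  E : Type u
  [normedAddCommGroup : NormedAddCommGroup E]
  [normedSpace : NormedSpace ℝ E]
  [completeSpace : CompleteSpace E]
  φ : OpenPartialHomeomorph M E

attribute [instance] BanachChart.normedAddCommGroup BanachChart.normedSpace
  BanachChart.completeSpace

/-- The coordinate change from `c` to `d` is smooth on its domain. -/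
def BanachChart.SmoothChange {M : Type u} [TopologicalSpace M] (c d : BanachChart M) : Prop :=
  ∀ x ∈ c.φ.source, x ∈ d.φ.source → ContDiffAt ℝ ∞ (d.φ ∘ c.φ.symm) (c.φ x)

/-- A smooth Banach manifold (in the sense of Lang). Different components may be modelled on
different Banach spaces, so that disjoint unions of manifolds are manifolds. No separation or
countability axiom is imposed. -/
structure BanMfd : Type (u + 1) where
  carrier : Type u
  [topologicalSpace : TopologicalSpace carrier]
  atlas : Set (BanachChart carrier)
  exists_mem_source : ∀ x : carrier, ∃ c ∈ atlas, x ∈ c.φ.source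
  smoothChange : ∀ c ∈ atlas, ∀ d ∈ atlas, c.SmoothChange d

namespace BanMfd

instance : CoeSort BanMfd.{u} (Type u) := ⟨BanMfd.carrier⟩

attribute [instance] BanMfd.topologicalSpace

/-- `c` belongs to the maximal atlas of `M`. -/
def IsChart (M : BanMfd.{u}) (c : BanachChart M) : Prop :=
  ∀ d ∈ M.atlas, c.SmoothChange d ∧ d.SmoothChange c

/-- Smooth (`C^∞`) maps between Banach manifolds. -/
def IsSmooth {M N : BanMfd.{u}} (f : M → N) : Prop :=
  Continuous f ∧ ∀ c ∈ M.atlas, ∀ d ∈ N.atlas, ∀ x ∈ c.φ.source, f x ∈ d.φ.source →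
    ContDiffAt ℝ ∞ (d.φ ∘ f ∘ c.φ.symm) (c.φ x)

theorem isSmooth_id (M : BanMfd.{u}) : IsSmooth (fun x : M => x) :=
  ⟨continuous_id, fun c hc d hd x hx hx' => M.smoothChange c hc d hd x hx hx'⟩

theorem IsSmooth.comp {M N P : BanMfd.{u}} {g : N → P} {f : M → N} (hg : IsSmooth g)
    (hf : IsSmooth f) : IsSmooth (fun x => g (f x)) := by
  refine ⟨hg.1.comp hf.1, fun c hc d hd x hx hx' => ?_⟩
  obtain ⟨e, he, hxe⟩ := N.exists_mem_source (f x)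
  have h1 := hf.2 c hc e he x hx hxe
  have h2 := hg.2 e he d hd (f x) hxe hx'
  have hx0 : c.φ.symm (c.φ x) = x := c.φ.left_inv hx
  have h2' : ContDiffAt ℝ ∞ (d.φ ∘ g ∘ e.φ.symm) ((e.φ ∘ f ∘ c.φ.symm) (c.φ x)) := by
    simpa [hx0] using h2
  refine (h2'.comp (c.φ x) h1).congr_of_eventuallyEq ?_
  have hcont : ContinuousAt (fun y => f (c.φ.symm y)) (c.φ x) :=
    hf.1.continuousAt.comp (c.φ.continuousAt_symm (c.φ.map_source hx))
  have hmem : e.φ.source ∈ 𝓝 (f (c.φ.symm (c.φ x))) := by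
    rw [hx0]; exact e.φ.open_source.mem_nhds hxe
  filter_upwards [hcont hmem] with y hy
  have hy' : f (c.φ.symm y) ∈ e.φ.source := hy
  simp [e.φ.left_inv hy']

/-- The category of Banach manifolds and smooth maps. -/
instance : LargeCategory BanMfd.{u} where
  Hom M N := {f : M → N // IsSmooth f}
  id M := ⟨fun x => x, isSmooth_id M⟩
  comp f g := ⟨fun x => g.1 (f.1 x), g.2.comp f.2⟩

/-- A smooth map is a submersion if near each point it is, in suitable charts, a projection
`E × F → E`. -/
def IsSubmersion {M N : BanMfd.{u}} (f : M ⟶ N) : Prop :=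
  ∀ x : M, ∃ (E F : Type u) (_ : NormedAddCommGroup E) (_ : NormedSpace ℝ E) (_ : CompleteSpace E)
    (_ : NormedAddCommGroup F) (_ : NormedSpace ℝ F) (_ : CompleteSpace F)
    (φ : OpenPartialHomeomorph M (E × F)) (ψ : OpenPartialHomeomorph N E),
    M.IsChart ⟨E × F, φ⟩ ∧ N.IsChart ⟨E, ψ⟩ ∧ x ∈ φ.source ∧
      (∀ y ∈ φ.source, f.1 y ∈ ψ.source ∧ ψ (f.1 y) = (φ y).1)

/-- Surjective submersions. -/
def IsSurjSubmersion {M N : BanMfd.{u}} (f : M ⟶ N) : Prop :=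
  Function.Surjective f.1 ∧ IsSubmersion f

/-! ### Disjoint unions -/

/-- Transport of a chart along an open embedding. -/
noncomputable def _root_.BanachChart.lift {M N : Type u} [TopologicalSpace M] [TopologicalSpace N]
    (c : BanachChart M) {j : M → N} (hj : Topology.IsOpenEmbedding j) : BanachChart N :=
  ⟨c.E, c.φ.lift_openEmbedding hj⟩

theorem _root_.BanachChart.SmoothChange.lift {M N : Type u} [TopologicalSpace M]
    [TopologicalSpace N] {c d : BanachChart M} (h : c.SmoothChange d) {j : M → N}
    (hj : Topology.IsOpenEmbedding j) : (c.lift hj).SmoothChange (d.lift hj) := by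
  intro x hx hx'
  obtain ⟨y, hy, rfl⟩ := hx
  obtain ⟨y', hy', hyy⟩ := hx'
  obtain rfl := hj.injective hyy
  have h1 := h _ hy hy'
  have e1 : (c.lift hj).φ (j y') = c.φ y' := c.φ.lift_openEmbedding_apply hj
  rw [e1]
  refine h1.congr_of_eventuallyEq (Filter.Eventually.of_forall fun z => ?_)
  change (d.φ.lift_openEmbedding hj) ((c.φ.lift_openEmbedding hj).symm z) = d.φ (c.φ.symm z)
  rw [OpenPartialHomeomorph.lift_openEmbedding_symm]
  exact d.φ.lift_openEmbedding_apply hj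

/-- The disjoint union of two Banach manifolds. -/
noncomputable def sum (A B : BanMfd.{u}) : BanMfd.{u} where
  carrier := A ⊕ B
  atlas := {c | (∃ d ∈ A.atlas, c = d.lift Topology.IsOpenEmbedding.inl) ∨
    (∃ d ∈ B.atlas, c = d.lift Topology.IsOpenEmbedding.inr)}
  exists_mem_source := by
    rintro (x | x)
    · obtain ⟨c, hc, hx⟩ := A.exists_mem_source x
      exact ⟨_, Or.inl ⟨c, hc, rfl⟩, ⟨x, hx, rfl⟩⟩
    · obtain ⟨c, hc, hx⟩ := B.exists_mem_source x
      exact ⟨_, Or.inr ⟨c, hc, rfl⟩, ⟨x, hx, rfl⟩⟩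
  smoothChange := by
    rintro _ (⟨c, hc, rfl⟩ | ⟨c, hc, rfl⟩) _ (⟨d, hd, rfl⟩ | ⟨d, hd, rfl⟩)
    · exact (A.smoothChange c hc d hd).lift _
    · rintro _ ⟨y, -, rfl⟩ ⟨z, -, h⟩
      cases h
    · rintro _ ⟨y, -, rfl⟩ ⟨z, -, h⟩
      cases h
    · exact (B.smoothChange c hc d hd).lift _

theorem isSmooth_sumElim {A B M : BanMfd.{u}} {f : A → M} {g : B → M} (hf : IsSmooth f)
    (hg : IsSmooth g) : IsSmooth (M := sum A B) (N := M) (Sum.elim f g) := by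
  refine ⟨hf.1.sumElim hg.1, ?_⟩
  rintro _ (⟨c, hc, rfl⟩ | ⟨c, hc, rfl⟩) d hd _ ⟨y, hy, rfl⟩ hx'
  · have h1 := hf.2 c hc d hd y hy hx'
    have h2 : ContDiffAt ℝ ∞
        (d.φ ∘ Sum.elim f g ∘ (c.φ.lift_openEmbedding (Topology.IsOpenEmbedding.inl (X := A) (Y := B))).symm)
        (c.φ.lift_openEmbedding Topology.IsOpenEmbedding.inl (Sum.inl y : A ⊕ B)) := by
      rw [OpenPartialHomeomorph.lift_openEmbedding_apply,
        OpenPartialHomeomorph.lift_openEmbedding_symm]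
      exact h1
    exact h2
  · have h1 := hg.2 c hc d hd y hy hx'
    have h2 : ContDiffAt ℝ ∞
        (d.φ ∘ Sum.elim f g ∘ (c.φ.lift_openEmbedding (Topology.IsOpenEmbedding.inr (X := A) (Y := B))).symm)
        (c.φ.lift_openEmbedding Topology.IsOpenEmbedding.inr (Sum.inr y : A ⊕ B)) := by
      rw [OpenPartialHomeomorph.lift_openEmbedding_apply,
        OpenPartialHomeomorph.lift_openEmbedding_symm]
      exact h1
    exact h2

/-- The map `f ⊔ g` out of a disjoint union. -/
def sumDesc {A B M : BanMfd.{u}} (f : A ⟶ M) (g : B ⟶ M) : sum A B ⟶ M :=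
  ⟨Sum.elim f.1 g.1, isSmooth_sumElim f.2 g.2⟩

/-! ### Presheaves on the category of manifolds

A limit of manifolds is regarded, via the Yoneda embedding, as the limit of the corresponding
presheaves. It is a manifold when this presheaf is representable. -/

/-- A map from the manifold `M` to the presheaf `P` (given by the element `p`, using Yoneda) is an
isomorphism. -/
def IsIsoOnto (P : BanMfd.{u}ᵒᵖ ⥤ Type u) {M : BanMfd.{u}} (p : P.obj (op M)) : Prop :=
  ∀ T : BanMfd.{u}, Function.Bijective (fun t : T ⟶ M => P.map t.op p)

/-- A map from the manifold `M` to the presheaf `P` (given by the element `p`, using Yoneda) is a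
surjective submersion: `P` is represented by a manifold `L`, and the resulting smooth map `M ⟶ L`
is a surjective submersion. -/
def IsSurjSubmersionOnto (P : BanMfd.{u}ᵒᵖ ⥤ Type u) {M : BanMfd.{u}} (p : P.obj (op M)) : Prop :=
  ∃ (L : BanMfd.{u}) (r : P.RepresentableBy L), IsSurjSubmersion (r.homEquiv.symm p)

end BanMfd

/-! ### Simplicial manifolds and Lie `n`-groupoids -/

namespace SimplicialMfd

open BanMfd

/-- The simplicial set of `T`-points of a simplicial manifold `X`, `k ↦ C^∞(T, X_k)`, as a functor
of `T`. -/
def points (X : SimplicialObject BanMfd.{u}) : BanMfd.{u}ᵒᵖ ⥤ SSet.{u} :=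
  coyoneda ⋙ (Functor.whiskeringLeft SimplexCategoryᵒᵖ BanMfd.{u} (Type u)).obj X

/-- The map on points induced by a morphism of simplicial manifolds. -/
def pointsMap {K Y : SimplicialObject BanMfd.{u}} (f : K ⟶ Y) : points K ⟶ points Y :=
  Functor.whiskerLeft coyoneda
    ((Functor.whiskeringLeft SimplexCategoryᵒᵖ BanMfd.{u} (Type u)).map f)

/-- The presheaf `hom(A, X)`, for a simplicial set `A` and a simplicial manifold `X`. -/
def homPresheaf (A : SSet.{u}) (X : SimplicialObject BanMfd.{u}) : BanMfd.{u}ᵒᵖ ⥤ Type u :=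
  points X ⋙ coyoneda.obj (op A)

/-- The presheaf `hom(A → B, K → Y) = hom(A, K) ×_{hom(A, Y)} hom(B, Y)` of commutative squares. -/
def relPresheaf {A B : SSet.{u}} (i : A ⟶ B) {K Y : SimplicialObject BanMfd.{u}} (f : K ⟶ Y) :
    BanMfd.{u}ᵒᵖ ⥤ Type u where
  obj T := {p : (A ⟶ (points K).obj T) × (B ⟶ (points Y).obj T) //
    p.1 ≫ (pointsMap f).app T = i ≫ p.2}
  map t := ↾fun p => ⟨(p.1.1 ≫ (points K).map t, p.1.2 ≫ (points Y).map t), by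
    change (p.1.1 ≫ (points K).map t) ≫ (pointsMap f).app _ = i ≫ p.1.2 ≫ (points Y).map t
    rw [Category.assoc, (pointsMap f).naturality, reassoc_of% p.2]⟩

/-- The isomorphism `C^∞(T, X_m) = hom(Δ[m], X)(T)`. -/
def simplex {X : SimplicialObject BanMfd.{u}} {T : BanMfd.{u}} {m : ℕ} (x : T ⟶ X _⦋m⦌) :
    Δ[m] ⟶ (points X).obj (op T) :=
  (SSet.yonedaEquiv (X := (points X).obj (op T)) (n := ⦋m⦌)).symm x

/-- The restriction map `X_m = hom(Δ[m], X) → hom(Λ[m,j], X)`. -/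
def hornRestriction (X : SimplicialObject BanMfd.{u}) (m : ℕ) (j : Fin (m + 1)) :
    (homPresheaf (Λ[m, j] : SSet.{u}) X).obj (op (X _⦋m⦌)) :=
  Λ[m, j].ι ≫ simplex (𝟙 (X _⦋m⦌))

/-- The condition `Kan(m,j)`. -/
def Kan (X : SimplicialObject BanMfd.{u}) (m : ℕ) (j : Fin (m + 1)) : Prop :=
  IsSurjSubmersionOnto _ (hornRestriction X m j)

/-- The condition `Kan!(m,j)`. -/
def KanUnique (X : SimplicialObject BanMfd.{u}) (m : ℕ) (j : Fin (m + 1)) : Prop :=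
  IsIsoOnto _ (hornRestriction X m j)

/-- A simplicial manifold is a Lie `n`-groupoid if `Kan(m,j)` holds for `m ≥ 1` and `Kan!(m,j)`
holds for `m > n`. -/
structure IsLieGroupoid (n : ℕ) (X : SimplicialObject BanMfd.{u}) : Prop where
  kan : ∀ (m : ℕ) (j : Fin (m + 1)), 1 ≤ m → Kan X m j
  kan_unique : ∀ (m : ℕ) (j : Fin (m + 1)), n < m → KanUnique X m j

/-- The natural map `K_k → hom(∂Δ[k] → Δ[k], K → Y)`. -/
def boundaryRestriction {K Y : SimplicialObject BanMfd.{u}} (f : K ⟶ Y) (k : ℕ) :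
    (relPresheaf (∂Δ[k].ι : (∂Δ[k] : SSet.{u}) ⟶ Δ[k]) f).obj (op (K _⦋k⦌)) :=
  ⟨(∂Δ[k].ι ≫ simplex (𝟙 (K _⦋k⦌)), simplex (f.app (op ⦋k⦌))), by
    rw [Category.assoc]
    congr 1
    apply SSet.yonedaEquiv.injective
    rw [SSet.yonedaEquiv_comp]
    unfold simplex
    erw [Equiv.apply_symm_apply, Equiv.apply_symm_apply]
    exact Category.id_comp (f.app (op ⦋k⦌))⟩

/-- Hypercovers of Lie `n`-groupoids. -/
structure IsHypercover (n : ℕ) {Z X : SimplicialObject BanMfd.{u}} (f : Z ⟶ X) : Prop where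
  surjSubmersion : ∀ k < n, IsSurjSubmersionOnto _ (boundaryRestriction f k)
  iso : IsIsoOnto _ (boundaryRestriction f n)

/-- Morita equivalence of Lie `n`-groupoids. -/
def MoritaEquivalent (n : ℕ) (X Y : SimplicialObject BanMfd.{u}) : Prop :=
  ∃ Z : SimplicialObject BanMfd.{u}, IsLieGroupoid n Z ∧
    ∃ (p : Z ⟶ X) (q : Z ⟶ Y), IsHypercover n p ∧ IsHypercover n q

/-! ### Bigons -/

/-- The smooth maps from `T` to `b(Y_2) = d_2⁻¹(s_0(Y_0))`, the manifold of bigons in `Y_2`. -/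
structure Bigon (Y : SimplicialObject BanMfd.{u}) (T : BanMfd.{u}) : Type u where
  hom : T ⟶ Y _⦋2⦌
  base : T ⟶ Y _⦋0⦌
  comm : hom ≫ Y.δ (2 : Fin 3) = base ≫ Y.σ (0 : Fin 1)

/-- A bigon is regarded as an arrow of the groupoid `d_0, d_1 : b(Y_2) ⇉ Y_1` from its face `d_1`
(the source) to its face `d_0` (the target). -/
def Bigon.source {Y : SimplicialObject BanMfd.{u}} {T : BanMfd.{u}} (β : Bigon Y T) :
    T ⟶ Y _⦋1⦌ := β.hom ≫ Y.δ (1 : Fin 3)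

/-- See `Bigon.source`. -/
def Bigon.target {Y : SimplicialObject BanMfd.{u}} {T : BanMfd.{u}} (β : Bigon Y T) :
    T ⟶ Y _⦋1⦌ := β.hom ≫ Y.δ (0 : Fin 3)

/-- The precomposition of `T → b(Y_2)` with `T' → T`. -/
def Bigon.pullback {Y : SimplicialObject BanMfd.{u}} {T T' : BanMfd.{u}} (t : T' ⟶ T)
    (β : Bigon Y T) : Bigon Y T' :=
  ⟨t ≫ β.hom, t ≫ β.base, by rw [Category.assoc, Category.assoc, β.comm]⟩

/-- `g = α · h`, where `α` is a map to `b(Y_2)` and `g`, `h` are maps to `Y_1`: pointwise, `α` is an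
arrow from `h` to `g`. -/
def Bigon.Acts {Y : SimplicialObject BanMfd.{u}} {T : BanMfd.{u}} (α : Bigon Y T)
    (h g : T ⟶ Y _⦋1⦌) : Prop :=
  α.source = h ∧ α.target = g

/-- The map `α ⊔ β` from a disjoint union to `b(Y_2)`. -/
def Bigon.sumDesc {Y : SimplicialObject BanMfd.{u}} {A B : BanMfd.{u}} (α : Bigon Y A)
    (β : Bigon Y B) : Bigon Y (BanMfd.sum A B) where
  hom := BanMfd.sumDesc α.hom β.hom
  base := BanMfd.sumDesc α.base β.base
  comm := by
    apply Subtype.ext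
    funext x
    rcases x with x | x
    · exact congrFun (congrArg Subtype.val α.comm) x
    · exact congrFun (congrArg Subtype.val β.comm) x

/-- The presheaf `X₁ ×_{e, Y_1, d_0} b(Y_2)`, for a smooth map `e : X₁ ⟶ Y_1`. -/
def bigonPullback {Y : SimplicialObject BanMfd.{u}} {X₁ : BanMfd.{u}} (e : X₁ ⟶ Y _⦋1⦌) :
    BanMfd.{u}ᵒᵖ ⥤ Type u where
  obj T := {p : (T.unop ⟶ X₁) × Bigon Y T.unop // p.1 ≫ e = p.2.target}
  map t := ↾fun p => ⟨(t.unop ≫ p.1.1, p.1.2.pullback t.unop), by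
    rw [Category.assoc, p.2]; exact (Category.assoc _ _ _).symm⟩

/-! ### The two sets of conditions -/

/-- The conditions, on a morphism `f : K ⟶ Y` of Lie 2-groupoids, a manifold `Z₁`, smooth maps
`K_1 ← Z₁ → Y_1` and a smooth map `α : Z₁ → b(Y_2)`. -/
structure BigonSpan {K Y : SimplicialObject BanMfd.{u}} (f : K ⟶ Y) (Z₁ : BanMfd.{u})
    (g₁ : Z₁ ⟶ K _⦋1⦌) (h₁ : Z₁ ⟶ Y _⦋1⦌) (α : Bigon Y Z₁) : Prop where
  iso_zero : IsIso (f.app (op ⦋0⦌))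
  surjSubmersion_left : IsSurjSubmersion g₁
  surjSubmersion_right : IsSurjSubmersion h₁
  acts : α.Acts h₁ (g₁ ≫ f.app (op ⦋1⦌))
  iso_two : IsIsoOnto _ (boundaryRestriction f 2)

/-- The presheaf `hom(Λ[2,1], K) ×_{hom(Λ[2,1], Y)} Y_2`. -/
abbrev hornPullback {K Y : SimplicialObject BanMfd.{u}} (f : K ⟶ Y) : BanMfd.{u}ᵒᵖ ⥤ Type u :=
  relPresheaf (Λ[2, 1].ι : (Λ[2, 1] : SSet.{u}) ⟶ Δ[2]) f

/-- Given
* `f : K ⟶ Y`, a manifold `X₁` and a smooth map `i : X₁ ⟶ K_1`,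
* manifolds `P = hom(Λ[2,1], K) ×_{hom(Λ[2,1], Y)} Y_2` and `Q = X₁ ×_{Y_1, d_0} b(Y_2)`
  (via `rP` and `rQ`),
* a morphism `μ : hom(Λ[2,1], K) → K_1` and a smooth map `α' : P → b(Y_2)`. -/
structure HornData {K Y : SimplicialObject BanMfd.{u}} (f : K ⟶ Y) : Type (u + 1) where
  X₁ : BanMfd.{u}
  i : X₁ ⟶ K _⦋1⦌
  P : BanMfd.{u}
  rP : (hornPullback f).RepresentableBy P
  Q : BanMfd.{u}
  rQ : (bigonPullback (i ≫ f.app (op ⦋1⦌))).RepresentableBy Q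
  μ : homPresheaf (Λ[2, 1] : SSet.{u}) K ⟶ yoneda.obj (K _⦋1⦌)
  α' : Bigon Y P

namespace HornData

variable {K Y : SimplicialObject BanMfd.{u}} {f : K ⟶ Y} (D : HornData f)

/-- The composed map `P → hom(Λ[2,1], K) → K_1`, the second map being `μ`. -/
def g' : D.P ⟶ K _⦋1⦌ :=
  D.μ.app (op D.P) (D.rP.homEquiv (𝟙 D.P)).1.1

/-- The composed map `P → Y_2 → Y_1`, the second map being `d_1`. -/
def h' : D.P ⟶ Y _⦋1⦌ :=
  SSet.yonedaEquiv (D.rP.homEquiv (𝟙 D.P)).1.2 ≫ Y.δ (1 : Fin 3)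

/-- The projection `Q → X₁`. -/
def prX₁ : D.Q ⟶ D.X₁ := (D.rQ.homEquiv (𝟙 D.Q)).1.1

/-- The projection `Q → b(Y_2)`. -/
def prBigon : Bigon Y D.Q := (D.rQ.homEquiv (𝟙 D.Q)).1.2

/-- The manifold `Z₁ = P ⊔ Q`. -/
noncomputable def Z₁ : BanMfd.{u} := BanMfd.sum D.P D.Q

/-- The map `g' ⊔ pr_{X₁} : Z₁ → K_1`. -/
def g₁ : D.Z₁ ⟶ K _⦋1⦌ := BanMfd.sumDesc D.g' (D.prX₁ ≫ D.i)

/-- The map `h' ⊔ d_1 ∘ pr_{b(Y_2)} : Z₁ → Y_1`. -/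
def h₁ : D.Z₁ ⟶ Y _⦋1⦌ := BanMfd.sumDesc D.h' D.prBigon.source

/-- The map `α' ⊔ pr_{b(Y_2)} : Z₁ → b(Y_2)`. -/
def α : Bigon Y D.Z₁ := Bigon.sumDesc D.α' D.prBigon

/-- The conditions on the data. -/
structure Conditions : Prop where
  iso_zero : IsIso (f.app (op ⦋0⦌))
  submersion : IsSubmersion (D.i ≫ f.app (op ⦋1⦌))
  surjSubmersion_h' : IsSurjSubmersion D.h'
  acts : D.α'.Acts D.h' (D.g' ≫ f.app (op ⦋1⦌))
  surjSubmersion_g₁ : IsSurjSubmersion D.g₁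
  iso_two : IsIsoOnto _ (boundaryRestriction f 2)

end HornData

end SimplicialMfd

/-! For (I), the Morita equivalence is realised by the path fibre product Z = K ×_Y Y^I, where Y^I
is the path object with respect to Δ[1] and Y^I → Y is evaluation at the vertex 0. The two legs are
the projection Z → K and the evaluation Z → Y at the vertex 1.

The inclusion of {ε} × Δ[k] ∪ Δ[1] × ∂Δ[k] in Δ[1] × Δ[k] is a finite composite of horn attachments
of dimension > k (`unionProd_horn_boundary_mem`). The Kan conditions of Y therefore give both
evaluations Y^I → Y the hypercover property, with isomorphisms for k ≥ 2 (`relClass_pathEval`). The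
leg Z → K inherits this by base change, and so Z is a Lie 2-groupoid (`exists_isLieGroupoid`).

The leg Z → Y is Z → Y^I, a base change of f, followed by evaluation. For k = 0 and k = 2 the
isomorphism conditions on f settle the matter. Only k = 1 involves the span and the bigons. An edge
of Z is an edge of K together with a square in Y, one side of which is the image of that edge. Given
the other three sides, one triangle of the square is filled by Kan(2,1). What remains is a base
change of K_1 ×_{Y_1,d_2} Y_2 → hom(Λ[2,2], Y) (`isPullback_toPartialSquare`).

To see that this map is a surjective submersion, take a 2-simplex with first edge h₁(z). Composition
with the bigon α(z), through a unique filler of a 3-dimensional horn, turns it into one with first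
edge f(g₁(z)) and the same two other edges. The space of these fillers maps to K_1 ×_{Y_1} Y_2 by a
base change of g₁, and to Y_2 by a base change of h₁. Both routes to hom(Λ[2,2], Y) agree, and the
one through Y_2 is a surjective submersion; so descent along the base change of g₁ finishes the
argument (`BigonSpan.descent_mem`).

Descent and base change rest on one fact about Banach manifolds: a smooth map is a submersion
exactly when smooth germs of sections pass through all points of its source (`isSubmersion_iff`).
Limits are handled as presheaves, with "surjective submersion" read as relative representability, so
that no fibre product has to be formed before it is known to exist.

For (II), the only analytic point is that d_1 is a submersion on Q. This map is a base change of X₁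
→ Y_1 followed by the source map of bigons, which is a base change of Y_2 → hom(Λ[2,0], Y). -/

namespace BanMfd

/-! ### Pointwise smoothness -/

/-- Smoothness (`C^∞`) of a map of Banach manifolds at a point. -/
def SmoothAt {M N : BanMfd.{u}} (f : M → N) (x : M) : Prop :=
  ContinuousAt f x ∧ ∀ c ∈ M.atlas, ∀ d ∈ N.atlas, x ∈ c.φ.source → f x ∈ d.φ.source →
    ContDiffAt ℝ ∞ (d.φ ∘ f ∘ c.φ.symm) (c.φ x)

theorem isSmooth_iff_smoothAt {M N : BanMfd.{u}} {f : M → N} :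
    IsSmooth f ↔ ∀ x, SmoothAt f x :=
  ⟨fun h x => ⟨h.1.continuousAt, fun c hc d hd hx hx' => h.2 c hc d hd x hx hx'⟩,
    fun h => ⟨continuous_iff_continuousAt.2 fun x => (h x).1,
      fun c hc d hd x hx hx' => (h x).2 c hc d hd hx hx'⟩⟩

theorem IsSmooth.smoothAt {M N : BanMfd.{u}} {f : M → N} (hf : IsSmooth f) (x : M) :
    SmoothAt f x :=
  isSmooth_iff_smoothAt.1 hf x

theorem SmoothAt.comp {M N P : BanMfd.{u}} {g : N → P} {f : M → N} {x : M}
    (hg : SmoothAt g (f x)) (hf : SmoothAt f x) : SmoothAt (fun x => g (f x)) x := by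
  refine ⟨hg.1.comp hf.1, fun c hc d hd hx hx' => ?_⟩
  obtain ⟨e, he, hxe⟩ := N.exists_mem_source (f x)
  have h1 := hf.2 c hc e he hx hxe
  have h2 := hg.2 e he d hd hxe hx'
  have hx0 : c.φ.symm (c.φ x) = x := c.φ.left_inv hx
  have h2' : ContDiffAt ℝ ∞ (d.φ ∘ g ∘ e.φ.symm) ((e.φ ∘ f ∘ c.φ.symm) (c.φ x)) := by
    simpa [hx0] using h2
  refine (h2'.comp (c.φ x) h1).congr_of_eventuallyEq ?_
  have hcont : ContinuousAt (fun y => f (c.φ.symm y)) (c.φ x) :=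
    ContinuousAt.comp (g := f) (by rw [hx0]; exact hf.1)
      (c.φ.continuousAt_symm (c.φ.map_source hx))
  have hmem : e.φ.source ∈ 𝓝 (f (c.φ.symm (c.φ x))) := by
    rw [hx0]; exact e.φ.open_source.mem_nhds hxe
  filter_upwards [hcont hmem] with y hy
  have hy' : f (c.φ.symm y) ∈ e.φ.source := hy
  simp [e.φ.left_inv hy']

theorem SmoothAt.congr {M N : BanMfd.{u}} {f g : M → N} {x : M} (hf : SmoothAt f x)
    (h : g =ᶠ[𝓝 x] f) : SmoothAt g x := by
  refine ⟨hf.1.congr_of_eventuallyEq h, fun c hc d hd hx hx' => ?_⟩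
  refine (hf.2 c hc d hd hx (h.eq_of_nhds ▸ hx')).congr_of_eventuallyEq ?_
  have hx0 : c.φ.symm (c.φ x) = x := c.φ.left_inv hx
  have hc' := c.φ.continuousAt_symm (c.φ.map_source hx)
  rw [ContinuousAt, hx0] at hc'
  filter_upwards [hc' h] with y hy
  exact congrArg d.φ hy

theorem smoothAt_id {M : BanMfd.{u}} (x : M) : SmoothAt (fun x : M => x) x :=
  (isSmooth_id M).smoothAt x

/-- A Banach space as a Banach manifold. -/
def model (E : Type u) [NormedAddCommGroup E] [NormedSpace ℝ E] [CompleteSpace E] :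
    BanMfd.{u} where
  carrier := E
  atlas := {⟨E, OpenPartialHomeomorph.refl E⟩}
  exists_mem_source x := ⟨⟨E, OpenPartialHomeomorph.refl E⟩, rfl, Set.mem_univ x⟩
  smoothChange := by
    rintro _ rfl _ rfl x - -
    exact contDiffAt_id

section model

variable {E F G : Type u} [NormedAddCommGroup E] [NormedSpace ℝ E] [CompleteSpace E]
  [NormedAddCommGroup F] [NormedSpace ℝ F] [CompleteSpace F]
  [NormedAddCommGroup G] [NormedSpace ℝ G] [CompleteSpace G]

theorem smoothAt_model_iff {f : E → F} {x : E} :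
    SmoothAt (M := model E) (N := model F) f x ↔ ContDiffAt ℝ ∞ f x := by
  constructor
  · intro h
    exact h.2 _ rfl _ rfl trivial trivial
  · intro h
    refine ⟨h.continuousAt, ?_⟩
    rintro _ rfl _ rfl - -
    exact h

theorem SmoothAt.prodMk {M : BanMfd.{u}} {f : M → E} {g : M → F} {x : M}
    (hf : SmoothAt (N := model E) f x) (hg : SmoothAt (N := model F) g x) :
    SmoothAt (N := model (E × F)) (fun y => (f y, g y)) x := by
  refine ⟨ContinuousAt.prodMk hf.1 hg.1, ?_⟩
  rintro c hc _ rfl hx -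
  exact (hf.2 c hc _ rfl hx trivial).prodMk (hg.2 c hc _ rfl hx trivial)

theorem SmoothAt.fst {M : BanMfd.{u}} {f : M → E × F} {x : M}
    (hf : SmoothAt (N := model (E × F)) f x) : SmoothAt (N := model E) (fun y => (f y).1) x :=
  SmoothAt.comp (N := model (E × F)) (P := model E) (g := Prod.fst)
    (smoothAt_model_iff.2 contDiffAt_fst) hf

theorem SmoothAt.snd {M : BanMfd.{u}} {f : M → E × F} {x : M}
    (hf : SmoothAt (N := model (E × F)) f x) : SmoothAt (N := model F) (fun y => (f y).2) x :=
  SmoothAt.comp (N := model (E × F)) (P := model F) (g := Prod.snd)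
    (smoothAt_model_iff.2 contDiffAt_snd) hf

end model

theorem isChart_of_mem {M : BanMfd.{u}} {c : BanachChart M} (hc : c ∈ M.atlas) : M.IsChart c :=
  fun d hd => ⟨M.smoothChange c hc d hd, M.smoothChange d hd c hc⟩

theorem IsChart.smoothAt {M : BanMfd.{u}} {c : BanachChart M} (hc : M.IsChart c) {x : M}
    (hx : x ∈ c.φ.source) : SmoothAt (N := model c.E) c.φ x := by
  refine ⟨c.φ.continuousAt hx, ?_⟩
  rintro d hd _ rfl hx' -
  exact (hc d hd).2 x hx' hx

theorem IsChart.smoothAt_symm {M : BanMfd.{u}} {c : BanachChart M} (hc : M.IsChart c) {y : c.E}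
    (hy : y ∈ c.φ.target) : SmoothAt (M := model c.E) c.φ.symm y := by
  refine ⟨c.φ.continuousAt_symm hy, ?_⟩
  rintro _ rfl d hd - hx'
  have := (hc d hd).1 (c.φ.symm y) (c.φ.map_target hy) hx'
  rw [c.φ.right_inv hy] at this
  exact this

theorem isChart_of_smoothAt {M : BanMfd.{u}} {c : BanachChart M}
    (h : ∀ x ∈ c.φ.source, SmoothAt (N := model c.E) c.φ x)
    (h' : ∀ y ∈ c.φ.target, SmoothAt (M := model c.E) c.φ.symm y) : M.IsChart c := by
  refine fun d hd => ⟨fun x hx hx' => ?_, fun x hx hx' => ?_⟩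
  · exact (h' _ (c.φ.map_source hx)).2 _ rfl d hd trivial (by rwa [c.φ.left_inv hx])
  · exact (h x hx').2 d hd _ rfl hx trivial

theorem smoothAt_of_chart {M N : BanMfd.{u}} {f : M → N} {x : M} {e : BanachChart N}
    (he : N.IsChart e) (hf : ContinuousAt f x) (hx : f x ∈ e.φ.source)
    (h : SmoothAt (N := model e.E) (fun y => e.φ (f y)) x) : SmoothAt f x := by
  refine (SmoothAt.comp (N := model e.E) (g := e.φ.symm) (f := fun y => e.φ (f y))
    (he.smoothAt_symm (e.φ.map_source hx)) h).congr ?_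
  filter_upwards [hf (e.φ.open_source.mem_nhds hx)] with y hy
  exact (e.φ.left_inv hy).symm

/-! ### Submersions and local sections -/

/-- Through every point of `M` there is a germ of a smooth section of `f`. -/
def HasLocalSections {M N : BanMfd.{u}} (f : M ⟶ N) : Prop :=
  ∀ x : M, ∃ σ : N → M, SmoothAt σ (f.1 x) ∧ σ (f.1 x) = x ∧ ∀ᶠ y in 𝓝 (f.1 x), f.1 (σ y) = y

/-- In coordinates where the map is a projection E × F → E, the section keeps the F-coordinate of
the given point fixed. -/
theorem IsSubmersion.hasLocalSections {M N : BanMfd.{u}} {f : M ⟶ N} (hf : IsSubmersion f) :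
    HasLocalSections f := by
  intro x
  obtain ⟨E, F, _, _, _, _, _, _, φ, ψ, hφ, hψ, hx, h⟩ := hf x
  have hfx := h x hx
  have hmk : SmoothAt (N := model (E × F)) (fun y => (ψ y, (φ x).2)) (f.1 x) := by
    refine SmoothAt.prodMk (hψ.smoothAt hfx.1) ?_
    refine ⟨continuousAt_const, ?_⟩
    rintro c hc _ rfl - -
    exact contDiffAt_const
  have heq : (ψ (f.1 x), (φ x).2) = φ x := by rw [hfx.2]
  refine ⟨fun y => φ.symm (ψ y, (φ x).2), ?_, ?_, ?_⟩
  · refine SmoothAt.comp (N := model (E × F)) (g := φ.symm) ?_ hmk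
    rw [heq]
    exact hφ.smoothAt_symm (φ.map_source hx)
  · change φ.symm (ψ (f.1 x), (φ x).2) = x
    rw [heq, φ.left_inv hx]
  · have h1 : ∀ᶠ y : N in 𝓝 (f.1 x), (ψ y, (φ x).2) ∈ φ.target := by
      refine hmk.1 (φ.open_target.mem_nhds ?_)
      change (ψ (f.1 x), (φ x).2) ∈ _
      rw [heq]
      exact φ.map_source hx
    filter_upwards [h1, ψ.open_source.mem_nhds hfx.1] with y hy hy'
    have h2 := h _ (φ.map_target hy)
    rw [φ.right_inv hy] at h2
    exact ψ.injOn h2.1 hy' h2.2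

/-- A smooth map between open subsets of Banach spaces whose derivative at `a` has a right inverse
is, in suitable coordinates near `a`, a linear projection. -/
theorem exists_straightening {E F : Type u} [NormedAddCommGroup E] [NormedSpace ℝ E]
    [CompleteSpace E] [NormedAddCommGroup F] [NormedSpace ℝ F] [CompleteSpace F]
    {f : E → F} {s : Set E} (hs : IsOpen s) (hf : ∀ x ∈ s, ContDiffAt ℝ ∞ f x) {a : E} (ha : a ∈ s)
    {f' : E →L[ℝ] F} (hf' : HasFDerivAt f f' a) {g' : F →L[ℝ] E}
    (hg' : Function.RightInverse g' f') :
    ∃ (K : Type u) (_ : NormedAddCommGroup K) (_ : NormedSpace ℝ K) (_ : CompleteSpace K)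
      (h : OpenPartialHomeomorph E (F × K)), a ∈ h.source ∧ h.source ⊆ s ∧
        (∀ x, (h x).1 = f x) ∧ (∀ x ∈ h.source, ContDiffAt ℝ ∞ h x) ∧
        ∀ y ∈ h.target, ContDiffAt ℝ ∞ h.symm y := by
  obtain ⟨π, hπ⟩ := ContinuousLinearMap.closedComplemented_ker_of_rightInverse f' g' hg'
  have hcl : IsClosed (f'.ker : Set E) := f'.isClosed_ker
  have : CompleteSpace f'.ker := hcl.completeSpace_coe
  -- The right inverse complements the kernel, so f' together with the projection π onto it is an
  -- isomorphism, and the inverse function theorem applies to (f, π).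
  let P : E →L[ℝ] F × f'.ker := f'.prod π
  have hinj : P.ker = ⊥ := by
    rw [LinearMap.ker_eq_bot']
    intro x hx
    have h1 : f' x = 0 := congrArg Prod.fst hx
    have h2 : π x = 0 := congrArg Prod.snd hx
    have h3 := hπ ⟨x, h1⟩
    exact (congrArg Subtype.val (h3.symm.trans h2))
  have hsurj : P.range = ⊤ := by
    rw [LinearMap.range_eq_top]
    rintro ⟨y, k⟩
    refine ⟨g' y - (π (g' y) : E) + k, ?_⟩
    have hk (k : f'.ker) : f' (k : E) = 0 := k.2
    refine Prod.ext ?_ ?_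
    · change f' (g' y - (π (g' y) : E) + k) = y
      rw [map_add, map_sub, hk, hk, hg' y]; simp
    · change π (g' y - (π (g' y) : E) + k) = k
      rw [map_add, map_sub, hπ, hπ]; simp
  let e : E ≃L[ℝ] F × f'.ker := ContinuousLinearEquiv.ofBijective P hinj hsurj
  have he : (e : E →L[ℝ] F × f'.ker) = P := ContinuousLinearEquiv.coe_ofBijective P hinj hsurj
  let H : E → F × f'.ker := fun x => (f x, π x)
  have hH (x) (hx : x ∈ s) : ContDiffAt ℝ ∞ H x := (hf x hx).prodMk π.contDiff.contDiffAt
  have hHa : HasFDerivAt H (e : E →L[ℝ] F × f'.ker) a := by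
    rw [he]; exact hf'.prodMk π.hasFDerivAt
  let h₀ := (hH a ha).toOpenPartialHomeomorph H hHa (by simp)
  have hcont : ContinuousOn (fderiv ℝ H) s := fun x hx =>
    ((hH x hx).fderiv_right (m := 0) (by norm_cast)).continuousAt.continuousWithinAt
  -- Smoothness of the inverse needs an invertible derivative at every point of the source, not only
  -- at a. This is an open condition, and the source is cut down to it.
  have hopen : IsOpen (s ∩ fderiv ℝ H ⁻¹'
      Set.range (ContinuousLinearEquiv.toContinuousLinearMap (σ₁₂ := RingHom.id ℝ)
        (M₁ := E) (M₂ := F × f'.ker))) :=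
    hcont.isOpen_inter_preimage hs ContinuousLinearEquiv.isOpen
  refine ⟨f'.ker, inferInstance, inferInstance, inferInstance, h₀.restrOpen _ hopen,
    ⟨(hH a ha).mem_toOpenPartialHomeomorph_source hHa (by simp), ha, ?_⟩,
    fun x hx => hx.2.1, fun x => rfl, fun x hx => hH x hx.2.1, ?_⟩
  · exact ⟨e, hHa.fderiv.symm⟩
  · intro y hy
    have hy' := (h₀.restrOpen _ hopen).map_target hy
    obtain ⟨e', he'⟩ := hy'.2.2
    refine OpenPartialHomeomorph.contDiffAt_symm (f₀' := e') _ hy ?_ (hH _ hy'.2.1)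
    rw [he']
    exact ((hH _ hy'.2.1).differentiableAt (by simp)).hasFDerivAt

/-- In charts, the chain rule makes the derivative of the section a bounded right inverse of the
derivative of the map, which is the hypothesis of `exists_straightening`. -/
theorem HasLocalSections.isSubmersion {M N : BanMfd.{u}} {f : M ⟶ N} (hf : HasLocalSections f) :
    IsSubmersion f := by
  intro x
  obtain ⟨σ, hσ, hσx, hσf⟩ := hf x
  obtain ⟨c, hc, hxc⟩ := M.exists_mem_source x
  obtain ⟨d, hd, hxd⟩ := N.exists_mem_source (f.1 x)
  have hf0 : IsSmooth f.1 := f.2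
  let f₀ : c.E → d.E := fun y => d.φ (f.1 (c.φ.symm y))
  let s : Set c.E := c.φ.target ∩ c.φ.symm ⁻¹' (f.1 ⁻¹' d.φ.source)
  have hs : IsOpen s := c.φ.symm.isOpen_inter_preimage (d.φ.open_source.preimage hf0.1)
  have hcx : c.φ.symm (c.φ x) = x := c.φ.left_inv hxc
  have ha : c.φ x ∈ s := ⟨c.φ.map_source hxc, by
    change f.1 (c.φ.symm (c.φ x)) ∈ d.φ.source; rwa [hcx]⟩
  have hf₀ : ∀ y ∈ s, ContDiffAt ℝ ∞ f₀ y := by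
    intro y hy
    have := hf0.2 c hc d hd (c.φ.symm y) (c.φ.map_target hy.1) hy.2
    rwa [c.φ.right_inv hy.1] at this
  have hfa := ((hf₀ _ ha).differentiableAt (by simp)).hasFDerivAt
  let g₀ : d.E → c.E := fun y => c.φ (σ (d.φ.symm y))
  have hdx : d.φ.symm (d.φ (f.1 x)) = f.1 x := d.φ.left_inv hxd
  have hg₀ : ContDiffAt ℝ ∞ g₀ (d.φ (f.1 x)) := hσ.2 d hd c hc hxd (by rwa [hσx])
  have hga := (hg₀.differentiableAt (by simp)).hasFDerivAt
  have hg₀x : g₀ (d.φ (f.1 x)) = c.φ x := by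
    change c.φ (σ (d.φ.symm (d.φ (f.1 x)))) = _
    rw [hdx, hσx]
  have hcomp : f₀ ∘ g₀ =ᶠ[𝓝 (d.φ (f.1 x))] id := by
    have h1 : Filter.Tendsto d.φ.symm (𝓝 (d.φ (f.1 x))) (𝓝 (f.1 x)) := by
      have := d.φ.continuousAt_symm (d.φ.map_source hxd)
      rwa [ContinuousAt, hdx] at this
    have h2 : ∀ᶠ y : N in 𝓝 (f.1 x), σ y ∈ c.φ.source :=
      hσ.1 (c.φ.open_source.mem_nhds (by rwa [hσx]))
    filter_upwards [h1 hσf, h1 h2, d.φ.open_target.mem_nhds (d.φ.map_source hxd)] with y h3 h4 h5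
    change d.φ (f.1 (c.φ.symm (c.φ (σ (d.φ.symm y))))) = y
    rw [c.φ.left_inv h4]
    change f.1 (σ (d.φ.symm y)) = d.φ.symm y at h3
    rw [h3, d.φ.right_inv h5]
  have hder : HasFDerivAt (f₀ ∘ g₀) _ (d.φ (f.1 x)) := (hg₀x ▸ hfa).comp _ hga
  have hid := (hder.congr_of_eventuallyEq hcomp.symm).unique (hasFDerivAt_id _)
  obtain ⟨K, _, _, _, h, hah, hhs, hh1, hh2, hh3⟩ := exists_straightening hs hf₀ ha hfa
    (g' := fderiv ℝ g₀ (d.φ (f.1 x)))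
    (fun y => by simpa [hg₀x] using DFunLike.congr_fun hid y)
  refine ⟨d.E, K, inferInstance, inferInstance, inferInstance, inferInstance, inferInstance,
    inferInstance, c.φ.trans h, d.φ, ?_, isChart_of_mem hd, ?_, ?_⟩
  · refine isChart_of_smoothAt ?_ ?_
    · intro y hy
      have hy : y ∈ (c.φ.trans h).source := hy
      rw [OpenPartialHomeomorph.trans_source] at hy
      exact SmoothAt.comp (N := model c.E) (P := model (d.E × K)) (g := h)
        (smoothAt_model_iff.2 (hh2 _ hy.2)) ((isChart_of_mem hc).smoothAt hy.1)
    · intro y hy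
      have hy : y ∈ (c.φ.trans h).target := hy
      rw [OpenPartialHomeomorph.trans_target] at hy
      exact SmoothAt.comp (M := model (d.E × K)) (N := model c.E) (g := c.φ.symm) (f := h.symm)
        ((isChart_of_mem hc).smoothAt_symm hy.2) (smoothAt_model_iff.2 (hh3 _ hy.1))
  · rw [OpenPartialHomeomorph.trans_source]
    exact ⟨hxc, hah⟩
  · intro y hy
    rw [OpenPartialHomeomorph.trans_source] at hy
    have hys := hhs hy.2
    have hyc : c.φ.symm (c.φ y) = y := c.φ.left_inv hy.1
    refine ⟨?_, ?_⟩
    · have := hys.2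
      rwa [Set.mem_preimage, hyc] at this
    · change _ = (h (c.φ y)).1
      rw [hh1]
      change _ = d.φ (f.1 (c.φ.symm (c.φ y)))
      rw [hyc]

theorem isSubmersion_iff {M N : BanMfd.{u}} {f : M ⟶ N} :
    IsSubmersion f ↔ HasLocalSections f :=
  ⟨fun h => h.hasLocalSections, fun h => h.isSubmersion⟩

theorem IsSubmersion.comp {M N P : BanMfd.{u}} {f : M ⟶ N} {g : N ⟶ P} (hf : IsSubmersion f)
    (hg : IsSubmersion g) : IsSubmersion (f ≫ g) := by
  rw [isSubmersion_iff] at *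
  intro x
  obtain ⟨σ, h1, h2, h3⟩ := hf x
  obtain ⟨τ, k1, k2, k3⟩ := hg (f.1 x)
  refine ⟨fun y => σ (τ y), SmoothAt.comp (by
    change SmoothAt σ (τ (g.1 (f.1 x)))
    rw [k2]; exact h1) k1, ?_, ?_⟩
  · change σ (τ (g.1 (f.1 x))) = x
    rw [k2, h2]
  · have := k1.1.tendsto
    rw [k2] at this
    filter_upwards [k3, this h3] with y hy hy'
    change g.1 (f.1 (σ (τ y))) = y
    have hy' : f.1 (σ (τ y)) = τ y := hy'
    rw [hy', hy]

/-- Push local sections of the composite forward along f. Surjectivity of f is enough to reach every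
point of N. -/
theorem isSubmersion_of_comp {M N P : BanMfd.{u}} {f : M ⟶ N} {g : N ⟶ P}
    (hf : Function.Surjective f.1) (h : IsSubmersion (f ≫ g)) : IsSubmersion g := by
  rw [isSubmersion_iff] at *
  intro y
  obtain ⟨x, rfl⟩ := hf y
  obtain ⟨σ, h1, h2, h3⟩ := h x
  exact ⟨fun y => f.1 (σ y), SmoothAt.comp (f.2.smoothAt _) h1, congrArg f.1 h2, h3⟩

theorem isSubmersion_of_isIso {M N : BanMfd.{u}} (f : M ⟶ N) [IsIso f] : IsSubmersion f := by
  rw [isSubmersion_iff]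
  intro x
  refine ⟨(inv f).1, (inv f).2.smoothAt _, ?_, Filter.Eventually.of_forall fun y => ?_⟩
  · exact congrFun (congrArg Subtype.val (IsIso.hom_inv_id f)) x
  · exact congrFun (congrArg Subtype.val (IsIso.inv_hom_id f)) y

theorem surjective_of_isIso {M N : BanMfd.{u}} (f : M ⟶ N) [IsIso f] :
    Function.Surjective f.1 :=
  fun y => ⟨(inv f).1 y, congrFun (congrArg Subtype.val (IsIso.inv_hom_id f)) y⟩

end BanMfd
namespace BanMfd

/-! ### Pullbacks along submersions -/

section fiberProduct

variable {M N T : BanMfd.{u}} (f : M ⟶ N) (g : T ⟶ N)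

/-- The set underlying the fibre product of `f` and `g`. -/
abbrev FiberProduct : Type u := {p : M × T // f.1 p.1 = g.1 p.2}

variable {f g}

open Classical in
/-- The chart of the fibre product of `f` and `g` around `p₀` which is determined by a chart
`c` of `T` and charts `φ`, `ψ` in which `f` is a projection. -/
noncomputable def fiberProductChart {E F : Type u} [NormedAddCommGroup E] [NormedSpace ℝ E]
    [CompleteSpace E] [NormedAddCommGroup F] [NormedSpace ℝ F] [CompleteSpace F]
    {φ : OpenPartialHomeomorph M (E × F)} {ψ : OpenPartialHomeomorph N E}
    (h : ∀ y ∈ φ.source, f.1 y ∈ ψ.source ∧ ψ (f.1 y) = (φ y).1) (c : BanachChart T)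
    (p₀ : FiberProduct f g) :
    OpenPartialHomeomorph (FiberProduct f g) (c.E × F) where
  toFun p := (c.φ p.1.2, (φ p.1.1).2)
  -- The condition holds on the whole target; p₀ is a junk value elsewhere.
  invFun z := if hz : f.1 (φ.symm (ψ (g.1 (c.φ.symm z.1)), z.2)) = g.1 (c.φ.symm z.1) then
    ⟨(φ.symm (ψ (g.1 (c.φ.symm z.1)), z.2), c.φ.symm z.1), hz⟩ else p₀
  source := {p | p.1.1 ∈ φ.source ∧ p.1.2 ∈ c.φ.source}
  target := {z | z.1 ∈ c.φ.target ∧ g.1 (c.φ.symm z.1) ∈ ψ.source ∧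
    (ψ (g.1 (c.φ.symm z.1)), z.2) ∈ φ.target}
  map_source' := by
    rintro ⟨⟨m, t⟩, hp⟩ ⟨hm, ht⟩
    have hp : f.1 m = g.1 t := hp
    have ht' : c.φ.symm (c.φ t) = t := c.φ.left_inv ht
    refine ⟨c.φ.map_source ht, ?_, ?_⟩
    · change g.1 (c.φ.symm (c.φ t)) ∈ ψ.source
      rw [ht', ← hp]
      exact (h m hm).1
    · change (ψ (g.1 (c.φ.symm (c.φ t))), (φ m).2) ∈ φ.target
      rw [ht', ← hp, (h m hm).2]
      exact φ.map_source hm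
  map_target' := by
    rintro ⟨z, v⟩ ⟨h1, h2, h3⟩
    have h4 := h _ (φ.map_target h3)
    rw [φ.right_inv h3] at h4
    -- Both points of N lie in the source of ψ and have the same E-coordinate, so they coincide and
    -- the pair lies in the fibre product.
    have h5 := ψ.injOn h4.1 h2 h4.2
    rw [dif_pos h5]
    exact ⟨φ.map_target h3, c.φ.map_target h1⟩
  left_inv' := by
    rintro ⟨⟨m, t⟩, hp⟩ ⟨hm, ht⟩
    have hp : f.1 m = g.1 t := hp
    have ht' : c.φ.symm (c.φ t) = t := c.φ.left_inv ht
    have key : φ.symm (ψ (g.1 (c.φ.symm (c.φ t))), (φ m).2) = m := by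
      rw [ht', ← hp, (h m hm).2]
      exact φ.left_inv hm
    have hz : f.1 (φ.symm (ψ (g.1 (c.φ.symm (c.φ t))), (φ m).2)) = g.1 (c.φ.symm (c.φ t)) := by
      rw [key, ht', hp]
    change dite (f.1 (φ.symm (ψ (g.1 (c.φ.symm (c.φ t))), (φ m).2)) = g.1 (c.φ.symm (c.φ t)))
      _ _ = _
    rw [dif_pos hz]
    exact Subtype.ext (Prod.ext key ht')
  right_inv' := by
    rintro ⟨z, v⟩ ⟨h1, h2, h3⟩
    have h4 := h _ (φ.map_target h3)
    rw [φ.right_inv h3] at h4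
    have h5 := ψ.injOn h4.1 h2 h4.2
    rw [dif_pos h5]
    have h6 : (φ (φ.symm (ψ (g.1 (c.φ.symm z)), v))).2 = v := by rw [φ.right_inv h3]
    exact Prod.ext (c.φ.right_inv h1) h6
  open_source := (φ.open_source.preimage (continuous_fst.comp continuous_subtype_val)).inter
    (c.φ.open_source.preimage (continuous_snd.comp continuous_subtype_val))
  open_target := by
    have hg : Continuous g.1 := g.2.1
    have h1 : IsOpen ({z | z.1 ∈ c.φ.target} : Set (c.E × F)) :=
      c.φ.open_target.preimage continuous_fst
    have h2 : ContinuousOn (fun z : c.E × F => g.1 (c.φ.symm z.1)) {z | z.1 ∈ c.φ.target} :=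
      hg.comp_continuousOn (c.φ.continuousOn_symm.comp continuousOn_fst fun z hz => hz)
    have h3 := h2.isOpen_inter_preimage h1 ψ.open_source
    have h4 : ContinuousOn (fun z : c.E × F => (ψ (g.1 (c.φ.symm z.1)), z.2))
        ({z | z.1 ∈ c.φ.target} ∩ (fun z : c.E × F => g.1 (c.φ.symm z.1)) ⁻¹' ψ.source) :=
      (ψ.continuousOn.comp (h2.mono Set.inter_subset_left) fun z hz => hz.2).prodMk
        continuousOn_snd
    have h5 := h4.isOpen_inter_preimage h3 φ.open_target
    rwa [Set.inter_assoc] at h5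
  continuousOn_toFun := by
    refine ContinuousOn.prodMk ?_ ?_
    · exact c.φ.continuousOn.comp (continuous_snd.comp continuous_subtype_val).continuousOn
        fun p hp => hp.2
    · exact continuous_snd.comp_continuousOn (φ.continuousOn.comp
        (continuous_fst.comp continuous_subtype_val).continuousOn fun p hp => hp.1)
  continuousOn_invFun := by
    refine Topology.IsInducing.subtypeVal.continuousOn_iff.2 ?_
    have hg : Continuous g.1 := g.2.1
    have h2 : ContinuousOn (fun z : c.E × F => c.φ.symm z.1) {z | z.1 ∈ c.φ.target} :=
      c.φ.continuousOn_symm.comp continuousOn_fst fun z hz => hz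
    have h4 : ContinuousOn (fun z : c.E × F =>
        (φ.symm (ψ (g.1 (c.φ.symm z.1)), z.2), c.φ.symm z.1))
        {z | z.1 ∈ c.φ.target ∧ g.1 (c.φ.symm z.1) ∈ ψ.source ∧
          (ψ (g.1 (c.φ.symm z.1)), z.2) ∈ φ.target} := by
      refine ContinuousOn.prodMk ?_ (h2.mono fun z hz => hz.1)
      refine φ.continuousOn_symm.comp (ContinuousOn.prodMk ?_ continuousOn_snd) fun z hz => hz.2.2
      exact ψ.continuousOn.comp (hg.comp_continuousOn (h2.mono fun z hz => hz.1))
        fun z hz => hz.2.1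
    refine h4.congr ?_
    rintro ⟨z, v⟩ ⟨h1, h2, h3⟩
    have h4 := h _ (φ.map_target h3)
    rw [φ.right_inv h3] at h4
    have h5 := ψ.injOn h4.1 h2 h4.2
    simp only [Function.comp_apply]
    rw [dif_pos h5]

theorem fiberProductChart_symm {E F : Type u} [NormedAddCommGroup E] [NormedSpace ℝ E]
    [CompleteSpace E] [NormedAddCommGroup F] [NormedSpace ℝ F] [CompleteSpace F]
    {φ : OpenPartialHomeomorph M (E × F)} {ψ : OpenPartialHomeomorph N E}
    (h : ∀ y ∈ φ.source, f.1 y ∈ ψ.source ∧ ψ (f.1 y) = (φ y).1) (c : BanachChart T)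
    (p₀ : FiberProduct f g) {z : c.E × F} (hz : z ∈ (fiberProductChart h c p₀).target) :
    ((fiberProductChart h c p₀).symm z).1 =
      (φ.symm (ψ (g.1 (c.φ.symm z.1)), z.2), c.φ.symm z.1) := by
  obtain ⟨h1, h2, h3⟩ := hz
  have h4 := h _ (φ.map_target h3)
  rw [φ.right_inv h3] at h4
  have h5 := ψ.injOn h4.1 h2 h4.2
  classical
  change (dite (f.1 (φ.symm (ψ (g.1 (c.φ.symm z.1)), z.2)) = g.1 (c.φ.symm z.1)) _ _ :
    FiberProduct f g).1 = _
  rw [dif_pos h5]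

/-- The components of the inverse of `fiberProductChart` are smooth. -/
theorem smoothAt_fiberProductChart_symm {E F : Type u} [NormedAddCommGroup E] [NormedSpace ℝ E]
    [CompleteSpace E] [NormedAddCommGroup F] [NormedSpace ℝ F] [CompleteSpace F]
    {φ : OpenPartialHomeomorph M (E × F)} {ψ : OpenPartialHomeomorph N E}
    (hφ : M.IsChart ⟨E × F, φ⟩) (hψ : N.IsChart ⟨E, ψ⟩)
    (h : ∀ y ∈ φ.source, f.1 y ∈ ψ.source ∧ ψ (f.1 y) = (φ y).1) {c : BanachChart T}
    (hc : c ∈ T.atlas) (p₀ : FiberProduct f g) {z : c.E × F}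
    (hz : z ∈ (fiberProductChart h c p₀).target) :
    SmoothAt (M := model (c.E × F)) (fun w => ((fiberProductChart h c p₀).symm w).1.1) z ∧
      SmoothAt (M := model (c.E × F)) (fun w => ((fiberProductChart h c p₀).symm w).1.2) z := by
  have hev : ∀ᶠ w in 𝓝 z, ((fiberProductChart h c p₀).symm w).1 =
      (φ.symm (ψ (g.1 (c.φ.symm w.1)), w.2), c.φ.symm w.1) := by
    filter_upwards [(fiberProductChart h c p₀).open_target.mem_nhds hz] with w hw
    exact fiberProductChart_symm h c p₀ hw
  obtain ⟨h1, h2, h3⟩ := hz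
  have s0 := smoothAt_id (M := model (c.E × F)) z
  have s1 : SmoothAt (M := model (c.E × F)) (fun w => c.φ.symm w.1) z :=
    SmoothAt.comp (M := model (c.E × F)) (N := model c.E) (g := c.φ.symm)
      (f := fun w => w.1)
      ((isChart_of_mem hc).smoothAt_symm h1) s0.fst
  have s2 : SmoothAt (M := model (c.E × F)) (N := model E)
      (fun w => ψ (g.1 (c.φ.symm w.1))) z :=
    SmoothAt.comp (P := model E) (g := ψ) (hψ.smoothAt h2) (SmoothAt.comp (g.2.smoothAt _) s1)
  have s3 : SmoothAt (M := model (c.E × F))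
      (fun w => φ.symm (ψ (g.1 (c.φ.symm w.1)), w.2)) z :=
    SmoothAt.comp (N := model (E × F)) (g := φ.symm) (hφ.smoothAt_symm h3) (s2.prodMk s0.snd)
  exact ⟨s3.congr (hev.mono fun w hw => congrArg Prod.fst hw),
    s1.congr (hev.mono fun w hw => congrArg Prod.snd hw)⟩

/-- The components of `fiberProductChart` are smooth, as functions of the two projections. -/
theorem smoothAt_fiberProductChart {E F : Type u} [NormedAddCommGroup E] [NormedSpace ℝ E]
    [CompleteSpace E] [NormedAddCommGroup F] [NormedSpace ℝ F] [CompleteSpace F]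
    {φ : OpenPartialHomeomorph M (E × F)} {ψ : OpenPartialHomeomorph N E}
    (hφ : M.IsChart ⟨E × F, φ⟩)
    (h : ∀ y ∈ φ.source, f.1 y ∈ ψ.source ∧ ψ (f.1 y) = (φ y).1) {c : BanachChart T}
    (hc : c ∈ T.atlas) (p₀ : FiberProduct f g) {A : BanMfd.{u}} {k : A → FiberProduct f g} {a : A}
    (ha : k a ∈ (fiberProductChart h c p₀).source)
    (h1 : SmoothAt (fun a => (k a).1.1) a) (h2 : SmoothAt (fun a => (k a).1.2) a) :
    SmoothAt (N := model (c.E × F)) (fun a => fiberProductChart h c p₀ (k a)) a :=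
  SmoothAt.prodMk
    (SmoothAt.comp (P := model c.E) (g := c.φ) ((isChart_of_mem hc).smoothAt ha.2) h2)
    (SmoothAt.comp (P := model (E × F)) (g := φ) (hφ.smoothAt ha.1) h1).snd

/-- The atlas of the fibre product. -/
def fiberProductAtlas (f : M ⟶ N) (g : T ⟶ N) : Set (BanachChart (FiberProduct f g)) :=
  {e | ∃ (E F : Type u) (_ : NormedAddCommGroup E) (_ : NormedSpace ℝ E) (_ : CompleteSpace E)
    (_ : NormedAddCommGroup F) (_ : NormedSpace ℝ F) (_ : CompleteSpace F)
    (φ : OpenPartialHomeomorph M (E × F)) (ψ : OpenPartialHomeomorph N E)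
    (_ : M.IsChart ⟨E × F, φ⟩) (_ : N.IsChart ⟨E, ψ⟩)
    (h : ∀ y ∈ φ.source, f.1 y ∈ ψ.source ∧ ψ (f.1 y) = (φ y).1)
    (c : BanachChart T) (_ : c ∈ T.atlas) (p₀ : FiberProduct f g),
    e = ⟨c.E × F, fiberProductChart h c p₀⟩}

/-- The fibre product of a submersion `f` and a smooth map `g`. -/
def fiberProduct (f : M ⟶ N) (hf : IsSubmersion f) (g : T ⟶ N) : BanMfd.{u} where
  carrier := FiberProduct f g
  atlas := fiberProductAtlas f g
  exists_mem_source p := by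
    obtain ⟨E, F, _, _, _, _, _, _, φ, ψ, hφ, hψ, hx, h⟩ := hf p.1.1
    obtain ⟨c, hc, hxc⟩ := T.exists_mem_source p.1.2
    exact ⟨⟨c.E × F, fiberProductChart h c p⟩, ⟨E, F, inferInstance, inferInstance, inferInstance,
      inferInstance, inferInstance, inferInstance, φ, ψ, hφ, hψ, h, c, hc, p, rfl⟩, hx, hxc⟩
  smoothChange := by
    rintro _ ⟨E, F, _, _, _, _, _, _, φ, ψ, hφ, hψ, h, c, hc, p, rfl⟩
      _ ⟨E', F', _, _, _, _, _, _, φ', ψ', hφ', hψ', h', c', hc', p', rfl⟩ x hx hx'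
    have h1 := smoothAt_fiberProductChart_symm hφ hψ h hc p
      ((fiberProductChart h c p).map_source hx)
    have hx'' : (fiberProductChart h c p).symm (fiberProductChart h c p x) ∈
        (fiberProductChart h' c' p').source := by
      rw [(fiberProductChart h c p).left_inv hx]
      exact hx'
    exact smoothAt_model_iff.1 (smoothAt_fiberProductChart hφ' h' hc' p' hx'' h1.1 h1.2)

variable (hf : IsSubmersion f)

/-- The charts and their inverses are smooth expressions in the two projections. This is what makes
the manifold structure satisfy the universal property of the pullback. -/
theorem smoothAt_fiberProduct_iff {A : BanMfd.{u}} {k : A → FiberProduct f g} {a : A} :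
    SmoothAt (N := fiberProduct f hf g) k a ↔
      SmoothAt (fun a => (k a).1.1) a ∧ SmoothAt (fun a => (k a).1.2) a := by
  constructor
  · intro hk
    obtain ⟨e, he, hxe⟩ := (fiberProduct f hf g).exists_mem_source (k a)
    have hchart : (fiberProduct f hf g).IsChart e := isChart_of_mem he
    obtain ⟨E, F, _, _, _, _, _, _, φ, ψ, hφ, hψ, h, c, hc, p, rfl⟩ := he
    have h0 := SmoothAt.comp (P := model (c.E × F)) (g := fiberProductChart h c p)
      (hchart.smoothAt hxe) hk
    have h1 := smoothAt_fiberProductChart_symm hφ hψ h hc p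
      ((fiberProductChart h c p).map_source hxe)
    have hev : ∀ᶠ b in 𝓝 a, (fiberProductChart h c p).symm (fiberProductChart h c p (k b)) =
        k b := by
      filter_upwards [hk.1 ((fiberProductChart h c p).open_source.mem_nhds hxe)] with b hb
      exact (fiberProductChart h c p).left_inv hb
    exact ⟨(SmoothAt.comp h1.1 h0).congr (hev.mono fun b hb => congrArg (fun p => p.1.1) hb.symm),
      (SmoothAt.comp h1.2 h0).congr (hev.mono fun b hb => congrArg (fun p => p.1.2) hb.symm)⟩
  · rintro ⟨h1, h2⟩
    obtain ⟨e, he, hxe⟩ := (fiberProduct f hf g).exists_mem_source (k a)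
    have hchart : (fiberProduct f hf g).IsChart e := isChart_of_mem he
    have hcont : ContinuousAt k a := by
      refine Topology.IsInducing.subtypeVal.continuousAt_iff.2 ?_
      exact ContinuousAt.prodMk h1.1 h2.1
    refine smoothAt_of_chart hchart hcont hxe ?_
    obtain ⟨E, F, _, _, _, _, _, _, φ, ψ, hφ, hψ, h, c, hc, p, rfl⟩ := he
    exact smoothAt_fiberProductChart hφ h hc p hxe h1 h2

/-- The first projection of the fibre product. -/
def fiberProductFst (f : M ⟶ N) (hf : IsSubmersion f) (g : T ⟶ N) : fiberProduct f hf g ⟶ M :=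
  ⟨fun p => p.1.1, isSmooth_iff_smoothAt.2 fun x =>
    ((smoothAt_fiberProduct_iff hf).1 (smoothAt_id x)).1⟩

/-- The second projection of the fibre product. -/
def fiberProductSnd (f : M ⟶ N) (hf : IsSubmersion f) (g : T ⟶ N) : fiberProduct f hf g ⟶ T :=
  ⟨fun p => p.1.2, isSmooth_iff_smoothAt.2 fun x =>
    ((smoothAt_fiberProduct_iff hf).1 (smoothAt_id x)).2⟩

theorem isPullback_fiberProduct :
    IsPullback (fiberProductFst f hf g) (fiberProductSnd f hf g) f g where
  w := Subtype.ext (funext fun p => p.2)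
  isLimit' := ⟨Limits.PullbackCone.IsLimit.mk _
    (fun s => ⟨fun a => ⟨(s.fst.1 a, s.snd.1 a),
      congrFun (congrArg Subtype.val s.condition) a⟩, isSmooth_iff_smoothAt.2 fun a =>
        (smoothAt_fiberProduct_iff hf).2 ⟨s.fst.2.smoothAt a, s.snd.2.smoothAt a⟩⟩)
    (fun _ => rfl) (fun _ => rfl)
    (fun _ _ h1 h2 => Subtype.ext (funext fun a => Subtype.ext (Prod.ext
      (congrFun (congrArg Subtype.val h1) a) (congrFun (congrArg Subtype.val h2) a))))⟩

theorem isSubmersion_fiberProductSnd : IsSubmersion (fiberProductSnd f hf g) := by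
  intro p
  obtain ⟨e, he, hxe⟩ := (fiberProduct f hf g).exists_mem_source p
  have hchart : (fiberProduct f hf g).IsChart e := isChart_of_mem he
  obtain ⟨E, F, _, _, _, _, _, _, φ, ψ, hφ, hψ, h, c, hc, p₀, rfl⟩ := he
  exact ⟨c.E, F, inferInstance, inferInstance, inferInstance, inferInstance, inferInstance,
    inferInstance, fiberProductChart h c p₀, c.φ, hchart, isChart_of_mem hc, hxe,
    fun y hy => ⟨hy.2, rfl⟩⟩

theorem surjective_fiberProductSnd (hf' : Function.Surjective f.1) :
    Function.Surjective (fiberProductSnd f hf g).1 := by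
  intro t
  obtain ⟨m, hm⟩ := hf' (g.1 t)
  exact ⟨⟨(m, t), hm⟩, rfl⟩

end fiberProduct

/-- The class of submersions. -/
def submersions : MorphismProperty BanMfd.{u} := fun _ _ f => IsSubmersion f

/-- The class of surjective submersions. -/
def surjSubmersions : MorphismProperty BanMfd.{u} := fun _ _ f => IsSurjSubmersion f

instance : submersions.{u}.IsMultiplicative where
  id_mem _ := isSubmersion_of_isIso _
  comp_mem _ _ hf hg := IsSubmersion.comp hf hg

instance : surjSubmersions.{u}.IsMultiplicative where
  id_mem _ := ⟨Function.surjective_id, isSubmersion_of_isIso _⟩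
  comp_mem _ _ hf hg := ⟨hg.1.comp hf.1, IsSubmersion.comp hf.2 hg.2⟩

instance : submersions.{u}.RespectsIso where
  precomp e he _ hf := IsSubmersion.comp (have : IsIso e := he; isSubmersion_of_isIso e) hf
  postcomp e he _ hf := IsSubmersion.comp hf (have : IsIso e := he; isSubmersion_of_isIso e)

theorem surjSubmersions_of_isIso {M N : BanMfd.{u}} (f : M ⟶ N) [IsIso f] : surjSubmersions f :=
  ⟨surjective_of_isIso f, isSubmersion_of_isIso f⟩

instance : surjSubmersions.{u}.RespectsIso where
  precomp e he _ hf := surjSubmersions.{u}.comp_mem _ _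
    (have : IsIso e := he; surjSubmersions_of_isIso e) hf
  postcomp e he _ hf := surjSubmersions.{u}.comp_mem _ _ hf
    (have : IsIso e := he; surjSubmersions_of_isIso e)

/-- The images of surjective submersions under the Yoneda embedding are relatively representable
by surjective submersions. -/
theorem surjSubmersions_presheaf_map {M N : BanMfd.{u}} {f : M ⟶ N} (hf : surjSubmersions f) :
    surjSubmersions.presheaf (yoneda.map f) :=
  MorphismProperty.relative.of_exists fun T g => by
    obtain ⟨g, rfl⟩ := yoneda.map_surjective g
    exact ⟨_, _, fiberProductSnd f hf.2 g, (isPullback_fiberProduct hf.2).map yoneda,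
      surjective_fiberProductSnd hf.2 hf.1, isSubmersion_fiberProductSnd hf.2⟩

theorem submersions_presheaf_map {M N : BanMfd.{u}} {f : M ⟶ N} (hf : submersions f) :
    submersions.presheaf (yoneda.map f) :=
  MorphismProperty.relative.of_exists fun T g => by
    obtain ⟨g, rfl⟩ := yoneda.map_surjective g
    exact ⟨_, _, fiberProductSnd f hf g, (isPullback_fiberProduct hf).map yoneda,
      isSubmersion_fiberProductSnd hf⟩

end BanMfd
/-! ### Morphisms of presheaves -/

section presheaves

variable {D : Type*} [Category D]

theorem isIso_iff_bijective_app {F G : D ⥤ Type u} (p : F ⟶ G) :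
    IsIso p ↔ ∀ T, Function.Bijective (p.app T) := by
  rw [NatTrans.isIso_iff_isIso_app]
  exact forall_congr' fun T => isIso_iff_bijective _

/-- Pullback squares of presheaves are recognised on elements. -/
theorem isPullback_of_existsUnique {F' F G' G : D ⥤ Type u} {a : F' ⟶ F} {p' : F' ⟶ G'}
    {p : F ⟶ G} {b : G' ⟶ G} (w : a ≫ p = p' ≫ b)
    (h : ∀ T (x : F.obj T) (y : G'.obj T), p.app T x = b.app T y →
      ∃! z : F'.obj T, a.app T z = x ∧ p'.app T z = y) : IsPullback a p' p b where
  w := w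
  isLimit' := ⟨Limits.evaluationJointlyReflectsLimits _ fun T => by
    refine (Limits.isLimitMapConePullbackConeEquiv _ _).symm (IsPullback.isLimit ?_)
    rw [Limits.Types.isPullback_iff]
    refine ⟨NatTrans.congr_app w T, fun x y hxy => ?_, fun x y hxy => ?_⟩
    · obtain ⟨z, -, hz⟩ := h T (a.app T x) (p'.app T x) (by
        have := ConcreteCategory.congr_hom (NatTrans.congr_app w T) x
        simpa using this)
      rw [hz x ⟨rfl, rfl⟩, hz y ⟨hxy.1.symm, hxy.2.symm⟩]
    · obtain ⟨z, hz, -⟩ := h T x y hxy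
      exact ⟨z, hz⟩⟩

end presheaves

namespace CategoryTheory.MorphismProperty

variable {C : Type*} [Category.{u} C] {P : MorphismProperty C}

/-- A relatively representable morphism with representable target has a representable source. -/
theorem presheaf.exists_representableBy [P.RespectsIso] {F G : Cᵒᵖ ⥤ Type u} {p : F ⟶ G}
    (hp : P.presheaf p) {L : C} (r : G.RepresentableBy L) :
    ∃ (M : C) (s : F.RepresentableBy M) (t : M ⟶ L), P t ∧
      s.toIso.hom ≫ p = yoneda.map t ≫ r.toIso.hom := by
  have hpb := hp.rep.isPullback r.toIso.hom
  have : IsIso (hp.rep.fst r.toIso.hom) := hpb.isIso_fst_of_isIso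
  refine ⟨_, Functor.representableByEquiv.symm (asIso (hp.rep.fst r.toIso.hom)),
    hp.rep.snd r.toIso.hom, hp.property_snd _, ?_⟩
  have e : (Functor.representableByEquiv.symm (asIso (hp.rep.fst r.toIso.hom))).toIso =
    asIso (hp.rep.fst r.toIso.hom) := Equiv.apply_symm_apply _ _
  rw [e]
  exact hpb.w

theorem presheaf.isRepresentable [P.RespectsIso] {F G : Cᵒᵖ ⥤ Type u} {p : F ⟶ G}
    (hp : P.presheaf p) (hG : G.IsRepresentable) : F.IsRepresentable := by
  obtain ⟨L, ⟨r⟩⟩ := hG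
  obtain ⟨M, s, -⟩ := hp.exists_representableBy r
  exact s.isRepresentable

/-- The given equation is an isomorphism of arrows, so relative properties may be tested on any
choice of representing objects. -/
theorem presheaf_iff_of_representableBy {F G : Cᵒᵖ ⥤ Type u} {p : F ⟶ G} {M L : C}
    (s : F.RepresentableBy M) (r : G.RepresentableBy L) {t : M ⟶ L}
    (h : s.toIso.hom ≫ p = yoneda.map t ≫ r.toIso.hom) :
    P.presheaf p ↔ P.presheaf (yoneda.map t) :=
  (P.presheaf.arrow_mk_iso_iff
    (CategoryTheory.Arrow.isoMk (f := CategoryTheory.Arrow.mk (yoneda.map t))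
      (g := CategoryTheory.Arrow.mk p) s.toIso r.toIso h)).symm

end CategoryTheory.MorphismProperty

/-! ### Presheaves of maps of simplicial sets -/

namespace SSet

variable {D : Type*} [Category D]

/-- The presheaf `T ↦ hom(A, X(T))`. -/
abbrev homFunctor (A : SSet.{u}) (X : D ⥤ SSet.{u}) : D ⥤ Type u :=
  X ⋙ coyoneda.obj (op A)

/-- Restriction along `i : A ⟶ B`. -/
def homFunctorRes {A B : SSet.{u}} (i : A ⟶ B) (X : D ⥤ SSet.{u}) :
    homFunctor B X ⟶ homFunctor A X :=
  Functor.whiskerLeft X (coyoneda.map i.op)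

/-- Postcomposition with `p : Z ⟶ K`. -/
def homFunctorMap (A : SSet.{u}) {Z K : D ⥤ SSet.{u}} (p : Z ⟶ K) :
    homFunctor A Z ⟶ homFunctor A K :=
  Functor.whiskerRight p (coyoneda.obj (op A))

/-- The presheaf of commutative squares from `i : A ⟶ B` to `p : Z ⟶ K`. -/
def relHom {A B : SSet.{u}} (i : A ⟶ B) {Z K : D ⥤ SSet.{u}} (p : Z ⟶ K) : D ⥤ Type u where
  obj T := {q : (A ⟶ Z.obj T) × (B ⟶ K.obj T) // q.1 ≫ p.app T = i ≫ q.2}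
  map t := ↾fun q => ⟨(q.1.1 ≫ Z.map t, q.1.2 ≫ K.map t), by
    change (q.1.1 ≫ Z.map t) ≫ p.app _ = i ≫ q.1.2 ≫ K.map t
    rw [Category.assoc, p.naturality, reassoc_of% q.2]⟩

theorem relHom_ext {A B : SSet.{u}} {i : A ⟶ B} {Z K : D ⥤ SSet.{u}} {p : Z ⟶ K} {T : D}
    {q q' : (relHom i p).obj T} (h₁ : q.1.1 = q'.1.1) (h₂ : q.1.2 = q'.1.2) : q = q' :=
  Subtype.ext (Prod.ext h₁ h₂)

/-- The natural map from `hom(B, Z)` to the commutative squares from `i` to `p`. -/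
def relRes {A B : SSet.{u}} (i : A ⟶ B) {Z K : D ⥤ SSet.{u}} (p : Z ⟶ K) :
    homFunctor B Z ⟶ relHom i p where
  app T := ↾fun b => ⟨(i ≫ b, b ≫ p.app T), Category.assoc _ _ _⟩
  naturality T T' t := by
    ext b
    exact relHom_ext (Category.assoc _ _ _).symm (by
      change (b ≫ Z.map t) ≫ p.app T' = (b ≫ p.app T) ≫ K.map t
      rw [Category.assoc, Category.assoc, p.naturality])

/-- The map from squares to their top morphism. -/
def relHomFst {A B : SSet.{u}} (i : A ⟶ B) {Z K : D ⥤ SSet.{u}} (p : Z ⟶ K) :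
    relHom i p ⟶ homFunctor A Z where
  app T := ↾fun q => q.1.1

/-- The map from squares to their bottom morphism. -/
def relHomSnd {A B : SSet.{u}} (i : A ⟶ B) {Z K : D ⥤ SSet.{u}} (p : Z ⟶ K) :
    relHom i p ⟶ homFunctor B K where
  app T := ↾fun q => q.1.2

theorem isPullback_relHom {A B : SSet.{u}} (i : A ⟶ B) {Z K : D ⥤ SSet.{u}} (p : Z ⟶ K) :
    IsPullback (relHomFst i p) (relHomSnd i p) (homFunctorMap A p) (homFunctorRes i K) :=
  isPullback_of_existsUnique (by ext T q; exact q.2) fun T x y h =>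
    ⟨⟨(x, y), h⟩, ⟨rfl, rfl⟩, fun z hz => relHom_ext hz.1 hz.2⟩

variable (Q : MorphismProperty (D ⥤ Type u))

/-- The class of maps `i : A ⟶ B` such that `hom(B, X) ⟶ hom(A, X)` belongs to `Q`. -/
def extClass (X : D ⥤ SSet.{u}) : MorphismProperty SSet.{u} :=
  fun _ _ i => Q (homFunctorRes i X)

/-- The class of maps `i : A ⟶ B` such that the natural map from `hom(B, Z)` to the squares from
`i` to `p` belongs to `Q`. -/
def relClass {Z K : D ⥤ SSet.{u}} (p : Z ⟶ K) : MorphismProperty SSet.{u} :=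
  fun _ _ i => Q (relRes i p)

section

variable [Q.IsMultiplicative] [Q.IsStableUnderBaseChange]

instance (X : D ⥤ SSet.{u}) : (extClass Q X).IsMultiplicative where
  id_mem A := by
    change Q (homFunctorRes (𝟙 A) X)
    have : IsIso (homFunctorRes (𝟙 A) X) := by
      unfold homFunctorRes; infer_instance
    exact Q.of_isIso _
  comp_mem i j hi hj := by
    change Q (homFunctorRes (i ≫ j) X)
    have : homFunctorRes (i ≫ j) X = homFunctorRes j X ≫ homFunctorRes i X := by
      ext T x; exact Category.assoc _ _ _
    rw [this]
    exact Q.comp_mem _ _ hj hi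

/-- Mapping out of a pushout is a pullback, so cobase change of i becomes base change of the
restriction map. -/
instance (X : D ⥤ SSet.{u}) : (extClass Q X).IsStableUnderCobaseChange where
  of_isPushout {A A' B B' i f i' f'} sq hi := by
    change Q (homFunctorRes i' X)
    refine Q.of_isPullback (f' := homFunctorRes f' X) (f := homFunctorRes f X)
      (isPullback_of_existsUnique ?_ fun T x y h => ?_) hi
    · ext T x
      change i ≫ f' ≫ x = f ≫ i' ≫ x
      rw [reassoc_of% sq.w]
    · refine ⟨sq.desc y x h.symm, ⟨?_, ?_⟩, fun z hz => sq.hom_ext ?_ ?_⟩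
      · exact sq.inr_desc _ _ _
      · exact sq.inl_desc _ _ _
      · exact hz.2.trans (sq.inl_desc _ _ _).symm
      · exact hz.1.trans (sq.inr_desc _ _ _).symm

variable {Z K : D ⥤ SSet.{u}} (p : Z ⟶ K)

/-- For a composite i ≫ j, the map to squares factors as the one for j followed by a base change of
the one for i: squares from j are squares from i ≫ j with a compatible extension of the top map
along i. -/
instance : (relClass Q p).IsMultiplicative where
  id_mem A := by
    change Q (relRes (𝟙 A) p)
    have : IsIso (relRes (𝟙 A) p) := by
      rw [isIso_iff_bijective_app]
      refine fun T => ⟨fun x y h => ?_, fun q => ⟨q.1.1, ?_⟩⟩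
      · have := congrArg (fun q => q.1.1) h
        exact (Category.id_comp x).symm.trans (this.trans (Category.id_comp y))
      · exact relHom_ext (Category.id_comp _) (q.2.trans (Category.id_comp _))
    exact Q.of_isIso _
  comp_mem {A B C} i j hi hj := by
    change Q (relRes (i ≫ j) p)
    let a : relHom j p ⟶ relHom (i ≫ j) p :=
      { app T := ↾fun q => ⟨(i ≫ q.1.1, q.1.2), by
          change (i ≫ q.1.1) ≫ p.app T = (i ≫ j) ≫ q.1.2
          rw [Category.assoc, Category.assoc, q.2]⟩
        naturality T T' t := by
          ext q
          exact relHom_ext (Category.assoc _ _ _).symm rfl }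
    let b : relHom (i ≫ j) p ⟶ relHom i p :=
      { app T := ↾fun q => ⟨(q.1.1, j ≫ q.1.2), q.2.trans (Category.assoc _ _ _)⟩
        naturality T T' t := by
          ext q
          exact relHom_ext rfl (Category.assoc _ _ _).symm }
    have h1 : relRes (i ≫ j) p = relRes j p ≫ a := by
      ext T x
      exact relHom_ext (Category.assoc _ _ _) rfl
    rw [h1]
    refine Q.comp_mem _ _ hj (Q.of_isPullback (f' := relHomFst j p) (f := b)
      (isPullback_of_existsUnique ?_ fun T x y h => ?_) hi)
    · ext T q
      exact relHom_ext rfl q.2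
    · have h2 : i ≫ x = y.1.1 := congrArg (fun q => q.1.1) h
      have h3 : x ≫ p.app T = j ≫ y.1.2 := congrArg (fun q => q.1.2) h
      exact ⟨⟨(x, y.1.2), h3⟩, ⟨rfl, relHom_ext h2 rfl⟩, fun z hz =>
        relHom_ext hz.1 (congrArg (fun q => q.1.2) hz.2)⟩

/-- A map out of the pushout lifting a given square is the same as a compatible lift on the attached
piece. -/
instance : (relClass Q p).IsStableUnderCobaseChange where
  of_isPushout {A A' B B' i f i' f'} sq hi := by
    change Q (relRes i' p)
    let b : relHom i' p ⟶ relHom i p :=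
      { app T := ↾fun q => ⟨(f ≫ q.1.1, f' ≫ q.1.2), by
          change (f ≫ q.1.1) ≫ p.app T = i ≫ f' ≫ q.1.2
          rw [Category.assoc, q.2, reassoc_of% sq.w]⟩
        naturality T T' t := by
          ext q
          exact relHom_ext (Category.assoc _ _ _).symm (Category.assoc _ _ _).symm }
    refine Q.of_isPullback (f' := homFunctorRes f' Z) (f := b)
      (isPullback_of_existsUnique ?_ fun T x y h => ?_) hi
    · ext T x
      refine relHom_ext ?_ ?_
      · change i ≫ f' ≫ x = f ≫ i' ≫ x
        rw [reassoc_of% sq.w]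
      · exact Category.assoc _ _ _
    · have h2 : i ≫ x = f ≫ y.1.1 := congrArg (fun q => q.1.1) h
      have h3 : x ≫ p.app T = f' ≫ y.1.2 := congrArg (fun q => q.1.2) h
      refine ⟨sq.desc y.1.1 x h2.symm, ⟨sq.inr_desc _ _ _, relHom_ext (sq.inl_desc _ _ _) ?_⟩,
        fun z hz => sq.hom_ext ?_ ?_⟩
      · refine sq.hom_ext ?_ ?_
        · change i' ≫ sq.desc y.1.1 x h2.symm ≫ p.app T = i' ≫ y.1.2
          rw [sq.inl_desc_assoc, y.2]
        · change f' ≫ sq.desc y.1.1 x h2.symm ≫ p.app T = f' ≫ y.1.2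
          rw [sq.inr_desc_assoc, h3]
      · exact (congrArg (fun q => q.1.1) hz.2).trans (sq.inl_desc _ _ _).symm
      · exact hz.1.trans (sq.inr_desc _ _ _).symm

variable {Q p}

/-- If `hom(B, K) ⟶ hom(A, K)` belongs to `Q`, and `i : A ⟶ B` to `relClass Q p`, then
`hom(B, Z) ⟶ hom(A, Z)` belongs to `Q`. -/
theorem extClass_of_relClass {A B : SSet.{u}} {i : A ⟶ B} (h : relClass Q p i)
    (hK : extClass Q K i) : extClass Q Z i := by
  change Q (homFunctorRes i Z)
  have : homFunctorRes i Z = relRes i p ≫ relHomFst i p := rfl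
  rw [this]
  exact Q.comp_mem _ _ h (Q.of_isPullback (isPullback_relHom i p).flip hK)

/-- `hom(A, Z) ⟶ hom(A, K)` belongs to `Q` if `∅ ⟶ A` belongs to `relClass Q p`. -/
theorem homFunctorMap_mem {E A : SSet.{u}} (hE : Limits.IsInitial E) {i : E ⟶ A}
    (h : relClass Q p i) : Q (homFunctorMap A p) := by
  have e : homFunctorMap A p = relRes i p ≫ relHomSnd i p := rfl
  rw [e]
  have : IsIso (relHomSnd i p) := by
    rw [isIso_iff_bijective_app]
    refine fun T => ⟨fun x y h => relHom_ext (hE.hom_ext _ _) h, fun y =>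
      ⟨⟨(hE.to _, y), hE.hom_ext _ _⟩, rfl⟩⟩
  exact Q.comp_mem _ _ h (Q.of_isIso _)

end

variable {Q} [Q.IsStableUnderBaseChange]

theorem relHomSnd_mem {A B : SSet.{u}} (i : A ⟶ B) {Z K : D ⥤ SSet.{u}} {p : Z ⟶ K}
    (h : Q (homFunctorMap A p)) : Q (relHomSnd i p) :=
  Q.of_isPullback (isPullback_relHom i p) h

/-- `relClass` is stable under base change in the morphism `p`. -/
theorem relClass_of_isPullback {Z K Z' K' : D ⥤ SSet.{u}} {p : Z ⟶ K} {p' : Z' ⟶ K'}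
    {a : Z' ⟶ Z} {b : K' ⟶ K}
    (sq : IsPullback a p' p b) : relClass Q p ≤ relClass Q p' := by
  intro A B i hi
  change Q (relRes i p')
  let c : relHom i p' ⟶ relHom i p :=
    { app T := ↾fun q => ⟨(q.1.1 ≫ a.app T, q.1.2 ≫ b.app T), by
        change (q.1.1 ≫ a.app T) ≫ p.app T = i ≫ q.1.2 ≫ b.app T
        rw [Category.assoc, ← NatTrans.comp_app, sq.w, NatTrans.comp_app, reassoc_of% q.2]⟩
      naturality T T' t := by
        ext q
        refine relHom_ext ?_ ?_
        · change (q.1.1 ≫ Z'.map t) ≫ a.app T' = (q.1.1 ≫ a.app T) ≫ Z.map t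
          rw [Category.assoc, Category.assoc, a.naturality]
        · change (q.1.2 ≫ K'.map t) ≫ b.app T' = (q.1.2 ≫ b.app T) ≫ K.map t
          rw [Category.assoc, Category.assoc, b.naturality] }
  refine Q.of_isPullback (f' := homFunctorMap B a) (f := c)
    (isPullback_of_existsUnique ?_ fun T x y h => ?_) hi
  · ext T x
    refine relHom_ext (Category.assoc _ _ _).symm ?_
    change (x ≫ a.app T) ≫ p.app T = (x ≫ p'.app T) ≫ b.app T
    rw [Category.assoc, Category.assoc, ← NatTrans.comp_app, sq.w, NatTrans.comp_app]
  · have sqT := sq.map ((evaluation D SSet.{u}).obj T)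
    have h2 : i ≫ x = y.1.1 ≫ a.app T := congrArg (fun q => q.1.1) h
    have h3 : x ≫ p.app T = y.1.2 ≫ b.app T := congrArg (fun q => q.1.2) h
    refine ⟨sqT.lift x y.1.2 h3, ⟨sqT.lift_fst _ _ _, relHom_ext ?_ (sqT.lift_snd _ _ _)⟩,
      fun z hz => sqT.hom_ext ?_ ?_⟩
    · refine sqT.hom_ext ?_ ?_
      · change (i ≫ sqT.lift x y.1.2 h3) ≫ a.app T = y.1.1 ≫ a.app T
        refine (Category.assoc _ _ _).trans ?_
        refine (congrArg (i ≫ ·) (sqT.lift_fst x y.1.2 h3)).trans h2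
      · change (i ≫ sqT.lift x y.1.2 h3) ≫ p'.app T = y.1.1 ≫ p'.app T
        refine (Category.assoc _ _ _).trans ?_
        exact (congrArg (i ≫ ·) (sqT.lift_snd x y.1.2 h3)).trans y.2.symm
    · exact hz.1.trans (sqT.lift_fst _ _ _).symm
    · exact (congrArg (fun q => q.1.2) hz.2).trans (sqT.lift_snd _ _ _).symm

end SSet

/-! ### Building inclusions from boundaries and horns -/

namespace SSet

section cells

variable {W : MorphismProperty SSet.{u}} [W.IsMultiplicative] [W.IsStableUnderCobaseChange]

open Limits

/-- Finite coproducts of morphisms in `W` belong to `W`, if `W` is stable under composition and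
cobase change. -/
theorem mem_of_isColimit_cofan {J : Type*} [Finite J] {X Y : J → SSet.{u}} {f : ∀ j, X j ⟶ Y j}
    (hf : ∀ j, W (f j)) {cX : Cofan X} (hX : IsColimit cX) {cY : Cofan Y} (hY : IsColimit cY)
    {g : cX.pt ⟶ cY.pt} (hg : ∀ j, cX.inj j ≫ g = f j ≫ cY.inj j) : W g := by
  induction J using Finite.induction_empty_option with
  | of_equiv e ih =>
    exact ih (fun j => hf (e j)) (Cofan.isColimitEquivOfEquiv e cX hX)
      (Cofan.isColimitEquivOfEquiv e cY hY) fun j => hg (e j)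
  | h_empty =>
    have : IsIso g := ⟨Cofan.IsColimit.desc hY (fun j => j.elim),
      Cofan.IsColimit.hom_ext hX _ _ (fun j => j.elim),
      Cofan.IsColimit.hom_ext hY _ _ (fun j => j.elim)⟩
    exact W.of_isIso _
  | @h_option J _ ih =>
    let s : (∐ fun j : J => X (some j)) ⟶ ∐ fun j : J => Y (some j) :=
      Limits.Sigma.map fun j => f (some j)
    have hs : W s := ih (fun j => hf (some j)) (coproductIsCoproduct _) (coproductIsCoproduct _)
      fun j => by simp [s]
    -- The map is split in two cobase changes: the summands `some j` are attached together along s,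
    -- then the summand `none` along `f none`.
    have h₁ := IsPushout.of_hasPushout (Sigma.desc fun j : J => cX.inj (some j)) s
    let t : pushout (Sigma.desc fun j : J => cX.inj (some j)) s ⟶ cY.pt :=
      h₁.desc g (Sigma.desc fun j : J => cY.inj (some j)) (by
        ext j : 1; simp [s, hg])
    have h₂ : IsPushout (cX.inj none ≫ pushout.inl _ _) (f none) t (cY.inj none) := by
      refine ⟨⟨by simp [t, hg]⟩, ⟨PushoutCocone.IsColimit.mk _
        (fun c => Cofan.IsColimit.desc hY (fun j => match j with
          | none => c.inr
          | some j => Sigma.ι (fun j : J => Y (some j)) j ≫ pushout.inr _ _ ≫ c.inl)) ?_ ?_ ?_⟩⟩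
      · intro c
        refine h₁.hom_ext ?_ ?_
        · refine Cofan.IsColimit.hom_ext hX _ _ ?_
          rintro (_ | j)
          · have := c.condition
            simp only [Category.assoc] at this
            simp [t, reassoc_of% hg, this]
          · have : cX.inj (some j) ≫ pushout.inl (Sigma.desc fun j : J => cX.inj (some j)) s =
              f (some j) ≫ Sigma.ι (fun j : J => Y (some j)) j ≫ pushout.inr _ _ := by
              have := Sigma.ι (fun j : J => X (some j)) j ≫= h₁.w
              simpa [s] using this
            simp [t, reassoc_of% hg, reassoc_of% this]
        · ext j : 1
          simp [t]
      · intro c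
        simp
      · intro c m h₁' h₂'
        refine Cofan.IsColimit.hom_ext hY _ _ ?_
        rintro (_ | j)
        · simp [h₂']
        · simp [← h₁', t]
    have e : g = pushout.inl _ _ ≫ t := by simp [t]
    rw [e]
    exact W.comp_mem _ _ (W.of_isPushout h₁ hs) (W.of_isPushout h₂ (hf none))

theorem sigmaMap_mem {J : Type u} [Finite J] {X Y : J → SSet.{u}} {f : ∀ j, X j ⟶ Y j}
    (hf : ∀ j, W (f j)) : W (Limits.Sigma.map f) :=
  mem_of_isColimit_cofan hf (coproductIsCoproduct _) (coproductIsCoproduct _) fun j => by simp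

/-- A monomorphism to a finite simplicial set belongs to `W` if the boundary inclusions of the
dimensions of its cells do. -/
theorem mono_mem {X Y : SSet.{u}} (i : X ⟶ Y) [Mono i] [Y.Finite]
    (h : ∀ n, (∃ x : Y.nonDegenerate n, x.1 ∉ Set.range (i.app _)) →
      W (∂Δ[n].ι : (∂Δ[n] : SSet.{u}) ⟶ Δ[n])) : W i := by
  obtain ⟨d, hd⟩ := Y.hasDimensionLT_of_finite
  -- Induction along the relative skeleta. Each stage attaches finitely many cells of one dimension,
  -- which is why finite coproducts suffice.
  have key (n : ℕ) : W (Subcomplex.homOfLE ((skeletonOfMono i).monotone (Nat.zero_le n))) := by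
    induction n with
    | zero =>
      have : IsIso (Subcomplex.homOfLE ((skeletonOfMono i).monotone (le_refl 0))) :=
        inferInstanceAs (IsIso (𝟙 _))
      exact W.of_isIso _
    | succ n ih =>
      have : Finite (relativeCellComplexOfMono.Cell i n) :=
        Finite.of_injective (fun c => (⟨c.simplex, c.nonDegenerate⟩ : Y.nonDegenerate n))
          fun c c' h => relativeCellComplexOfMono.Cell.ext (congrArg Subtype.val h)
      exact W.comp_mem _ _ ih (W.of_isPushout (relativeCellComplexOfMono.isPushout i n)
        (sigmaMap_mem fun c => h n ⟨⟨c.simplex, c.nonDegenerate⟩, c.notMem⟩))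
  have htop : skeletonOfMono i d = ⊤ := by
    rw [Subcomplex.eq_top_iff_of_hasDimensionLT _ d]
    intro n hn x hx
    rw [skeletonOfMono_obj_eq_top i hn]
    trivial
  have e₁ : Subcomplex.range i = skeletonOfMono i 0 := (skeletonOfMono_zero i).symm
  let a : X ⟶ skeletonOfMono i 0 := Subcomplex.lift i e₁.le
  have ha : IsIso a := by
    have h1 : IsIso (Subcomplex.toRange i) := inferInstance
    have h2 : IsIso (Subcomplex.homOfLE e₁.le) := ⟨Subcomplex.homOfLE e₁.ge, rfl, rfl⟩
    exact inferInstanceAs (IsIso (Subcomplex.toRange i ≫ Subcomplex.homOfLE e₁.le))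
  have hb : IsIso (skeletonOfMono i d).ι := by
    rw [htop]
    exact inferInstanceAs (IsIso (Subcomplex.topIso Y).hom)
  have e : i = a ≫ Subcomplex.homOfLE ((skeletonOfMono i).monotone (Nat.zero_le d)) ≫
    (skeletonOfMono i d).ι := rfl
  rw [e]
  exact W.comp_mem _ _ (W.of_isIso _) (W.comp_mem _ _ (key d) (W.of_isIso _))

/-- The inclusion of a subcomplex of a finite simplicial set belongs to `W` if it has a regular
pairing, and the horn inclusions of the dimensions of the type (I) simplices belong to `W`. -/
theorem pairing_mem {X : SSet.{u}} [X.Finite] {A : X.Subcomplex} (P : A.Pairing) [P.IsRegular]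
    (h : ∀ (s : P.II) (j : Fin (s.1.dim + 2)),
      W (Λ[s.1.dim + 1, j].ι : (Λ[s.1.dim + 1, j] : SSet.{u}) ⟶ Δ[s.1.dim + 1])) : W A.ι := by
  let f := P.rankFunction
  have : Finite A.N :=
    Finite.of_injective (fun x => x.toN) fun x y h => (Subcomplex.N.ext_iff x y).2 h
  have key (n : ℕ) : W (Subcomplex.homOfLE (f.filtration_monotone (Nat.zero_le n))) := by
    induction n with
    | zero =>
      have : IsIso (Subcomplex.homOfLE (f.filtration_monotone (le_refl 0))) :=
        inferInstanceAs (IsIso (𝟙 _))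
      exact W.of_isIso _
    | succ n ih =>
      have : Finite (f.Cell n) := Finite.of_injective (fun c => c.s) fun c c' h => by
        cases c; cases c'; cases h; rfl
      exact W.comp_mem _ _ ih (W.of_isPushout (f.isPushout n)
        (sigmaMap_mem fun c => h c.s c.index))
  -- Finiteness of X bounds the ranks, so the anodyne filtration stops after finitely many steps and
  -- no transfinite composition is needed.
  obtain ⟨d, hd⟩ : ∃ d, f.filtration d = ⊤ := by
    obtain ⟨d, hd⟩ := Set.Finite.bddAbove (Set.finite_range f.rank)
    refine ⟨d + 1, le_antisymm le_top ?_⟩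
    rw [← f.iSup_filtration]
    refine iSup_le fun i => ?_
    rw [f.filtration_def]
    refine sup_le (f.le_filtration _) (iSup_le fun j => iSup_le fun hj => iSup_le fun c =>
      f.subcomplex_le_filtration c (Nat.lt_succ_of_le ?_))
    exact c.rank_s ▸ hd ⟨c.s, rfl⟩
  have e₁ : f.filtration 0 = A := f.filtration_bot
  have ha : IsIso (Subcomplex.homOfLE e₁.ge) := ⟨Subcomplex.homOfLE e₁.le, rfl, rfl⟩
  have hb : IsIso (f.filtration d).ι := by
    rw [hd]
    exact inferInstanceAs (IsIso (Subcomplex.topIso X).hom)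
  have e : A.ι = Subcomplex.homOfLE e₁.ge ≫
    Subcomplex.homOfLE (f.filtration_monotone (Nat.zero_le d)) ≫ (f.filtration d).ι := rfl
  rw [e]
  exact W.comp_mem _ _ (W.of_isIso _) (W.comp_mem _ _ (key d) (W.of_isIso _))

/-- The inclusion of `Λ[1, k] ⊗ Δ[n] ∪ Δ[1] ⊗ ∂Δ[n]` in `Δ[1] ⊗ Δ[n]` belongs to `W` if the horn
inclusions of dimension `> n` do. -/
theorem unionProd_horn_boundary_mem (k : Fin 2) (n : ℕ)
    (h : ∀ (m : ℕ) (j : Fin (m + 2)), n ≤ m →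
      W (Λ[m + 1, j].ι : (Λ[m + 1, j] : SSet.{u}) ⟶ Δ[m + 1])) :
    W (Subcomplex.unionProd.{u} Λ[0 + 1, k] ∂Δ[n]).ι := by
  refine pairing_mem (prodStdSimplex.pairing (m := 0) k n) fun s j => h _ j ?_
  obtain ⟨s, hs⟩ := s
  -- A simplex outside the subcomplex has its second component outside ∂Δ[n], hence onto the
  -- vertices of Δ[n]. Its dimension is at least n, and the horn paired with it has dimension one
  -- more.
  have h1 : s.simplex.2 ∉ (∂Δ[n] : (Δ[n] : SSet.{u}).Subcomplex).obj _ := fun h' =>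
    s.notMem ((Subcomplex.mem_unionProd_iff _ _ _).2 (Or.inl h'))
  have h2 : Function.Surjective (stdSimplex.objEquiv s.simplex.2).toOrderHom := by
    by_contra h3
    exact h1 h3
  simpa using Fintype.card_le_of_surjective _ h2

end cells

end SSet

/-! ### Surjective submersions of presheaves -/

namespace BanMfd

instance (P : MorphismProperty BanMfd.{u}) : P.presheaf.IsStableUnderBaseChange :=
  MorphismProperty.relative_isStableUnderBaseChange P

/-- Base change along the identity recovers f from the relative statement. -/
theorem presheaf_map_iff {P : MorphismProperty BanMfd.{u}} [P.RespectsIso] {M N : BanMfd.{u}}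
    {f : M ⟶ N} (h : P f → P.presheaf (yoneda.map f)) : P.presheaf (yoneda.map f) ↔ P f :=
  ⟨fun hf => hf.property (𝟙 _) (𝟙 _) f (by simpa using IsPullback.of_id_fst), h⟩

theorem surjSubmersions_presheaf_map_iff {M N : BanMfd.{u}} {f : M ⟶ N} :
    surjSubmersions.presheaf (yoneda.map f) ↔ surjSubmersions f :=
  presheaf_map_iff surjSubmersions_presheaf_map

theorem submersions_presheaf_map_iff {M N : BanMfd.{u}} {f : M ⟶ N} :
    submersions.presheaf (yoneda.map f) ↔ submersions f :=
  presheaf_map_iff submersions_presheaf_map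

/-- Surjective submersions descend along surjective submersions. -/
theorem surjSubmersions_presheaf_of_comp {F G H : BanMfd.{u}ᵒᵖ ⥤ Type u} {q : F ⟶ G} {p : G ⟶ H}
    (hq : surjSubmersions.presheaf q) (hqp : surjSubmersions.presheaf (q ≫ p))
    (hG : G.IsRepresentable) (hH : H.IsRepresentable) : surjSubmersions.presheaf p := by
  obtain ⟨M, ⟨r⟩⟩ := hG
  obtain ⟨N, ⟨r'⟩⟩ := hH
  obtain ⟨L, s, t, ht, hst⟩ := hq.exists_representableBy r
  obtain ⟨t', ht'⟩ := yoneda.map_surjective (r.toIso.hom ≫ p ≫ r'.toIso.inv)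
  have e : r.toIso.hom ≫ p = yoneda.map t' ≫ r'.toIso.hom := by simp [ht']
  rw [MorphismProperty.presheaf_iff_of_representableBy r r' e, surjSubmersions_presheaf_map_iff]
  rw [MorphismProperty.presheaf_iff_of_representableBy (t := t ≫ t') s r' (by
    rw [reassoc_of% hst, e, Functor.map_comp, Category.assoc]),
    surjSubmersions_presheaf_map_iff] at hqp
  exact ⟨.of_comp (g := t.1) hqp.1, isSubmersion_of_comp ht.1 hqp.2⟩

/-- By Yoneda, the value of p at the universal element classifies p itself. The condition on an
element thus becomes one on a morphism of presheaves, where composition and base change are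
available. -/
theorem isSurjSubmersionOnto_iff {F G : BanMfd.{u}ᵒᵖ ⥤ Type u} {M : BanMfd.{u}}
    (s : F.RepresentableBy M) (p : F ⟶ G) :
    IsSurjSubmersionOnto G (p.app (op M) (s.homEquiv (𝟙 M))) ↔
      G.IsRepresentable ∧ surjSubmersions.presheaf p := by
  have key {L : BanMfd.{u}} (r : G.RepresentableBy L) :
      IsSurjSubmersion (r.homEquiv.symm (p.app (op M) (s.homEquiv (𝟙 M)))) ↔
        surjSubmersions.presheaf p := by
    have e : s.toIso.hom ≫ p =
        yoneda.map (r.homEquiv.symm (p.app (op M) (s.homEquiv (𝟙 M)))) ≫ r.toIso.hom := by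
      refine CategoryTheory.yonedaEquiv.injective ?_
      change p.app (op M) (s.homEquiv (𝟙 M)) = r.homEquiv (𝟙 M ≫ _)
      rw [Category.id_comp, Equiv.apply_symm_apply]
    rw [MorphismProperty.presheaf_iff_of_representableBy s r e, surjSubmersions_presheaf_map_iff]
    rfl
  exact ⟨fun ⟨L, r, h⟩ => ⟨r.isRepresentable, (key r).1 h⟩,
    fun ⟨⟨L, ⟨r⟩⟩, h⟩ => ⟨L, r, (key r).2 h⟩⟩

theorem isIsoOnto_iff {F G : BanMfd.{u}ᵒᵖ ⥤ Type u} {M : BanMfd.{u}}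
    (s : F.RepresentableBy M) (p : F ⟶ G) :
    IsIsoOnto G (p.app (op M) (s.homEquiv (𝟙 M))) ↔ IsIso p := by
  have e (T : BanMfd.{u}) : (fun t : T ⟶ M => G.map t.op (p.app (op M) (s.homEquiv (𝟙 M)))) =
      p.app (op T) ∘ s.homEquiv := by
    ext t
    have := s.homEquiv_comp t (𝟙 M)
    rw [Category.comp_id] at this
    simp only [Function.comp_apply, this]
    exact (NatTrans.naturality_apply p t.op (s.homEquiv (𝟙 M))).symm
  rw [isIso_iff_bijective_app]
  refine ⟨fun h T => ?_, fun h T => ?_⟩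
  · have := h T.unop
    rw [e] at this
    exact (Function.Bijective.of_comp_iff _ s.homEquiv.bijective).1 this
  · rw [e]
    exact (h (op T)).comp s.homEquiv.bijective

end BanMfd

/-! ### Kan and hypercover conditions as classes of simplicial maps -/

namespace SimplicialMfd

open BanMfd SSet

variable (X : SimplicialObject BanMfd.{u})

/-- `simplex` as an equivalence. -/
def simplexEquiv (T : BanMfd.{u}) (m : ℕ) :
    (T ⟶ X _⦋m⦌) ≃ (Δ[m] ⟶ (points X).obj (op T)) :=
  (SSet.yonedaEquiv (X := (points X).obj (op T)) (n := ⦋m⦌)).symm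

theorem simplex_comp {T T' : BanMfd.{u}} {m : ℕ} (t : T' ⟶ T) (x : T ⟶ X _⦋m⦌) :
    simplex (t ≫ x) = simplex x ≫ (points X).map t.op :=
  ((simplexEquiv X T' m).symm_apply_eq.1
    (congrArg (fun y => t ≫ y) ((simplexEquiv X T m).symm_apply_apply x))).symm

/-- `X_m` represents `hom(Δ[m], X)`. -/
def simplexRepresentableBy (m : ℕ) :
    (homFunctor Δ[m] (points X)).RepresentableBy (X _⦋m⦌) where
  homEquiv := simplexEquiv X _ m
  homEquiv_comp t x := simplex_comp X t x

variable {X}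

/-- In this form the Kan conditions pass to any inclusion built from horns, since `extClass` is
closed under composition and cobase change. -/
theorem kan_iff {m : ℕ} {j : Fin (m + 1)} : Kan X m j ↔
    (homFunctor (Λ[m, j] : SSet.{u}) (points X)).IsRepresentable ∧
      extClass surjSubmersions.presheaf (points X) Λ[m, j].ι :=
  isSurjSubmersionOnto_iff (simplexRepresentableBy X m) (homFunctorRes Λ[m, j].ι (points X))

theorem kanUnique_iff {m : ℕ} {j : Fin (m + 1)} : KanUnique X m j ↔
    extClass (.isomorphisms _) (points X) (Λ[m, j].ι : (Λ[m, j] : SSet.{u}) ⟶ _) :=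
  isIsoOnto_iff (simplexRepresentableBy X m) (homFunctorRes Λ[m, j].ι (points X))

variable {K Y : SimplicialObject BanMfd.{u}} {f : K ⟶ Y}

theorem simplex_comp_pointsMap {T : BanMfd.{u}} {m : ℕ} (x : T ⟶ K _⦋m⦌) :
    simplex x ≫ (pointsMap f).app (op T) = simplex (x ≫ f.app (op ⦋m⦌)) :=
  ((simplexEquiv Y T m).symm_apply_eq.1
    (congrArg (fun y => y ≫ f.app (op ⦋m⦌)) ((simplexEquiv K T m).symm_apply_apply x)))

theorem boundaryRestriction_eq (k : ℕ) : boundaryRestriction f k =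
    (relRes ∂Δ[k].ι (pointsMap f)).app (op (K _⦋k⦌))
      ((simplexRepresentableBy K k).homEquiv (𝟙 (K _⦋k⦌))) :=
  relHom_ext (p := pointsMap f) rfl (by
    have := simplex_comp_pointsMap (f := f) (𝟙 (K _⦋k⦌))
    rw [Category.id_comp] at this
    exact this.symm)

theorem isSurjSubmersionOnto_boundaryRestriction_iff {k : ℕ} :
    IsSurjSubmersionOnto _ (boundaryRestriction f k) ↔
      (relHom (∂Δ[k].ι : (∂Δ[k] : SSet.{u}) ⟶ Δ[k]) (pointsMap f)).IsRepresentable ∧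
      relClass surjSubmersions.presheaf (pointsMap f) ∂Δ[k].ι := by
  rw [boundaryRestriction_eq]
  exact isSurjSubmersionOnto_iff _ _

theorem isIsoOnto_boundaryRestriction_iff {k : ℕ} :
    IsIsoOnto _ (boundaryRestriction f k) ↔
      relClass (.isomorphisms _) (pointsMap f) (∂Δ[k].ι : (∂Δ[k] : SSet.{u}) ⟶ Δ[k]) := by
  rw [boundaryRestriction_eq]
  exact isIsoOnto_iff _ _

end SimplicialMfd

/-! ### Path objects -/

namespace SSet

open MonoidalCategory CartesianMonoidalCategory

/-- The inclusion of `A` in `Δ[1] ⊗ A` at the vertex `ε`. -/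
noncomputable def atVertex (ε : Fin 2) (A : SSet.{u}) : A ⟶ Δ[1] ⊗ A :=
  lift (SSet.const (stdSimplex.obj₀Equiv.{u}.symm ε)) (𝟙 A)

theorem atVertex_naturality (ε : Fin 2) {A B : SSet.{u}} (f : A ⟶ B) :
    atVertex ε A ≫ Δ[1] ◁ f = f ≫ atVertex ε B := rfl

theorem vertex_mem_horn (ε : Fin 2) :
    stdSimplex.obj₀Equiv.{u}.symm ε ∈ Λ[0 + 1, ε].obj (op ⦋0⦌) := by
  rw [mem_horn_iff]
  intro h
  have h0 : ∀ ε : Fin 2, ε.rev ≠ ε := by decide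
  have h1 : ε.rev ∈ (Set.univ : Set (Fin 2)) := trivial
  rw [← h] at h1
  rcases h1 with ⟨k, hk⟩ | h1
  · exact h0 ε hk.symm
  · exact h0 ε h1

/-- The inclusion of `Λ[1, ε] ⊗ A` in `Δ[1] ⊗ A` is the inclusion at the vertex `ε`. -/
theorem horn_ι_whiskerRight (ε : Fin 2) (A : SSet.{u}) :
    Λ[0 + 1, ε].ι ▷ A = snd _ A ≫ atVertex ε A := by
  refine CartesianMonoidalCategory.hom_ext _ _ ?_ rfl
  ext n ⟨⟨x, hx⟩, a⟩
  change x = stdSimplex.const _ ε n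
  rw [mem_horn_iff] at hx
  refine stdSimplex.ext _ _ fun k => ?_
  change stdSimplex.asOrderHom x k = ε
  by_contra hk
  refine hx (Set.eq_univ_of_forall fun i => ?_)
  rcases eq_or_ne i ε with rfl | hi
  · exact Or.inr rfl
  · exact Or.inl ⟨k, by
      generalize stdSimplex.asOrderHom x k = y at hk
      lia⟩

variable {D : Type*} [Category D]

/-- The path object of a diagram of simplicial sets. -/
noncomputable def pathObject (Y : D ⥤ SSet.{u}) : D ⥤ SSet.{u} := Y ⋙ ihom Δ[1]

/-- Maps to the path object. -/
noncomputable def pathEquiv (Y : D ⥤ SSet.{u}) (A : SSet.{u}) (T : D) :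
    (A ⟶ (pathObject Y).obj T) ≃ (Δ[1] ⊗ A ⟶ Y.obj T) :=
  ((ihom.adjunction Δ[1]).homEquiv A (Y.obj T)).symm

theorem pathEquiv_comp {Y : D ⥤ SSet.{u}} {A B : SSet.{u}} {T : D} (i : A ⟶ B)
    (b : B ⟶ (pathObject Y).obj T) : pathEquiv Y A T (i ≫ b) = Δ[1] ◁ i ≫ pathEquiv Y B T b :=
  MonoidalClosed.uncurry_natural_left (A := Δ[1]) (Y := Y.obj T) i b

theorem pathEquiv_comp_map {Y : D ⥤ SSet.{u}} {A : SSet.{u}} {T T' : D}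
    (b : A ⟶ (pathObject Y).obj T) (t : T ⟶ T') :
    pathEquiv Y A T' (b ≫ (pathObject Y).map t) = pathEquiv Y A T b ≫ Y.map t :=
  MonoidalClosed.uncurry_natural_right (A := Δ[1]) (Y := Y.obj T) b (Y.map t)

/-- Evaluation of paths at the vertex `ε`. -/
noncomputable def pathEval (ε : Fin 2) (Y : D ⥤ SSet.{u}) : pathObject Y ⟶ Y where
  app T := atVertex ε _ ≫ (ihom.ev Δ[1]).app (Y.obj T)
  naturality T T' t := by
    change (ihom Δ[1]).map (Y.map t) ≫ atVertex ε _ ≫ (ihom.ev Δ[1]).app (Y.obj T') =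
      (atVertex ε _ ≫ (ihom.ev Δ[1]).app (Y.obj T)) ≫ Y.map t
    rw [← reassoc_of% atVertex_naturality, ihom.ev_naturality, Category.assoc]

theorem comp_pathEval (ε : Fin 2) {Y : D ⥤ SSet.{u}} {T : D} {A : SSet.{u}}
    (a : A ⟶ (pathObject Y).obj T) :
    a ≫ (pathEval ε Y).app T = atVertex ε A ≫ pathEquiv Y A T a := by
  have : pathEquiv Y A T a = Δ[1] ◁ a ≫ (ihom.ev Δ[1]).app (Y.obj T) :=
    MonoidalClosed.uncurry_eq (A := Δ[1]) (X := Y.obj T) a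
  rw [this]
  rfl

section sides

variable (ε : Fin 2) (Y : D ⥤ SSet.{u}) {B : SSet.{u}} (A : B.Subcomplex)

/-- The agreement on {ε} × A that allows the two pieces of a square to be glued. -/
theorem whiskerRight_pathEquiv {T : D} (q : (relHom A.ι (pathEval ε Y)).obj T) :
    Λ[0 + 1, ε].ι ▷ (A : SSet.{u}) ≫ pathEquiv Y A T q.1.1 =
      (Λ[0 + 1, ε] : SSet.{u}) ◁ A.ι ≫ snd _ _ ≫ q.1.2 := by
  have h1 : q.1.1 ≫ (pathEval ε Y).app T = A.ι ≫ q.1.2 := q.2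
  rw [horn_ι_whiskerRight, Category.assoc, ← comp_pathEval, h1, whiskerLeft_snd_assoc]

/-- A square from `A ⟶ B` to `pathEval ε Y` as a map from `{ε} ⊗ B ∪ Δ[1] ⊗ A` to `Y`. -/
noncomputable def sidesOfSquare : relHom A.ι (pathEval ε Y) ⟶
    homFunctor (Subcomplex.unionProd.{u} Λ[0 + 1, ε] A) Y where
  app T := ↾fun q => (Subcomplex.unionProd.isPushout.{u} Λ[0 + 1, ε] A).desc
    (pathEquiv Y A T q.1.1) (snd _ _ ≫ q.1.2) (whiskerRight_pathEquiv ε Y A q)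
  naturality T T' t := by
    have sq := Subcomplex.unionProd.isPushout.{u} Λ[0 + 1, ε] A
    ext q
    refine sq.hom_ext ?_ ?_
    · refine (sq.inl_desc _ _ _).trans ?_
      refine (pathEquiv_comp_map q.1.1 t).trans ?_
      exact (sq.inl_desc_assoc _ _ (whiskerRight_pathEquiv ε Y A q) (Y.map t)).symm
    · refine (sq.inr_desc _ _ _).trans ?_
      exact (sq.inr_desc_assoc _ _ (whiskerRight_pathEquiv ε Y A q) (Y.map t)).symm

variable {ε Y A}

theorem ι₁_sidesOfSquare {T : D} (q : (relHom A.ι (pathEval ε Y)).obj T) :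
    Subcomplex.unionProd.ι₁ _ _ ≫ (sidesOfSquare ε Y A).app T q = pathEquiv Y A T q.1.1 :=
  (Subcomplex.unionProd.isPushout.{u} Λ[0 + 1, ε] A).inl_desc _ _ (whiskerRight_pathEquiv ε Y A q)

theorem ι₂_sidesOfSquare {T : D} (q : (relHom A.ι (pathEval ε Y)).obj T) :
    Subcomplex.unionProd.ι₂ _ _ ≫ (sidesOfSquare ε Y A).app T q = snd _ _ ≫ q.1.2 :=
  (Subcomplex.unionProd.isPushout.{u} Λ[0 + 1, ε] A).inr_desc _ _ (whiskerRight_pathEquiv ε Y A q)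

theorem sidesOfSquare_eq {T : D} {q : (relHom A.ι (pathEval ε Y)).obj T}
    {x : (Subcomplex.unionProd.{u} Λ[0 + 1, ε] A : SSet.{u}) ⟶ Y.obj T}
    (h₁ : Subcomplex.unionProd.ι₁ _ _ ≫ x = pathEquiv Y A T q.1.1)
    (h₂ : Subcomplex.unionProd.ι₂ _ _ ≫ x = snd _ _ ≫ q.1.2) :
    (sidesOfSquare ε Y A).app T q = x :=
  (Subcomplex.unionProd.isPushout.{u} Λ[0 + 1, ε] A).hom_ext
    ((ι₁_sidesOfSquare q).trans h₁.symm) ((ι₂_sidesOfSquare q).trans h₂.symm)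

/-- The part on Δ[1] × A gives back the top map by adjunction, and the slice at ε gives back the
bottom map. -/
theorem sidesOfSquare_injective (T : D) : Function.Injective ((sidesOfSquare ε Y A).app T) := by
  intro q q' h
  refine relHom_ext ((pathEquiv Y A T).injective ?_) ?_
  · rw [← ι₁_sidesOfSquare, ← ι₁_sidesOfSquare, h]
  · have h₂ : snd (Λ[0 + 1, ε] : SSet.{u}) B ≫ q.1.2 = snd _ _ ≫ q'.1.2 := by
      rw [← ι₂_sidesOfSquare, ← ι₂_sidesOfSquare, h]
    let v : B ⟶ (Λ[0 + 1, ε] : SSet.{u}) ⊗ B := lift (SSet.const ⟨_, vertex_mem_horn ε⟩) (𝟙 B)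
    have hv : v ≫ snd _ _ = 𝟙 B := lift_snd _ _
    have := v ≫= h₂
    rwa [reassoc_of% hv, reassoc_of% hv] at this

theorem sidesOfSquare_relRes {T : D} (x : Δ[1] ⊗ B ⟶ Y.obj T) :
    (sidesOfSquare ε Y A).app T
        ((relRes A.ι (pathEval ε Y)).app T ((pathEquiv Y B T).symm x)) =
      (Subcomplex.unionProd.{u} Λ[0 + 1, ε] A).ι ≫ x := by
  refine sidesOfSquare_eq ?_ ?_
  · refine Eq.trans ?_ (pathEquiv_comp A.ι ((pathEquiv Y B T).symm x)).symm
    rw [Equiv.apply_symm_apply, Subcomplex.unionProd.ι₁_ι_assoc]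
  · change _ = snd _ _ ≫ (pathEquiv Y B T).symm x ≫ (pathEval ε Y).app T
    rw [comp_pathEval, Equiv.apply_symm_apply, Subcomplex.unionProd.ι₂_ι_assoc,
      horn_ι_whiskerRight, Category.assoc]

end sides

/-- The map from `hom(B, Y^I)` to the squares from `A ⟶ B` to `pathEval ε Y` is a base change of
the restriction map from `hom(Δ[1] ⊗ B, Y)` to `hom({ε} ⊗ B ∪ Δ[1] ⊗ A, Y)`. -/
theorem relClass_pathEval {Q : MorphismProperty (D ⥤ Type u)} [Q.IsStableUnderBaseChange]
    (ε : Fin 2) {Y : D ⥤ SSet.{u}} {B : SSet.{u}} (A : B.Subcomplex)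
    (h : extClass Q Y (Subcomplex.unionProd.{u} Λ[0 + 1, ε] A).ι) :
    relClass Q (pathEval ε Y) A.ι := by
  let a : homFunctor B (pathObject Y) ⟶ homFunctor (Δ[1] ⊗ B) Y :=
    { app T := ↾(pathEquiv Y B T)
      naturality T T' t := by
        ext x
        exact pathEquiv_comp_map x t }
  refine Q.of_isPullback (f' := a) (f := sidesOfSquare ε Y A)
    (isPullback_of_existsUnique ?_ fun T x q hq => ?_) h
  · ext T x
    have := sidesOfSquare_relRes (A := A) (ε := ε) (pathEquiv Y B T x)
    rw [Equiv.symm_apply_apply] at this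
    exact this.symm
  · exact ⟨(pathEquiv Y B T).symm x, ⟨(pathEquiv Y B T).apply_symm_apply x,
      sidesOfSquare_injective T ((sidesOfSquare_relRes x).trans hq)⟩,
      fun z hz => (pathEquiv Y B T).eq_symm_apply.2 hz.1⟩

end SSet

/-! ### Whiskering of 2-simplices by bigons -/

namespace SSet

/-- Horns `Λ[n, j]` in `S` have unique fillers. -/
def HasUniqueFillers (S : SSet.{u}) (n : ℕ) (j : Fin (n + 1)) : Prop :=
  Function.Bijective fun w : Δ[n] ⟶ S => Λ[n, j].ι ≫ w

/-- A horn is glued from its faces, so fillers can be prescribed by compatible families of faces. -/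
theorem HasUniqueFillers.existsUnique {S : SSet.{u}} {n : ℕ} {j : Fin (n + 2)}
    (h : S.HasUniqueFillers (n + 1) j) {φ : ∀ (i : Fin (n + 2)) (_ : i ≠ j), Δ[n] ⟶ S}
    (hφ : horn.IsCompatible φ) :
    ∃! w : Δ[n + 1] ⟶ S, ∀ (i : Fin (n + 2)) (hi : i ≠ j), stdSimplex.δ i ≫ w = φ i hi := by
  obtain ⟨ψ, hψ⟩ := hφ.exists_desc
  obtain ⟨w, rfl⟩ := h.2 ψ
  have e (w : Δ[n + 1] ⟶ S) (i : Fin (n + 2)) (hi : i ≠ j) :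
      horn.ι j i hi ≫ Λ[n + 1, j].ι ≫ w = stdSimplex.δ i ≫ w := by
    rw [← Category.assoc, horn.ι_ι]
  refine ⟨w, fun i hi => (e w i hi).symm.trans (hψ i hi), fun w' hw' => h.1 ?_⟩
  exact horn.hom_ext' fun i hi => (e w' i hi).trans ((hw' i hi).trans (hψ i hi).symm)

/-! Simplicial identities in low dimensions. -/

theorem δ_one_δ_two : (stdSimplex.{u}.δ (1 : Fin 2) ≫ stdSimplex.δ (2 : Fin 3)) =
    stdSimplex.δ (1 : Fin 2) ≫ stdSimplex.δ (1 : Fin 3) :=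
  (stdSimplex.δ_comp_δ_self (n := 0) (i := 1)).symm

theorem δ_zero_δ_two : (stdSimplex.{u}.δ (0 : Fin 2) ≫ stdSimplex.δ (2 : Fin 3)) =
    stdSimplex.δ (1 : Fin 2) ≫ stdSimplex.δ (0 : Fin 3) :=
  stdSimplex.δ_comp_δ (n := 0) (i := 0) (j := 1) (by decide)

theorem δ_one_σ_zero : (stdSimplex.{u}.δ (1 : Fin 3) ≫ stdSimplex.σ (0 : Fin 2)) = 𝟙 _ :=
  stdSimplex.δ_comp_σ_succ (n := 1) (i := 0)

theorem δ_zero_σ_zero : (stdSimplex.{u}.δ (0 : Fin 3) ≫ stdSimplex.σ (0 : Fin 2)) = 𝟙 _ :=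
  stdSimplex.δ_comp_σ_self (n := 1) (i := 0)

theorem δ_two_σ_zero : (stdSimplex.{u}.δ (2 : Fin 3) ≫ stdSimplex.σ (0 : Fin 2)) =
    stdSimplex.σ (0 : Fin 1) ≫ stdSimplex.δ (1 : Fin 2) :=
  stdSimplex.δ_comp_σ_of_gt (n := 0) (i := 1) (j := 0) (by decide)

theorem δ_one_σ_zero' : (stdSimplex.{u}.δ (1 : Fin 2) ≫ stdSimplex.σ (0 : Fin 1)) = 𝟙 _ :=
  stdSimplex.δ_comp_σ_succ (n := 0) (i := 0)

theorem δ_zero_σ_zero' : (stdSimplex.{u}.δ (0 : Fin 2) ≫ stdSimplex.σ (0 : Fin 1)) = 𝟙 _ :=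
  stdSimplex.δ_comp_σ_self (n := 0) (i := 0)

theorem δ_zero_δ_two' : (stdSimplex.{u}.δ (0 : Fin 3) ≫ stdSimplex.δ (2 : Fin 4)) =
    stdSimplex.δ (1 : Fin 3) ≫ stdSimplex.δ (0 : Fin 4) :=
  stdSimplex.δ_comp_δ (n := 1) (i := 0) (j := 1) (by decide)

theorem δ_zero_δ_one : (stdSimplex.{u}.δ (0 : Fin 3) ≫ stdSimplex.δ (1 : Fin 4)) =
    stdSimplex.δ (0 : Fin 3) ≫ stdSimplex.δ (0 : Fin 4) :=
  (stdSimplex.δ_comp_δ_self (n := 1) (i := 0)).symm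

theorem δ_one_δ_two' : (stdSimplex.{u}.δ (1 : Fin 3) ≫ stdSimplex.δ (2 : Fin 4)) =
    stdSimplex.δ (1 : Fin 3) ≫ stdSimplex.δ (1 : Fin 4) :=
  (stdSimplex.δ_comp_δ_self (n := 1) (i := 1)).symm

theorem δ_one_δ_three : (stdSimplex.{u}.δ (1 : Fin 3) ≫ stdSimplex.δ (3 : Fin 4)) =
    stdSimplex.δ (2 : Fin 3) ≫ stdSimplex.δ (1 : Fin 4) :=
  stdSimplex.δ_comp_δ (n := 1) (i := 1) (j := 2) (by decide)

theorem δ_zero_δ_three : (stdSimplex.{u}.δ (0 : Fin 3) ≫ stdSimplex.δ (3 : Fin 4)) =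
    stdSimplex.δ (2 : Fin 3) ≫ stdSimplex.δ (0 : Fin 4) :=
  stdSimplex.δ_comp_δ (n := 1) (i := 0) (j := 2) (by decide)

variable {S : SSet.{u}} {β : Δ[2] ⟶ S} {v : Δ[0] ⟶ S}
  (hβ : stdSimplex.δ 2 ≫ β = stdSimplex.σ 0 ≫ v)

include hβ

/-- A 2-simplex can be composed with a bigon from its face `d_2`. -/
theorem existsUnique_of_source (h : S.HasUniqueFillers 3 0) {t : Δ[2] ⟶ S}
    (ht : stdSimplex.δ 2 ≫ t = stdSimplex.δ 1 ≫ β) :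
    ∃! w : Δ[3] ⟶ S, stdSimplex.δ 3 ≫ w = β ∧ stdSimplex.δ 1 ≫ w = t ∧
      stdSimplex.δ 2 ≫ w = stdSimplex.σ 0 ≫ stdSimplex.δ 1 ≫ t := by
  have hv : stdSimplex.δ (1 : Fin 2) ≫ stdSimplex.δ (1 : Fin 3) ≫ t = v := by
    rw [← reassoc_of% δ_one_δ_two, ht, ← reassoc_of% δ_one_δ_two, hβ, reassoc_of% δ_one_σ_zero']
  -- The bigon sits on the vertices 0, 1, 2, so the edge 01 is degenerate; t sits on 0, 2, 3, and
  -- the face 013 is degenerate on the edge 03 of t. The missing face 123 is t with its first edge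
  -- moved from the source of the bigon to its target.
  let φ : ∀ (i : Fin 4) (_ : i ≠ 0), Δ[2] ⟶ S := fun i hi => match i with
    | 0 => (hi rfl).elim
    | 1 => t
    | 2 => stdSimplex.σ 0 ≫ stdSimplex.δ 1 ≫ t
    | 3 => β
  have hφ : horn.IsCompatible φ := by
    rw [horn.isCompatible_iff]
    intro j k hj hk hjk
    fin_cases j <;> fin_cases k <;>
      first | (exfalso; revert hjk; decide) | (exfalso; exact hj rfl) | skip
    · change stdSimplex.δ (1 : Fin 3) ≫ t = stdSimplex.δ 1 ≫ stdSimplex.σ 0 ≫ stdSimplex.δ 1 ≫ t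
      rw [reassoc_of% δ_one_σ_zero]
    · exact ht
    · change stdSimplex.δ (2 : Fin 3) ≫ stdSimplex.σ 0 ≫ stdSimplex.δ 1 ≫ t = stdSimplex.δ 2 ≫ β
      rw [reassoc_of% δ_two_σ_zero, hv, hβ]
  obtain ⟨w, hw, hw'⟩ := h.existsUnique hφ
  refine ⟨w, ⟨hw 3 (by decide), hw 1 (by decide), hw 2 (by decide)⟩,
    fun y hy => hw' y fun i hi => ?_⟩
  fin_cases i
  · exact (hi rfl).elim
  · exact hy.2.1
  · exact hy.2.2
  · exact hy.1

/-- A 2-simplex can be composed with the inverse of a bigon to its face `d_2`. -/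
theorem existsUnique_of_target (h : S.HasUniqueFillers 3 1) {t : Δ[2] ⟶ S}
    (ht : stdSimplex.δ 2 ≫ t = stdSimplex.δ 0 ≫ β) :
    ∃! w : Δ[3] ⟶ S, stdSimplex.δ 3 ≫ w = β ∧ stdSimplex.δ 0 ≫ w = t ∧
      stdSimplex.δ 2 ≫ w = stdSimplex.σ 0 ≫ stdSimplex.δ 1 ≫ t := by
  have hv : stdSimplex.δ (1 : Fin 2) ≫ stdSimplex.δ (1 : Fin 3) ≫ t = v := by
    rw [← reassoc_of% δ_one_δ_two, ht, ← reassoc_of% δ_zero_δ_two, hβ, reassoc_of% δ_zero_σ_zero']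
  -- The same tetrahedron read backwards: t is now the face 123, and the filler provides the face
  -- 023.
  let φ : ∀ (i : Fin 4) (_ : i ≠ 1), Δ[2] ⟶ S := fun i hi => match i with
    | 1 => (hi rfl).elim
    | 0 => t
    | 2 => stdSimplex.σ 0 ≫ stdSimplex.δ 1 ≫ t
    | 3 => β
  have hφ : horn.IsCompatible φ := by
    rw [horn.isCompatible_iff]
    intro j k hj hk hjk
    fin_cases j <;> fin_cases k <;>
      first | (exfalso; revert hjk; decide) | (exfalso; exact hj rfl) |
        (exfalso; exact hk rfl) | skip
    · change stdSimplex.δ (1 : Fin 3) ≫ t = stdSimplex.δ 0 ≫ stdSimplex.σ 0 ≫ stdSimplex.δ 1 ≫ t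
      rw [reassoc_of% δ_zero_σ_zero]
    · exact ht
    · change stdSimplex.δ (2 : Fin 3) ≫ stdSimplex.σ 0 ≫ stdSimplex.δ 1 ≫ t = stdSimplex.δ 2 ≫ β
      rw [reassoc_of% δ_two_σ_zero, hv, hβ]
  obtain ⟨w, hw, hw'⟩ := h.existsUnique hφ
  refine ⟨w, ⟨hw 3 (by decide), hw 0 (by decide), hw 2 (by decide)⟩,
    fun y hy => hw' y fun i hi => ?_⟩
  fin_cases i
  · exact hy.2.1
  · exact (hi rfl).elim
  · exact hy.2.2
  · exact hy.1

end SSet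

/-! ### Moving the first edge of a 2-simplex along a family of bigons -/

namespace SSet

variable {D : Type*} [Category D]

/-- The explicit fibre product of presheaves. -/
def fiberFunctor {F G H : D ⥤ Type u} (p : F ⟶ H) (q : G ⟶ H) : D ⥤ Type u where
  obj T := {x : F.obj T × G.obj T // p.app T x.1 = q.app T x.2}
  map t := ↾fun x => ⟨(F.map t x.1.1, G.map t x.1.2), by
    have h1 := NatTrans.naturality_apply p t x.1.1
    have h2 := NatTrans.naturality_apply q t x.1.2
    exact h1.trans ((congrArg (H.map t) x.2).trans h2.symm)⟩
  map_id T := by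
    ext x
    · exact ConcreteCategory.congr_hom (F.map_id T) x.1.1
    · exact ConcreteCategory.congr_hom (G.map_id T) x.1.2
  map_comp s t := by
    ext x
    · exact ConcreteCategory.congr_hom (F.map_comp s t) x.1.1
    · exact ConcreteCategory.congr_hom (G.map_comp s t) x.1.2

/-- The first projection. -/
def fiberFunctorFst {F G H : D ⥤ Type u} (p : F ⟶ H) (q : G ⟶ H) : fiberFunctor p q ⟶ F where
  app T := ↾fun x => x.1.1

/-- The second projection. -/
def fiberFunctorSnd {F G H : D ⥤ Type u} (p : F ⟶ H) (q : G ⟶ H) : fiberFunctor p q ⟶ G where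
  app T := ↾fun x => x.1.2

theorem isPullback_fiberFunctor {F G H : D ⥤ Type u} (p : F ⟶ H) (q : G ⟶ H) :
    IsPullback (fiberFunctorFst p q) (fiberFunctorSnd p q) p q :=
  isPullback_of_existsUnique (by ext T x; exact x.2) fun T x y h =>
    ⟨⟨(x, y), h⟩, ⟨rfl, rfl⟩, fun z hz => Subtype.ext (Prod.ext hz.1 hz.2)⟩

/-- Data of a bigon from `h` to `f ∘ g`. -/
structure BigonBetween {K Y : D ⥤ SSet.{u}} (f : K ⟶ Y) {G : D ⥤ Type u}
    (g : G ⟶ homFunctor Δ[1] K) (h : G ⟶ homFunctor Δ[1] Y) where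
  bigon : G ⟶ homFunctor Δ[2] Y
  exists_base {T : D} (z : G.obj T) : ∃ v : Δ[0] ⟶ Y.obj T,
    stdSimplex.δ 2 ≫ bigon.app T z = stdSimplex.σ 0 ≫ v
  source {T : D} (z : G.obj T) : stdSimplex.δ 1 ≫ bigon.app T z = h.app T z
  target {T : D} (z : G.obj T) : stdSimplex.δ 0 ≫ bigon.app T z = g.app T z ≫ f.app T

namespace BigonBetween

variable {K Y : D ⥤ SSet.{u}} {f : K ⟶ Y} {G : D ⥤ Type u}
    {g : G ⟶ homFunctor Δ[1] K} {h : G ⟶ homFunctor Δ[1] Y} (α : BigonBetween f g h)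

/-- Fillings which compose a 2-simplex with a bigon. -/
def filling : D ⥤ Type u where
  obj T := {x : G.obj T × (Δ[3] ⟶ Y.obj T) // stdSimplex.δ 3 ≫ x.2 = α.bigon.app T x.1 ∧
    ∃ e : Δ[1] ⟶ Y.obj T, stdSimplex.δ 2 ≫ x.2 = stdSimplex.σ 0 ≫ e}
  map {T T'} t := ↾fun x => ⟨(G.map t x.1.1, x.1.2 ≫ Y.map t), by
      have h1 := NatTrans.naturality_apply α.bigon t x.1.1
      exact (congrArg (· ≫ Y.map t) x.2.1).trans h1.symm, by
      obtain ⟨e, he⟩ := x.2.2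
      exact ⟨e ≫ Y.map t, congrArg (· ≫ Y.map t) he⟩⟩
  map_id T := by
    ext x : 3
    refine Subtype.ext (Prod.ext ?_ ?_)
    · exact ConcreteCategory.congr_hom (G.map_id T) x.1.1
    · exact ConcreteCategory.congr_hom ((homFunctor Δ[3] Y).map_id T) x.1.2
  map_comp s t := by
    ext x : 3
    refine Subtype.ext (Prod.ext ?_ ?_)
    · exact ConcreteCategory.congr_hom (G.map_comp s t) x.1.1
    · exact ConcreteCategory.congr_hom ((homFunctor Δ[3] Y).map_comp s t) x.1.2

variable {α}

theorem filling_ext {T : D} {x y : α.filling.obj T} (h₁ : x.1.1 = y.1.1) (h₂ : x.1.2 = y.1.2) :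
    x = y :=
  Subtype.ext (Prod.ext h₁ h₂)

/-- The edge e in the definition of a filling is only asserted to exist. It is in fact an edge of
the face d_1, so uniqueness of fillers applies. -/
theorem filling_eq_one {T : D} (x : α.filling.obj T) : stdSimplex.δ 2 ≫ x.1.2 =
    stdSimplex.σ 0 ≫ stdSimplex.δ 1 ≫ stdSimplex.δ 1 ≫ x.1.2 := by
  obtain ⟨e, he⟩ := x.2.2
  rw [← reassoc_of% δ_one_δ_two', he, reassoc_of% δ_one_σ_zero]

theorem filling_eq_zero {T : D} (x : α.filling.obj T) : stdSimplex.δ 2 ≫ x.1.2 =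
    stdSimplex.σ 0 ≫ stdSimplex.δ 1 ≫ stdSimplex.δ 0 ≫ x.1.2 := by
  obtain ⟨e, he⟩ := x.2.2
  rw [← reassoc_of% δ_zero_δ_two', he, reassoc_of% δ_zero_σ_zero]

variable (α)

/-- The underlying element of `G`. -/
def fillingFst : α.filling ⟶ G where
  app T := ↾fun x => x.1.1

/-- The 2-simplex from which a filling starts. -/
def fillingSource : α.filling ⟶ homFunctor Δ[2] Y where
  app T := ↾fun x => stdSimplex.δ 1 ≫ x.1.2

/-- The 2-simplex at which a filling ends. -/
def fillingTarget : α.filling ⟶ relHom (stdSimplex.δ 2 : Δ[1] ⟶ Δ[2]) f where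
  app T := ↾fun x => ⟨(g.app T x.1.1, stdSimplex.δ 0 ≫ x.1.2), by
    change g.app T x.1.1 ≫ f.app T = stdSimplex.δ 2 ≫ stdSimplex.δ 0 ≫ x.1.2
    rw [← α.target, ← reassoc_of% δ_zero_δ_three, x.2.1]⟩
  naturality T T' t := by
    ext x
    refine relHom_ext ?_ rfl
    have := ConcreteCategory.congr_hom (g.naturality t) x.1.1
    exact this

/-- Once z and the final 2-simplex are given, three faces of the tetrahedron are known and the horn
Λ[3,1] has a unique filler. -/
theorem isPullback_fillingTarget (hY : ∀ T, (Y.obj T).HasUniqueFillers 3 1) :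
    IsPullback α.fillingFst α.fillingTarget g (relHomFst _ f) :=
  isPullback_of_existsUnique rfl fun T z y hzy => by
    obtain ⟨v, hv⟩ := α.exists_base z
    have h1 : stdSimplex.δ 2 ≫ y.1.2 = stdSimplex.δ 0 ≫ α.bigon.app T z := by
      rw [α.target]
      exact y.2.symm.trans (congrArg (· ≫ f.app T) hzy.symm)
    obtain ⟨w, ⟨hw3, hw0, hw2⟩, hw⟩ := existsUnique_of_target hv (hY T) h1
    refine ⟨⟨(z, w), hw3, _, hw2⟩, ⟨rfl, relHom_ext hzy hw0⟩, ?_⟩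
    rintro x ⟨rfl, rfl⟩
    exact filling_ext rfl (hw _ ⟨x.2.1, rfl, filling_eq_zero x⟩)

/-- Here z and the initial 2-simplex determine a horn Λ[3,0]. -/
theorem isPullback_fillingSource (hY : ∀ T, (Y.obj T).HasUniqueFillers 3 0) :
    IsPullback α.fillingFst α.fillingSource h (homFunctorRes (stdSimplex.δ 2) Y) :=
  isPullback_of_existsUnique (by
      ext T x
      change h.app T x.1.1 = stdSimplex.δ 2 ≫ stdSimplex.δ 1 ≫ x.1.2
      rw [← α.source, ← reassoc_of% δ_one_δ_three, x.2.1]) fun T z y hzy => by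
    obtain ⟨v, hv⟩ := α.exists_base z
    have h1 : stdSimplex.δ 2 ≫ y = stdSimplex.δ 1 ≫ α.bigon.app T z := by
      rw [α.source]
      exact hzy.symm
    obtain ⟨w, ⟨hw3, hw1, hw2⟩, hw⟩ := existsUnique_of_source hv (hY T) h1
    refine ⟨⟨(z, w), hw3, _, hw2⟩, ⟨rfl, hw1⟩, ?_⟩
    rintro x ⟨rfl, rfl⟩
    exact filling_ext rfl (hw _ ⟨x.2.1, rfl, filling_eq_one x⟩)

/-- The faces 123 and 023 of the tetrahedron share the edge 23, and their edges 13 and 03 agree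
because the face 013 is degenerate. Composition with a bigon thus changes the first edge only. -/
theorem fillingTarget_comp :
    α.fillingTarget ≫ relHomSnd _ f ≫ homFunctorRes Λ[2, 2].ι Y =
      α.fillingSource ≫ homFunctorRes Λ[2, 2].ι Y := by
  ext T x
  change Λ[2, 2].ι ≫ stdSimplex.δ 0 ≫ x.1.2 = Λ[2, 2].ι ≫ stdSimplex.δ 1 ≫ x.1.2
  obtain ⟨e, he⟩ := x.2.2
  refine horn.hom_ext' fun i hi => ?_
  rw [horn.ι_ι_assoc, horn.ι_ι_assoc]
  fin_cases i
  · exact ((reassoc_of% δ_zero_δ_one) _).symm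
  · change stdSimplex.δ (1 : Fin 3) ≫ stdSimplex.δ (0 : Fin 4) ≫ x.1.2 =
      stdSimplex.δ (1 : Fin 3) ≫ stdSimplex.δ (1 : Fin 4) ≫ x.1.2
    rw [← reassoc_of% δ_zero_δ_two', ← reassoc_of% δ_one_δ_two', he,
      reassoc_of% δ_zero_σ_zero, reassoc_of% δ_one_σ_zero]
  · exact (hi rfl).elim

variable {Q : MorphismProperty (D ⥤ Type u)} [Q.IsStableUnderBaseChange]

theorem fillingTarget_mem (hY : ∀ T, (Y.obj T).HasUniqueFillers 3 1) (hg : Q g) :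
    Q α.fillingTarget :=
  Q.of_isPullback (α.isPullback_fillingTarget hY) hg

theorem fillingTarget_comp_mem [Q.IsMultiplicative]
    (hY : ∀ T, (Y.obj T).HasUniqueFillers 3 0) (hh : Q h)
    (hY' : extClass Q Y Λ[2, 2].ι) :
    Q (α.fillingTarget ≫ relHomSnd _ f ≫ homFunctorRes Λ[2, 2].ι Y) := by
  rw [fillingTarget_comp]
  exact Q.comp_mem _ _ (Q.of_isPullback (α.isPullback_fillingSource hY) hh) hY'

end BigonBetween

/-- `relClass` is compatible with composition. -/
theorem relClass_comp {Q : MorphismProperty (D ⥤ Type u)} [Q.IsMultiplicative]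
    [Q.IsStableUnderBaseChange] {Z K Y : D ⥤ SSet.{u}} {p : Z ⟶ K} {p' : K ⟶ Y} {A B : SSet.{u}}
    {i : A ⟶ B} (h : relClass Q p i) (h' : relClass Q p' i) : relClass Q (p ≫ p') i := by
  let a : relHom i (p ≫ p') ⟶ relHom i p' :=
    { app T := ↾fun q => ⟨(q.1.1 ≫ p.app T, q.1.2), (Category.assoc _ _ _).trans q.2⟩
      naturality T T' t := by
        ext q
        refine relHom_ext ?_ rfl
        change (q.1.1 ≫ Z.map t) ≫ p.app T' = (q.1.1 ≫ p.app T) ≫ K.map t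
        rw [Category.assoc, Category.assoc, p.naturality] }
  let b : relHom i p ⟶ relHom i (p ≫ p') :=
    { app T := ↾fun q => ⟨(q.1.1, q.1.2 ≫ p'.app T), by
        change q.1.1 ≫ p.app T ≫ p'.app T = i ≫ q.1.2 ≫ p'.app T
        rw [← Category.assoc, q.2, Category.assoc]⟩
      naturality T T' t := by
        ext q
        refine relHom_ext rfl ?_
        change (q.1.2 ≫ K.map t) ≫ p'.app T' = (q.1.2 ≫ p'.app T) ≫ Y.map t
        rw [Category.assoc, Category.assoc, p'.naturality] }
  have e : relRes i (p ≫ p') = relRes i p ≫ b := by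
    ext T x
    exact relHom_ext rfl (Category.assoc _ _ _).symm
  change Q (relRes i (p ≫ p'))
  rw [e]
  refine Q.comp_mem _ _ h (Q.of_isPullback (f' := relHomSnd i p) (f := a)
    (isPullback_of_existsUnique ?_ fun T x y hxy => ?_) h')
  · ext T q
    exact relHom_ext q.2.symm rfl
  · have h1 : i ≫ x = y.1.1 ≫ p.app T := congrArg (fun q => q.1.1) hxy
    have h2 : x ≫ p'.app T = y.1.2 := congrArg (fun q => q.1.2) hxy
    exact ⟨⟨(y.1.1, x), h1.symm⟩, ⟨rfl, relHom_ext rfl h2⟩, fun z hz =>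
      relHom_ext (congrArg (fun q => q.1.1) hz.2) hz.1⟩

end SSet

/-! ### The square as a union of two triangles -/

namespace SSet

open MonoidalCategory CartesianMonoidalCategory

/-- Attaching a simplicial set along a monomorphism `t` to a subcomplex `A`. -/
theorem isPushout_of_preimage {X B : SSet.{u}} (t : B ⟶ X) [Mono t] {A A' : X.Subcomplex}
    {S : B.Subcomplex} (hS : A.preimage t = S) (hAA' : A ≤ A') (ht : ∀ n x, t.app n x ∈ A'.obj n)
    (hA' : ∀ n, ∀ x ∈ A'.obj n, x ∈ A.obj n ∨ ∃ y, t.app n y = x) :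
    IsPushout (Subcomplex.lift (S.ι ≫ t) (by rw [← hS]; rintro n _ ⟨⟨x, hx⟩, rfl⟩; exact hx) :
        (S : SSet.{u}) ⟶ A) S.ι (Subcomplex.homOfLE hAA')
      (Subcomplex.lift t (by rintro n _ ⟨x, rfl⟩; exact ht n x) : B ⟶ A') where
  w := rfl
  isColimit' := ⟨Limits.evaluationJointlyReflectsColimits _ fun n => by
    refine (Limits.isColimitMapCoconePushoutCoconeEquiv _ _).2 (IsPushout.isColimit ?_)
    have hinj : Function.Injective (t.app n) := (mono_iff_injective _).1 inferInstance
    refine Limits.Types.isPushout_of_isPullback_of_mono' ?_ ?_ ?_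
    · rw [Limits.Types.isPullback_iff]
      refine ⟨rfl, fun x y h => Subtype.ext h.2, fun x y h => ?_⟩
      have h' : x.1 = t.app n y := congrArg Subtype.val h
      have hy : y ∈ S.obj n := by
        rw [← hS]
        change t.app n y ∈ A.obj n
        rw [← h']
        exact x.2
      exact ⟨⟨y, hy⟩, Subtype.ext h'.symm, rfl⟩
    · refine Set.eq_univ_of_forall fun x => ?_
      rcases hA' n x.1 x.2 with h | ⟨y, hy⟩
      · exact Or.inl ⟨⟨x.1, h⟩, rfl⟩
      · exact Or.inr ⟨y, Subtype.ext hy⟩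
    · intro x y _ _ h
      exact hinj (congrArg Subtype.val h)⟩

/-- The triangle `00, 01, 11` in the square. -/
noncomputable def firstTriangle : (Δ[2] : SSet.{u}) ⟶ Δ[1] ⊗ Δ[1] :=
  lift (stdSimplex.σ 0) (stdSimplex.σ 1)

/-- The triangle `00, 10, 11` in the square. -/
noncomputable def secondTriangle : (Δ[2] : SSet.{u}) ⟶ Δ[1] ⊗ Δ[1] :=
  lift (stdSimplex.σ 1) (stdSimplex.σ 0)

theorem δ_two_firstTriangle : stdSimplex.δ 2 ≫ firstTriangle.{u} = atVertex 0 Δ[1] := by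
  refine CartesianMonoidalCategory.hom_ext _ _ ?_ ?_
  · ext ⟨⟨n⟩⟩ x : 4
    refine stdSimplex.ext _ _ fun k => ?_
    have h0 : ∀ y : Fin 2, Fin.predAbove (0 : Fin 2) (Fin.succAbove (2 : Fin 3) y) = 0 := by decide
    exact h0 _
  · exact stdSimplex.δ_comp_σ_succ (n := 1) (i := 1)

theorem mem_boundary_one {n : ℕ} {x : (Δ[1] : SSet.{u}) _⦋n⦌} :
    x ∈ ∂Δ[1].obj (op ⦋n⦌) ↔ (∀ k, x k = 0) ∨ ∀ k, x k = 1 := by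
  change ¬ Function.Surjective x ↔ _
  rw [← not_iff_not, not_not, not_or, not_forall, not_forall]
  have h2 : ∀ y : Fin 2, (¬ y = 0 ↔ y = 1) ∧ (¬ y = 1 ↔ y = 0) := by decide
  refine ⟨fun h => ?_, fun h y => ?_⟩
  · obtain ⟨a, ha⟩ := h 0
    obtain ⟨b, hb⟩ := h 1
    exact ⟨⟨b, by rw [hb]; decide⟩, ⟨a, by rw [ha]; decide⟩⟩
  · obtain ⟨⟨b, hb⟩, ⟨a, ha⟩⟩ := h
    rcases eq_or_ne y 0 with rfl | hy
    · exact ⟨a, ((h2 _).2).1 ha⟩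
    · exact ⟨b, (((h2 _).1).1 hb).trans (((h2 _).1).1 hy).symm⟩

theorem mem_horn_one_one {n : ℕ} {x : (Δ[1] : SSet.{u}) _⦋n⦌} :
    x ∈ Λ[0 + 1, 1].obj (op ⦋n⦌) ↔ ∀ k, x k = 1 := by
  rw [mem_horn_iff_notMem_range]
  have h2 : ∀ y : Fin 2, (y ≠ 0 ↔ y = 1) := by decide
  constructor
  · rintro ⟨j, hj, h⟩ k
    have : j = 0 := by
      by_contra h0
      exact hj ((h2 j).1 h0)
    subst this
    exact (h2 _).1 fun h' => h ⟨k, h'⟩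
  · intro h
    refine ⟨0, by decide, ?_⟩
    rintro ⟨k, hk⟩
    rw [h k] at hk
    exact absurd hk (by decide)

theorem mem_horn_two_one {n : ℕ} {x : (Δ[2] : SSet.{u}) _⦋n⦌} :
    x ∈ Λ[2, 1].obj (op ⦋n⦌) ↔ (∀ k, x k ≠ 0) ∨ ∀ k, x k ≠ 2 := by
  rw [mem_horn_iff_notMem_range]
  constructor
  · rintro ⟨j, hj, h⟩
    fin_cases j
    · exact Or.inl fun k hk => h ⟨k, hk⟩
    · exact (hj rfl).elim
    · exact Or.inr fun k hk => h ⟨k, hk⟩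
  · rintro (h | h)
    · exact ⟨0, by decide, fun ⟨k, hk⟩ => h k hk⟩
    · exact ⟨2, by decide, fun ⟨k, hk⟩ => h k hk⟩

theorem mem_horn_two_two {n : ℕ} {x : (Δ[2] : SSet.{u}) _⦋n⦌} :
    x ∈ Λ[2, 2].obj (op ⦋n⦌) ↔ (∀ k, x k ≠ 0) ∨ ∀ k, x k ≠ 1 := by
  rw [mem_horn_iff_notMem_range]
  constructor
  · rintro ⟨j, hj, h⟩
    fin_cases j
    · exact Or.inl fun k hk => h ⟨k, hk⟩
    · exact Or.inr fun k hk => h ⟨k, hk⟩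
    · exact (hj rfl).elim
  · rintro (h | h)
    · exact ⟨0, by decide, fun ⟨k, hk⟩ => h k hk⟩
    · exact ⟨1, by decide, fun ⟨k, hk⟩ => h k hk⟩

/-- The degeneracy maps `Δ[2] ⟶ Δ[1]` on vertices. -/
theorem predAbove_facts : ∀ y : Fin 3,
    (Fin.predAbove (0 : Fin 2) y = 0 ↔ y ≠ 2) ∧ (Fin.predAbove (0 : Fin 2) y = 1 ↔ y = 2) ∧
    (Fin.predAbove (1 : Fin 2) y = 0 ↔ y = 0) ∧ (Fin.predAbove (1 : Fin 2) y = 1 ↔ y ≠ 0) := by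
  decide

instance : Mono firstTriangle.{u} := by
  rw [NatTrans.mono_iff_mono_app]
  rintro ⟨⟨n⟩⟩
  rw [mono_iff_injective]
  intro x y h
  have h0 : ∀ a b : Fin 3, Fin.predAbove (0 : Fin 2) a = Fin.predAbove (0 : Fin 2) b →
    Fin.predAbove (1 : Fin 2) a = Fin.predAbove (1 : Fin 2) b → a = b := by decide
  refine stdSimplex.ext _ _ fun k => h0 _ _ ?_ ?_
  · exact DFunLike.congr_fun (F := (Δ[1] : SSet.{u}) _⦋n⦌) (congrArg Prod.fst h) k
  · exact DFunLike.congr_fun (F := (Δ[1] : SSet.{u}) _⦋n⦌) (congrArg Prod.snd h) k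

instance : Mono secondTriangle.{u} := by
  rw [NatTrans.mono_iff_mono_app]
  rintro ⟨⟨n⟩⟩
  rw [mono_iff_injective]
  intro x y h
  have h0 : ∀ a b : Fin 3, Fin.predAbove (1 : Fin 2) a = Fin.predAbove (1 : Fin 2) b →
    Fin.predAbove (0 : Fin 2) a = Fin.predAbove (0 : Fin 2) b → a = b := by decide
  refine stdSimplex.ext _ _ fun k => h0 _ _ ?_ ?_
  · exact DFunLike.congr_fun (F := (Δ[1] : SSet.{u}) _⦋n⦌) (congrArg Prod.fst h) k
  · exact DFunLike.congr_fun (F := (Δ[1] : SSet.{u}) _⦋n⦌) (congrArg Prod.snd h) k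

/-- Three sides of the square. -/
noncomputable abbrev threeSides : (Δ[1] ⊗ Δ[1] : SSet.{u}).Subcomplex :=
  Subcomplex.unionProd.{u} Λ[0 + 1, 1] ∂Δ[1]

/-- Three sides and one triangle of the square. -/
noncomputable def filledSides : (Δ[1] ⊗ Δ[1] : SSet.{u}).Subcomplex :=
  threeSides ⊔ Subcomplex.range secondTriangle

theorem mem_threeSides {n : ℕ} {x : (Δ[1] ⊗ Δ[1] : SSet.{u}) _⦋n⦌} :
    x ∈ threeSides.obj (op ⦋n⦌) ↔
      ((∀ k, (show (Δ[1] : SSet.{u}) _⦋n⦌ from x.2) k = 0) ∨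
        ∀ k, (show (Δ[1] : SSet.{u}) _⦋n⦌ from x.2) k = 1) ∨
      ∀ k, (show (Δ[1] : SSet.{u}) _⦋n⦌ from x.1) k = 1 := by
  refine (Subcomplex.mem_unionProd_iff _ _ x).trans (or_congr mem_boundary_one mem_horn_one_one)

/-- The missing side has first coordinate 0, so the triangle 00, 10, 11 meets the other three in its
edges 00–10 and 10–11; its diagonal is free. -/
theorem preimage_secondTriangle : threeSides.preimage secondTriangle.{u} = Λ[2, 1] := by
  ext ⟨⟨n⟩⟩ x
  refine mem_threeSides.trans (Iff.trans ?_ mem_horn_two_one.symm)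
  change ((∀ k, Fin.predAbove (0 : Fin 2) (x k) = 0) ∨ ∀ k, Fin.predAbove (0 : Fin 2) (x k) = 1) ∨
    (∀ k, Fin.predAbove (1 : Fin 2) (x k) = 1) ↔ _
  simp only [(predAbove_facts _).1, (predAbove_facts _).2.1, (predAbove_facts _).2.2.2]
  constructor
  · rintro ((h | h) | h)
    · exact Or.inr h
    · exact Or.inl fun k => by rw [h k]; decide
    · exact Or.inl h
  · rintro (h | h)
    · exact Or.inr h
    · exact Or.inl (Or.inl h)

/-- The edge 01–11 is one of the three sides and the diagonal belongs to the other triangle. The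
free edge 00–01 is the one that must come from K. -/
theorem preimage_firstTriangle : filledSides.preimage firstTriangle.{u} = Λ[2, 2] := by
  ext ⟨⟨n⟩⟩ x
  refine (or_congr mem_threeSides Iff.rfl).trans (Iff.trans ?_ mem_horn_two_two.symm)
  change (((∀ k, Fin.predAbove (1 : Fin 2) (x k) = 0) ∨
    ∀ k, Fin.predAbove (1 : Fin 2) (x k) = 1) ∨
    (∀ k, Fin.predAbove (0 : Fin 2) (x k) = 1)) ∨ _ ↔ _
  simp only [(predAbove_facts _).2.1, (predAbove_facts _).2.2.1, (predAbove_facts _).2.2.2]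
  have h0 : ∀ a b : Fin 3, Fin.predAbove (1 : Fin 2) a = Fin.predAbove (0 : Fin 2) b →
    Fin.predAbove (0 : Fin 2) a = Fin.predAbove (1 : Fin 2) b → b ≠ 1 := by decide
  constructor
  · rintro (((h | h) | h) | ⟨y, hy⟩)
    · exact Or.inr fun k => by rw [h k]; decide
    · exact Or.inl h
    · exact Or.inl fun k => by rw [h k]; decide
    · exact Or.inr fun k => h0 ((show (Δ[2] : SSet.{u}) _⦋n⦌ from y) k) _
        (DFunLike.congr_fun (F := (Δ[1] : SSet.{u}) _⦋n⦌) (congrArg Prod.fst hy) k)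
        (DFunLike.congr_fun (F := (Δ[1] : SSet.{u}) _⦋n⦌) (congrArg Prod.snd hy) k)
  · rintro (h | h)
    · exact Or.inl (Or.inl (Or.inr h))
    · refine Or.inr ⟨x, ?_⟩
      have h1 : ∀ y : Fin 3, y ≠ 1 → Fin.predAbove (1 : Fin 2) y = Fin.predAbove (0 : Fin 2) y := by
        decide
      refine Prod.ext (stdSimplex.ext _ _ fun k => ?_) (stdSimplex.ext _ _ fun k => ?_)
      · exact h1 _ (h k)
      · exact (h1 _ (h k)).symm

/-- The vertices 10 and 01 are incomparable, so a simplex of the square, being a chain, avoids one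
of them and lies in one of the triangles. -/
theorem mem_filledSides_or {n : SimplexCategoryᵒᵖ} (x : (Δ[1] ⊗ Δ[1] : SSet.{u}).obj n) :
    x ∈ filledSides.obj n ∨ ∃ y, firstTriangle.app n y = x := by
  obtain ⟨⟨n⟩⟩ := n
  let a : (Δ[1] : SSet.{u}) _⦋n⦌ := x.1
  let b : (Δ[1] : SSet.{u}) _⦋n⦌ := x.2
  -- The vertices of y are the sums of the two coordinates, which is the right position in either
  -- triangle.
  let y : (Δ[2] : SSet.{u}) _⦋n⦌ :=
    stdSimplex.objMk (prodStdSimplex.orderHomOfSimplex (p := 1) (q := 1) (n := n) x rfl)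
  by_cases h : ∃ k, a k = 1 ∧ b k = 0
  · have h0 : ∀ (c d : Fin 2) (e : Fin 3), (e : ℕ) = c + d → ¬ (c = 0 ∧ d = 1) →
      Fin.predAbove (1 : Fin 2) e = c ∧ Fin.predAbove (0 : Fin 2) e = d := by decide
    have h1 (k) : ¬ (a k = 0 ∧ b k = 1) := by
      rintro ⟨ha, hb⟩
      obtain ⟨l, hla, hlb⟩ := h
      rcases le_total k l with hkl | hkl
      · have := stdSimplex.monotone_apply b hkl
        simp [hb, hlb] at this
      · have := stdSimplex.monotone_apply a hkl
        simp [ha, hla] at this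
    refine Or.inl (Or.inr ⟨y, ?_⟩)
    refine Prod.ext (stdSimplex.ext _ _ fun k => ?_) (stdSimplex.ext _ _ fun k => ?_)
    · exact (h0 _ _ (y k) rfl (h1 k)).1
    · exact (h0 _ _ (y k) rfl (h1 k)).2
  · have h0 : ∀ (c d : Fin 2) (e : Fin 3), (e : ℕ) = c + d → ¬ (c = 1 ∧ d = 0) →
      Fin.predAbove (0 : Fin 2) e = c ∧ Fin.predAbove (1 : Fin 2) e = d := by decide
    refine Or.inr ⟨y, ?_⟩
    refine Prod.ext (stdSimplex.ext _ _ fun k => ?_) (stdSimplex.ext _ _ fun k => ?_)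
    · exact (h0 _ _ (y k) rfl fun hk => h ⟨k, hk⟩).1
    · exact (h0 _ _ (y k) rfl fun hk => h ⟨k, hk⟩).2

theorem exists_isPushout_filledSides : ∃ (s : (Λ[2, 1] : SSet.{u}) ⟶ threeSides)
    (t : Δ[2] ⟶ (filledSides : SSet.{u})),
    IsPushout s Λ[2, 1].ι (Subcomplex.homOfLE (le_sup_left : threeSides ≤ filledSides)) t :=
  ⟨_, _, isPushout_of_preimage (A' := filledSides) secondTriangle preimage_secondTriangle
    le_sup_left (fun _ x => Or.inr ⟨x, rfl⟩) fun _ _ hx => hx⟩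

theorem exists_isPushout_firstTriangle : ∃ s : (Λ[2, 2] : SSet.{u}) ⟶ filledSides,
    IsPushout s Λ[2, 2].ι filledSides.ι firstTriangle := by
  obtain ⟨s, sq⟩ : ∃ s, IsPushout s Λ[2, 2].ι (Subcomplex.homOfLE le_top)
      (Subcomplex.lift firstTriangle.{u} (B := ⊤) le_top) :=
    ⟨_, isPushout_of_preimage firstTriangle preimage_firstTriangle
      (le_top (a := filledSides)) (fun _ _ => trivial) fun n x _ => mem_filledSides_or x⟩
  exact ⟨s, sq.of_iso (Iso.refl _) (Iso.refl _) (Iso.refl _) (Subcomplex.topIso _) rfl rfl rfl rfl⟩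

end SSet

/-! ### Edges of the path fibre product over Y -/

namespace SSet

open MonoidalCategory CartesianMonoidalCategory

variable {D : Type*} [Category D] {K Y Z : D ⥤ SSet.{u}} {f : K ⟶ Y} {p : Z ⟶ K}
  {s : Z ⟶ pathObject Y}

/-- The edges of the first triangle other than the initial one. -/
noncomputable def hornToSides : (Λ[2, 2] : SSet.{u}) ⟶ filledSides :=
  exists_isPushout_firstTriangle.choose

theorem isPushout_firstTriangle :
    IsPushout hornToSides.{u} Λ[2, 2].ι filledSides.ι firstTriangle :=
  exists_isPushout_firstTriangle.choose_spec

theorem threeSides_filledSides_mem {Q : MorphismProperty (D ⥤ Type u)} [Q.IsMultiplicative]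
    [Q.IsStableUnderBaseChange] (h : extClass Q Y Λ[2, 1].ι) :
    extClass Q Y (Subcomplex.homOfLE (le_sup_left : threeSides ≤ filledSides)) := by
  obtain ⟨a, b, sq⟩ := exists_isPushout_filledSides.{u}
  exact (extClass Q Y).of_isPushout sq h

/-- Squares from `∂Δ[1] ⟶ Δ[1]` to `s ≫ pathEval 1 Y`, as maps out of three sides of the square. -/
noncomputable def toSides (s : Z ⟶ pathObject Y) :
    relHom (∂Δ[1].ι : (∂Δ[1] : SSet.{u}) ⟶ _) (s ≫ pathEval 1 Y) ⟶
      homFunctor (threeSides : SSet.{u}) Y :=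
  (show relHom ∂Δ[1].ι (s ≫ pathEval 1 Y) ⟶ relHom ∂Δ[1].ι (pathEval 1 Y) from
    { app T := ↾fun q => ⟨(q.1.1 ≫ s.app T, q.1.2), (Category.assoc _ _ _).trans q.2⟩
      naturality T T' t := by
        ext q
        refine relHom_ext ?_ rfl
        change (q.1.1 ≫ Z.map t) ≫ s.app T' = (q.1.1 ≫ s.app T) ≫ (pathObject Y).map t
        rw [Category.assoc, Category.assoc, s.naturality] }) ≫ sidesOfSquare 1 Y ∂Δ[1]

theorem toSides_relRes {T : D} (z : Δ[1] ⟶ Z.obj T) :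
    (toSides s).app T ((relRes ∂Δ[1].ι (s ≫ pathEval 1 Y)).app T z) =
      threeSides.ι ≫ pathEquiv Y Δ[1] T (z ≫ s.app T) := by
  rw [← sidesOfSquare_relRes, Equiv.symm_apply_apply]
  refine congrArg ((sidesOfSquare 1 Y ∂Δ[1]).app T) (relHom_ext ?_ ?_)
  · exact Category.assoc _ _ _
  · exact (Category.assoc _ _ _).symm

theorem of_toSides_eq {T : D} {q : (relHom (∂Δ[1].ι : (∂Δ[1] : SSet.{u}) ⟶ _)
      (s ≫ pathEval 1 Y)).obj T} {x : Δ[1] ⊗ Δ[1] ⟶ Y.obj T}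
    (h : (toSides s).app T q = threeSides.ι ≫ x) :
    ∂Δ[1].ι ≫ (pathEquiv Y Δ[1] T).symm x = q.1.1 ≫ s.app T ∧
      (pathEquiv Y Δ[1] T).symm x ≫ (pathEval 1 Y).app T = q.1.2 := by
  rw [← sidesOfSquare_relRes] at h
  have := sidesOfSquare_injective T h
  exact ⟨(congrArg (fun q => q.1.1) this).symm, (congrArg (fun q => q.1.2) this).symm⟩

/-- Squares together with a filling of the second triangle. -/
noncomputable abbrev partialSquare (s : Z ⟶ pathObject Y) : D ⥤ Type u :=
  fiberFunctor (toSides s)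
    (homFunctorRes (Subcomplex.homOfLE (le_sup_left : threeSides ≤ filledSides)) Y)

/-- The restriction of an edge of `Z` to its partial square. -/
noncomputable def toPartialSquare (s : Z ⟶ pathObject Y) :
    homFunctor Δ[1] Z ⟶ partialSquare s where
  app T := ↾fun z => ⟨((relRes ∂Δ[1].ι (s ≫ pathEval 1 Y)).app T z,
    filledSides.ι ≫ pathEquiv Y Δ[1] T (z ≫ s.app T)), toSides_relRes z⟩
  naturality T T' t := by
    ext z : 3
    refine Subtype.ext (Prod.ext ?_ ?_)
    · exact ConcreteCategory.congr_hom ((relRes ∂Δ[1].ι (s ≫ pathEval 1 Y)).naturality t) z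
    · change filledSides.ι ≫ pathEquiv Y Δ[1] T' ((z ≫ Z.map t) ≫ s.app T') =
        (filledSides.ι ≫ pathEquiv Y Δ[1] T (z ≫ s.app T)) ≫ Y.map t
      rw [Category.assoc, s.naturality, ← Category.assoc z, pathEquiv_comp_map, Category.assoc]

/-- The first triangle of an edge of `Z`. -/
noncomputable def toFirstTriangle (sq : p ≫ f = s ≫ pathEval 0 Y) :
    homFunctor Δ[1] Z ⟶ relHom (stdSimplex.δ 2 : Δ[1] ⟶ Δ[2]) f where
  app T := ↾fun z => ⟨(z ≫ p.app T, firstTriangle ≫ pathEquiv Y Δ[1] T (z ≫ s.app T)), by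
    change (z ≫ p.app T) ≫ f.app T = stdSimplex.δ 2 ≫ _
    rw [← Category.assoc, δ_two_firstTriangle, ← comp_pathEval, Category.assoc, Category.assoc,
      ← NatTrans.comp_app, ← NatTrans.comp_app, sq]⟩
  naturality T T' t := by
    ext z : 3
    refine relHom_ext ?_ ?_
    · change (z ≫ Z.map t) ≫ p.app T' = (z ≫ p.app T) ≫ K.map t
      rw [Category.assoc, Category.assoc, p.naturality]
    · change firstTriangle ≫ pathEquiv Y Δ[1] T' ((z ≫ Z.map t) ≫ s.app T') =
        (firstTriangle ≫ pathEquiv Y Δ[1] T (z ≫ s.app T)) ≫ Y.map t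
      rw [Category.assoc, s.naturality, ← Category.assoc z, pathEquiv_comp_map, Category.assoc]

/-- An edge of Z is an edge of K with a square over its image, and the square is the filled sides
glued to the first triangle along Λ[2,2]. Injectivity of f on maps from ∂Δ[1] ensures that the edge
of K has the prescribed end points, since these are only known after mapping to Y. -/
theorem isPullback_toPartialSquare (sq : IsPullback p s f (pathEval 0 Y))
    (hf : ∀ T (a b : (∂Δ[1] : SSet.{u}) ⟶ K.obj T), a ≫ f.app T = b ≫ f.app T → a = b) :
    IsPullback (toFirstTriangle sq.w) (toPartialSquare s)
      (relHomSnd _ f ≫ homFunctorRes Λ[2, 2].ι Y)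
      (fiberFunctorSnd _ _ ≫ homFunctorRes hornToSides Y) := by
  refine isPullback_of_existsUnique ?_ fun T v w h => ?_
  · refine NatTrans.ext (funext fun T => ?_)
    ext z : 3
    change Λ[2, 2].ι ≫ firstTriangle ≫ pathEquiv Y Δ[1] T (z ≫ s.app T) =
      hornToSides ≫ filledSides.ι ≫ pathEquiv Y Δ[1] T (z ≫ s.app T)
    rw [isPushout_firstTriangle.w_assoc]
  · obtain ⟨⟨k, t⟩, hkt⟩ := v
    obtain ⟨⟨q, c⟩, hqc⟩ := w
    change k ≫ f.app T = stdSimplex.δ 2 ≫ t at hkt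
    change (toSides s).app T q = Subcomplex.homOfLE le_sup_left ≫ c at hqc
    change Λ[2, 2].ι ≫ t = hornToSides ≫ c at h
    let x : Δ[1] ⊗ Δ[1] ⟶ Y.obj T := isPushout_firstTriangle.desc c t h.symm
    have hx₁ : filledSides.ι ≫ x = c := isPushout_firstTriangle.inl_desc _ _ _
    have hx₂ : firstTriangle ≫ x = t := isPushout_firstTriangle.inr_desc _ _ _
    obtain ⟨e₁, e₂⟩ := of_toSides_eq (q := q) (x := x) (by rw [hqc, ← hx₁]; rfl)
    have sqT := sq.map ((evaluation D SSet.{u}).obj T)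
    have hz : k ≫ f.app T = (pathEquiv Y Δ[1] T).symm x ≫ (pathEval 0 Y).app T := by
      rw [comp_pathEval, Equiv.apply_symm_apply, ← δ_two_firstTriangle, Category.assoc, hx₂, hkt]
    let z : Δ[1] ⟶ Z.obj T := sqT.lift k ((pathEquiv Y Δ[1] T).symm x) hz
    have hz₁ : z ≫ p.app T = k := sqT.lift_fst _ _ _
    have hz₂ : z ≫ s.app T = (pathEquiv Y Δ[1] T).symm x := sqT.lift_snd _ _ _
    refine ⟨z, ⟨relHom_ext hz₁ ?_, Subtype.ext (Prod.ext (relHom_ext ?_ ?_) ?_)⟩, ?_⟩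
    · change firstTriangle ≫ pathEquiv Y Δ[1] T (z ≫ s.app T) = t
      rw [hz₂, Equiv.apply_symm_apply, hx₂]
    · change ∂Δ[1].ι ≫ z = q.1.1
      refine sqT.hom_ext ?_ ?_
      · change (∂Δ[1].ι ≫ z) ≫ p.app T = q.1.1 ≫ p.app T
        apply hf
        have w : p.app T ≫ f.app T = s.app T ≫ (pathEval 0 Y).app T := NatTrans.congr_app sq.w T
        rw [Category.assoc, Category.assoc, Category.assoc, w, reassoc_of% hz₂, ← Category.assoc,
          e₁, Category.assoc]
      · change (∂Δ[1].ι ≫ z) ≫ s.app T = q.1.1 ≫ s.app T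
        rw [Category.assoc, hz₂, e₁]
    · change z ≫ s.app T ≫ (pathEval 1 Y).app T = q.1.2
      rw [← Category.assoc, hz₂, e₂]
    · change filledSides.ι ≫ pathEquiv Y Δ[1] T (z ≫ s.app T) = c
      rw [hz₂, Equiv.apply_symm_apply, hx₁]
    · intro z' ⟨h₁, h₂⟩
      have h₃ : z' ≫ p.app T = k := congrArg (fun q => q.1.1) h₁
      have h₄ : firstTriangle ≫ pathEquiv Y Δ[1] T (z' ≫ s.app T) = t :=
        congrArg (fun q => q.1.2) h₁
      have h₅ : filledSides.ι ≫ pathEquiv Y Δ[1] T (z' ≫ s.app T) = c :=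
        congrArg (fun q => q.1.2) h₂
      refine sqT.hom_ext (h₃.trans hz₁.symm) ?_
      change z' ≫ s.app T = z ≫ s.app T
      rw [hz₂, Equiv.eq_symm_apply]
      exact isPushout_firstTriangle.hom_ext (h₅.trans hx₁.symm) (h₄.trans hx₂.symm)

/-- The natural map from the edges of `Z = K ×_Y Y^I` to the squares from `∂Δ[1] ⟶ Δ[1]` to
`Z ⟶ Y`. -/
theorem relClass_comp_pathEval {Q : MorphismProperty (D ⥤ Type u)} [Q.IsMultiplicative]
    [Q.IsStableUnderBaseChange] (sq : IsPullback p s f (pathEval 0 Y))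
    (hf : ∀ T (a b : (∂Δ[1] : SSet.{u}) ⟶ K.obj T), a ≫ f.app T = b ≫ f.app T → a = b)
    (h₁ : extClass Q Y Λ[2, 1].ι)
    (h₂ : Q (relHomSnd (stdSimplex.δ 2 : Δ[1] ⟶ Δ[2]) f ≫ homFunctorRes Λ[2, 2].ι Y)) :
    relClass Q (s ≫ pathEval 1 Y) ∂Δ[1].ι := by
  have e : relRes ∂Δ[1].ι (s ≫ pathEval 1 Y) =
    toPartialSquare s ≫ fiberFunctorFst _ _ := rfl
  change Q _
  rw [e]
  -- The first factor fills the triangle whose free edge lifts to K; the second fills the other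
  -- triangle by Kan(2,1).
  exact Q.comp_mem _ _ (Q.of_isPullback (isPullback_toPartialSquare sq hf) h₂)
    (Q.of_isPullback (isPullback_fiberFunctor _ _).flip (threeSides_filledSides_mem h₁))

end SSet

/-! ### Boundaries, horns and faces in low dimension -/

namespace SSet

section cells

variable {D : Type*} [Category D] {Q : MorphismProperty (D ⥤ Type u)} [Q.IsMultiplicative]
  [Q.IsStableUnderBaseChange] {Z K Y : D ⥤ SSet.{u}} {p : Z ⟶ K}

/-- `hom(A, Z) ⟶ hom(A, K)` is in `Q` if `A` is finite of dimension `< d` and the boundary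
inclusions of dimension `< d` belong to `relClass Q p`. -/
theorem homFunctorMap_mem_of_boundary (A : SSet.{u}) [A.Finite] (d : ℕ) [A.HasDimensionLT d]
    (h : ∀ n < d, relClass Q p ∂Δ[n].ι) : Q (homFunctorMap A p) :=
  homFunctorMap_mem Limits.initialIsInitial (i := Limits.initial.to A)
    (mono_mem _ fun n ⟨x, _⟩ => h n (A.dim_lt_of_nonDegenerate x d))

/-- The boundary of the point is empty. -/
def isInitialBoundaryZero : Limits.IsInitial (∂Δ[0] : SSet.{u}) :=
  boundary_zero.{u} ▸ Subcomplex.isInitialBot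

/-- Since ∂Δ[0] is empty, a square from ∂Δ[0] → Δ[0] is just its bottom map. -/
theorem relClass_boundary_zero_iff :
    relClass Q p (∂Δ[0].ι : (∂Δ[0] : SSet.{u}) ⟶ Δ[0]) ↔ Q (homFunctorMap Δ[0] p) := by
  refine ⟨fun h => homFunctorMap_mem isInitialBoundaryZero h, fun h => ?_⟩
  have : IsIso (relHomSnd (∂Δ[0].ι : (∂Δ[0] : SSet.{u}) ⟶ Δ[0]) p) := by
    rw [isIso_iff_bijective_app]
    exact fun T => ⟨fun x y h => relHom_ext (isInitialBoundaryZero.hom_ext _ _) h, fun y =>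
      ⟨⟨(isInitialBoundaryZero.to _, y), isInitialBoundaryZero.hom_ext _ _⟩, rfl⟩⟩
  exact (Q.cancel_right_of_respectsIso (relRes ∂Δ[0].ι p) (relHomSnd _ p)).1 h

/-- Nondegenerate simplices outside of a horn of dimension `m + 1` have dimension `≥ m`. -/
theorem le_of_notMem_horn {m n : ℕ} {j : Fin (m + 2)} {x : (Δ[m + 1] : SSet.{u}) _⦋n⦌}
    (hx : x ∉ Λ[m + 1, j].obj (op ⦋n⦌)) : m ≤ n := by
  by_contra! h
  exact hx (by rw [horn_obj_eq_univ j n (by lia)]; trivial)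

/-- The cells missing from the horn have dimension at least m ≥ d, so only boundaries in the range
of h are attached. -/
theorem relClass_horn (m d : ℕ) (hd : d ≤ m) (j : Fin (m + 2))
    (h : ∀ n, d ≤ n → relClass Q p (∂Δ[n].ι : (∂Δ[n] : SSet.{u}) ⟶ Δ[n])) :
    relClass Q p (Λ[m + 1, j].ι : (Λ[m + 1, j] : SSet.{u}) ⟶ Δ[m + 1]) :=
  mono_mem _ fun n ⟨_, hx⟩ => h n (hd.trans (le_of_notMem_horn (j := j) fun h => hx ⟨⟨_, h⟩, rfl⟩))

/-- The classes of boundary inclusions for the evaluation of paths at a vertex. -/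
theorem relClass_pathEval_boundary (ε : Fin 2) (n : ℕ)
    (h : ∀ (m : ℕ) (j : Fin (m + 2)), n ≤ m →
      extClass Q Y (Λ[m + 1, j].ι : (Λ[m + 1, j] : SSet.{u}) ⟶ Δ[m + 1])) :
    relClass Q (pathEval ε Y) ∂Δ[n].ι :=
  relClass_pathEval ε _ (unionProd_horn_boundary_mem (W := extClass Q Y) ε n h)

/-- The restriction to the initial vertex. -/
theorem δ_one_mem (h : extClass Q Y (Λ[0 + 1, 0].ι : (Λ[0 + 1, 0] : SSet.{u}) ⟶ Δ[0 + 1])) :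
    extClass Q Y (stdSimplex.δ 1 : Δ[0] ⟶ Δ[1]) := by
  -- The horn Λ[1,0] is a single vertex, so restriction to that vertex is an isomorphism.
  have h1 : extClass Q Y (horn.ι.{u} (n := 0) 0 1 (by decide)) := by
    have : IsIso (homFunctorRes (horn.ι.{u} (n := 0) 0 1 (by decide)) Y) := by
      rw [isIso_iff_bijective_app]
      refine fun T => ⟨fun x y hxy => horn.hom_ext' fun i hi => ?_, fun y => ?_⟩
      · obtain rfl : i = 1 := by lia
        exact hxy
      · obtain ⟨φ, hφ⟩ := horn.IsCompatible.exists_desc (n := 0) (i := 0)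
          (f := fun _ _ => (y : Δ[0] ⟶ Y.obj T)) trivial
        exact ⟨φ, hφ 1 (by decide)⟩
    exact Q.of_isIso _
  have h2 := (extClass Q Y).comp_mem _ _ h1 h
  rwa [horn.ι_ι] at h2

/-- The restriction to the first edge of a 2-simplex. -/
theorem δ_two_mem (h : extClass Q Y (Λ[0 + 1, 0].ι : (Λ[0 + 1, 0] : SSet.{u}) ⟶ Δ[0 + 1]))
    (h' : extClass Q Y (Λ[2, 1].ι : (Λ[2, 1] : SSet.{u}) ⟶ Δ[2])) :
    extClass Q Y (stdSimplex.δ 2 : Δ[1] ⟶ Δ[2]) := by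
  -- Λ[2,1] is two edges glued at a vertex; the inclusion of the first is a cobase change of the
  -- initial vertex of the second.
  have h2 := (extClass Q Y).comp_mem _ _
    ((extClass Q Y).of_isPushout horn₂₁.isPushout (δ_one_mem h)) h'
  rwa [horn.ι_ι] at h2

end cells

end SSet

/-! ### From presheaves back to simplicial manifolds -/

namespace SimplicialMfd

open BanMfd SSet

variable {K Y Z : SimplicialObject BanMfd.{u}}

theorem map_comp_simplex {X : SimplicialObject BanMfd.{u}} {T : BanMfd.{u}} {m n : ℕ}
    (φ : ⦋m⦌ ⟶ ⦋n⦌) (x : T ⟶ X _⦋n⦌) :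
    SSet.stdSimplex.map φ ≫ simplex x = simplex (x ≫ X.map φ.op) :=
  SSet.yonedaEquiv_symm_naturality_left (X := (points X).obj (op T)) φ x

/-- Levelwise representable presheaves of simplicial sets come from simplicial manifolds. -/
theorem exists_points_iso (P : BanMfd.{u}ᵒᵖ ⥤ SSet.{u})
    (h : ∀ n : ℕ, (homFunctor Δ[n] P).IsRepresentable) :
    ∃ Z : SimplicialObject BanMfd.{u}, Nonempty (points Z ≅ P) := by
  -- After exchanging the variables, this is a simplicial object in the essential image of Yoneda,
  -- which is fully faithful.
  let F : SimplexCategoryᵒᵖ ⥤ BanMfd.{u}ᵒᵖ ⥤ Type u := Functor.flip P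
  have hF (n : SimplexCategoryᵒᵖ) : yoneda.essImage (F.obj n) := by
    obtain ⟨⟨n⟩⟩ := n
    obtain ⟨L, ⟨r⟩⟩ := h n
    exact ⟨L, ⟨r.toIso ≪≫ NatIso.ofComponents (fun T => Equiv.toIso SSet.yonedaEquiv) (by
      intro T T' t
      ext x
      rfl)⟩⟩
  let e := Functor.essImage.liftFunctorCompIso F yoneda hF
  exact ⟨_, ⟨(flipFunctor _ _ _).mapIso e⟩⟩

/-- Morphisms between the presheaves of points come from morphisms of simplicial manifolds. -/
theorem exists_pointsMap_eq (φ : points Z ⟶ points K) : ∃ p : Z ⟶ K, pointsMap p = φ := by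
  let ψ : (Z ⋙ yoneda) ⟶ (K ⋙ yoneda) := (flipFunctor _ _ _).map φ
  refine ⟨{ app := fun n => yoneda.preimage (ψ.app n), naturality := fun n n' θ => ?_ }, ?_⟩
  · apply yoneda.map_injective
    simp only [Functor.map_comp, Functor.map_preimage]
    exact ψ.naturality θ
  · refine NatTrans.ext (funext fun T => NatTrans.ext (funext fun n => ?_))
    have : yoneda.map (yoneda.preimage (ψ.app n)) = ψ.app n := yoneda.map_preimage _
    exact NatTrans.congr_app this T

end SimplicialMfd

namespace SSet

theorem relClass_iso_comp {D : Type*} [Category D] {Q : MorphismProperty (D ⥤ Type u)}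
    [Q.IsStableUnderBaseChange] [Q.IsMultiplicative] {Z Z' K : D ⥤ SSet.{u}} (e : Z' ≅ Z)
    {p : Z ⟶ K} : relClass Q p ≤ relClass Q (e.hom ≫ p) :=
  relClass_of_isPullback (a := e.hom) (b := 𝟙 K) (.of_horiz_isIso ⟨by simp⟩)

end SSet

/-! ### Lie groupoid structure on the path fibre product, and part (I) -/

namespace SimplicialMfd

open BanMfd SSet

variable {K Y Z : SimplicialObject BanMfd.{u}} {n : ℕ}

theorem isomorphisms_le_surjSubmersions :
    .isomorphisms (BanMfd.{u}ᵒᵖ ⥤ Type u) ≤ surjSubmersions.presheaf :=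
  fun _ _ _ h => have := h; MorphismProperty.of_isIso _ _

theorem IsLieGroupoid.extClass_horn (h : IsLieGroupoid n K) (m : ℕ) (j : Fin (m + 2)) :
    extClass surjSubmersions.presheaf (points K) (Λ[m + 1, j].ι : (Λ[m + 1, j] : SSet.{u}) ⟶ _) :=
  (kan_iff.1 (h.kan (m + 1) j (by lia))).2

theorem IsLieGroupoid.extClass_isomorphisms_horn (h : IsLieGroupoid n K) (m : ℕ)
    (j : Fin (m + 2)) (hm : n ≤ m) :
    extClass (.isomorphisms _) (points K) (Λ[m + 1, j].ι : (Λ[m + 1, j] : SSet.{u}) ⟶ _) :=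
  kanUnique_iff.1 (h.kan_unique (m + 1) j (by lia))

theorem IsLieGroupoid.hasUniqueFillers (h : IsLieGroupoid 2 K) (j : Fin 4) (T : BanMfd.{u}ᵒᵖ) :
    HasUniqueFillers ((points K).obj T) 3 j :=
  (isIso_iff_bijective_app _).1 (h.extClass_isomorphisms_horn 2 j le_rfl) T

theorem isRepresentable_simplex (X : SimplicialObject BanMfd.{u}) (m : ℕ) :
    (homFunctor Δ[m] (points X)).IsRepresentable :=
  (simplexRepresentableBy X m).isRepresentable

/-- The boundary inclusions of a morphism of presheaves determine whether it comes from a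
hypercover. -/
theorem isHypercover_of_relClass {p : Z ⟶ K}
    (h : ∀ k < n, relClass surjSubmersions.presheaf (pointsMap p) ∂Δ[k].ι)
    (h' : relClass (.isomorphisms _) (pointsMap p) (∂Δ[n].ι : (∂Δ[n] : SSet.{u}) ⟶ Δ[n])) :
    IsHypercover n p where
  surjSubmersion k hk := isSurjSubmersionOnto_boundaryRestriction_iff.2
    ⟨MorphismProperty.presheaf.isRepresentable (relHomSnd_mem _
      (homFunctorMap_mem_of_boundary _ k fun m hm => h m (hm.trans hk))) (isRepresentable_simplex K k), h k hk⟩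
  iso := isIsoOnto_boundaryRestriction_iff.2 h'

/-- A presheaf of simplicial sets over a Lie groupoid is a Lie groupoid if it satisfies the
conditions of a hypercover. -/
theorem exists_isLieGroupoid (hK : IsLieGroupoid n K) {P : BanMfd.{u}ᵒᵖ ⥤ SSet.{u}}
    (p : P ⟶ points K) (h : ∀ k, relClass surjSubmersions.presheaf p ∂Δ[k].ι)
    (h' : ∀ k, n ≤ k →
      relClass (.isomorphisms _) p (∂Δ[k].ι : (∂Δ[k] : SSet.{u}) ⟶ Δ[k])) :
    ∃ Z : SimplicialObject BanMfd.{u}, IsLieGroupoid n Z ∧ Nonempty (points Z ≅ P) := by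
  -- The empty set is extended to A by finitely many cells, so hom(A, P) is relatively representable
  -- over hom(A, K).
  have hr (A : SSet.{u}) [A.Finite] (d : ℕ) [A.HasDimensionLT d]
      (hA : (homFunctor A (points K)).IsRepresentable) : (homFunctor A P).IsRepresentable :=
    MorphismProperty.presheaf.isRepresentable
      (homFunctorMap_mem_of_boundary (p := p) A d fun k _ => h k) hA
  obtain ⟨Z, ⟨e⟩⟩ := exists_points_iso P fun m => hr Δ[m] (m + 1) (isRepresentable_simplex K m)
  replace h k := relClass_iso_comp e _ (h k)
  replace h' k hk := relClass_iso_comp e _ (h' k hk)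
  refine ⟨Z, ⟨fun m j hm => ?_, fun m j hm => ?_⟩, ⟨e⟩⟩
  · obtain ⟨m, rfl⟩ := Nat.exists_eq_add_of_le' hm
    exact kan_iff.2 ⟨MorphismProperty.presheaf.isRepresentable
      (homFunctorMap_mem_of_boundary (p := e.hom ≫ p) _ (m + 1) fun k _ => h k) (kan_iff.1 (hK.kan _ j hm)).1,
      extClass_of_relClass (relClass_horn m 0 (by lia) j fun k _ => h k) (hK.extClass_horn m j)⟩
  · obtain ⟨m, rfl⟩ := Nat.exists_eq_add_of_le' (show 1 ≤ m by lia)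
    exact kanUnique_iff.2 (extClass_of_relClass (relClass_horn m n (by lia) j h')
      (hK.extClass_isomorphisms_horn m j (by lia)))

/-- The morphism to `hom(Δ[m], X)` which corresponds to `x : T ⟶ X _⦋m⦌`. -/
def simplexMap {X : SimplicialObject BanMfd.{u}} {T : BanMfd.{u}} {m : ℕ} (x : T ⟶ X _⦋m⦌) :
    yoneda.obj T ⟶ homFunctor Δ[m] (points X) :=
  yoneda.map x ≫ (simplexRepresentableBy X m).toIso.hom

theorem simplexMap_app {X : SimplicialObject BanMfd.{u}} {T : BanMfd.{u}} {m : ℕ}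
    (x : T ⟶ X _⦋m⦌) (T' : BanMfd.{u}ᵒᵖ) (t : T'.unop ⟶ T) :
    (simplexMap x).app T' t = simplex (t ≫ x) :=
  rfl

theorem simplexMap_mem {X : SimplicialObject BanMfd.{u}} {T : BanMfd.{u}} {m : ℕ}
    {x : T ⟶ X _⦋m⦌} (hx : IsSurjSubmersion x) : surjSubmersions.presheaf (simplexMap x) :=
  MorphismProperty.comp_mem _ _ _ (surjSubmersions_presheaf_map hx)
    (MorphismProperty.of_isIso _ _)

variable {f : K ⟶ Y} {Z₁ : BanMfd.{u}} {g₁ : Z₁ ⟶ K _⦋1⦌} {h₁ : Z₁ ⟶ Y _⦋1⦌} {α : Bigon Y Z₁}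

/-- The data of bigons given by `α : Z₁ → b(Y_2)`. -/
def bigonBetween (hα : α.Acts h₁ (g₁ ≫ f.app (op ⦋1⦌))) :
    BigonBetween (pointsMap f) (simplexMap g₁) (simplexMap h₁) where
  bigon := simplexMap α.hom
  exists_base {T} z := by
    refine ⟨simplex (z ≫ α.base), ?_⟩
    rw [simplexMap_app]
    refine (map_comp_simplex _ _).trans (Eq.trans ?_ (map_comp_simplex _ _).symm)
    exact congrArg simplex ((Category.assoc _ _ _).trans
      ((congrArg (z ≫ ·) α.comm).trans (Category.assoc _ _ _).symm))
  source {T} z := by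
    rw [simplexMap_app, simplexMap_app, ← hα.1]
    exact (map_comp_simplex _ _).trans (congrArg simplex (Category.assoc _ _ _))
  target {T} z := by
    rw [simplexMap_app, simplexMap_app]
    refine (map_comp_simplex _ _).trans (Eq.trans ?_ (simplex_comp_pointsMap _).symm)
    exact congrArg simplex ((Category.assoc _ _ _).trans
      ((congrArg (z ≫ ·) hα.2).trans (Category.assoc _ _ _).symm))

theorem relClass_pointsMap_boundary_zero (hf : IsIso (f.app (op ⦋0⦌))) :
    relClass (.isomorphisms _) (pointsMap f) (∂Δ[0].ι : (∂Δ[0] : SSet.{u}) ⟶ Δ[0]) := by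
  rw [relClass_boundary_zero_iff, MorphismProperty.isomorphisms.iff]
  rw [isIso_iff_bijective_app]
  intro T
  have e : ⇑((homFunctorMap Δ[0] (pointsMap f)).app T).hom ∘ simplexEquiv K T.unop 0 =
      simplexEquiv Y T.unop 0 ∘ fun x => x ≫ f.app (op ⦋0⦌) :=
    funext fun x => simplex_comp_pointsMap x
  refine (Function.Bijective.of_comp_iff _ (simplexEquiv K T.unop 0).bijective).1 ?_
  have hb : Function.Bijective fun x : T.unop ⟶ K _⦋0⦌ => x ≫ f.app (op ⦋0⦌) :=
    ((asIso (f.app (op ⦋0⦌))).homToEquiv (Z := T.unop)).bijective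
  exact e ▸ (simplexEquiv Y T.unop 0).bijective.comp hb

/-- The edge case of the evaluation `K ×_Y Y^I ⟶ Y` at the end of a path. -/
theorem BigonSpan.descent_mem (hY : IsLieGroupoid 2 Y) (H : BigonSpan f Z₁ g₁ h₁ α) :
    surjSubmersions.presheaf (relHomSnd (stdSimplex.δ 2 : Δ[1] ⟶ Δ[2]) (pointsMap f) ≫
      homFunctorRes Λ[2, 2].ι (points Y)) := by
  -- Descent from the space of fillings: the map to K_1 ×_{Y_1} Y_2 is a base change of g₁, and the
  -- composite to the horns is a base change of h₁ followed by Kan(2,2).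
  refine surjSubmersions_presheaf_of_comp (q := (bigonBetween H.acts).fillingTarget)
    (BigonBetween.fillingTarget_mem _ (hY.hasUniqueFillers 1) (simplexMap_mem
      H.surjSubmersion_left))
    (BigonBetween.fillingTarget_comp_mem _ (hY.hasUniqueFillers 0) (simplexMap_mem
      H.surjSubmersion_right) (hY.extClass_horn 1 2)) ?_ (kan_iff.1 (hY.kan 2 2 (by lia))).1
  -- Descent takes place between manifolds. K_1 ×_{Y_1} Y_2 is one because d_2 : Y_2 → Y_1 is a
  -- surjective submersion.
  exact MorphismProperty.presheaf.isRepresentable (p := relHomFst _ _)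
    (MorphismProperty.of_isPullback (isPullback_relHom _ _).flip
      (δ_two_mem (hY.extClass_horn 0 0) (hY.extClass_horn 1 1))) (isRepresentable_simplex K 1)

/-- The span is the path fibre product of f with evaluation at 0; the bigons enter only for edges of
the leg to Y. -/
theorem BigonSpan.moritaEquivalent (hK : IsLieGroupoid 2 K) (hY : IsLieGroupoid 2 Y)
    (H : BigonSpan f Z₁ g₁ h₁ α) : MoritaEquivalent 2 K Y := by
  have hf₀ := relClass_pointsMap_boundary_zero H.iso_zero
  have hf₂ := isIsoOnto_boundaryRestriction_iff.1 H.iso_two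
  -- ∂Δ[1] has only vertices as cells, so bijectivity of f in degree 0 suffices.
  have hf₁ (T : BanMfd.{u}ᵒᵖ) (a b : (∂Δ[1] : SSet.{u}) ⟶ (points K).obj T)
      (h : a ≫ (pointsMap f).app T = b ≫ (pointsMap f).app T) : a = b :=
    ((isIso_iff_bijective_app _).1 (homFunctorMap_mem_of_boundary (Q := .isomorphisms _)
      (p := pointsMap f) ∂Δ[1] 1 fun k hk => by obtain rfl : k = 0 := by lia
                                                exact hf₀) T).1 h
  have hev (ε : Fin 2) (k : ℕ) : relClass surjSubmersions.presheaf (pathEval ε (points Y))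
      ∂Δ[k].ι :=
    relClass_pathEval_boundary ε k fun m j _ => hY.extClass_horn m j
  have hev' (ε : Fin 2) (k : ℕ) (hk : 2 ≤ k) : relClass (.isomorphisms _)
      (pathEval ε (points Y)) (∂Δ[k].ι : (∂Δ[k] : SSet.{u}) ⟶ Δ[k]) :=
    relClass_pathEval_boundary ε k fun m j hm => hY.extClass_isomorphisms_horn m j (hk.trans hm)
  have sq := IsPullback.of_hasPullback (pointsMap f) (pathEval 0 (points Y))
  set p := Limits.pullback.fst (pointsMap f) (pathEval 0 (points Y))
  set s := Limits.pullback.snd (pointsMap f) (pathEval 0 (points Y))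
  have hp (k : ℕ) := relClass_of_isPullback sq.flip _ (hev 0 k)
  have hp' (k : ℕ) (hk : 2 ≤ k) := relClass_of_isPullback sq.flip _ (hev' 0 k hk)
  obtain ⟨Z, hZ, ⟨e⟩⟩ := exists_isLieGroupoid hK p hp hp'
  obtain ⟨p₁, hp₁⟩ := exists_pointsMap_eq (e.hom ≫ p)
  obtain ⟨q₁, hq₁⟩ := exists_pointsMap_eq (e.hom ≫ s ≫ pathEval 1 (points Y))
  refine ⟨Z, hZ, p₁, q₁, isHypercover_of_relClass (fun k _ => ?_) ?_,
    isHypercover_of_relClass (fun k hk => ?_) ?_⟩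
  · rw [hp₁]
    exact relClass_iso_comp e _ (hp k)
  · rw [hp₁]
    exact relClass_iso_comp e _ (hp' 2 le_rfl)
  · rw [hq₁]
    refine relClass_iso_comp e _ ?_
    obtain rfl | rfl : k = 0 ∨ k = 1 := by lia
    -- In degree 0, Z → Y^I is an isomorphism as a base change of f_0, and evaluation at 1 does the
    -- rest.
    · exact relClass_comp (isomorphisms_le_surjSubmersions _ (relClass_of_isPullback sq _ hf₀))
        (hev 1 0)
    · exact relClass_comp_pathEval sq hf₁ (hY.extClass_horn 1 1) (H.descent_mem hY)
  · rw [hq₁]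
    exact relClass_iso_comp e _ (relClass_comp (relClass_of_isPullback sq _ hf₂) (hev' 1 2 le_rfl))

end SimplicialMfd

namespace BanMfd

/-! ### Maps out of disjoint unions -/

theorem isSmooth_inl (A B : BanMfd.{u}) : IsSmooth (M := A) (N := sum A B) Sum.inl := by
  refine ⟨continuous_inl, ?_⟩
  rintro c hc _ (⟨d, hd, rfl⟩ | ⟨d, hd, rfl⟩) x hx ⟨y, hy, hyx⟩
  · obtain rfl := Sum.inl_injective hyx
    exact (A.smoothChange c hc d hd y hx hy).congr_of_eventuallyEq
      (.of_forall fun z => d.φ.lift_openEmbedding_apply Topology.IsOpenEmbedding.inl)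
  · cases hyx

theorem isSmooth_inr (A B : BanMfd.{u}) : IsSmooth (M := B) (N := sum A B) Sum.inr := by
  refine ⟨continuous_inr, ?_⟩
  rintro c hc _ (⟨d, hd, rfl⟩ | ⟨d, hd, rfl⟩) x hx ⟨y, hy, hyx⟩
  · cases hyx
  · obtain rfl := Sum.inr_injective hyx
    exact (B.smoothChange c hc d hd y hx hy).congr_of_eventuallyEq
      (.of_forall fun z => d.φ.lift_openEmbedding_apply Topology.IsOpenEmbedding.inr)

/-- A local section into one summand is a local section into the disjoint union. -/
theorem isSubmersion_sumDesc {A B M : BanMfd.{u}} {f : A ⟶ M} {g : B ⟶ M} (hf : IsSubmersion f)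
    (hg : IsSubmersion g) : IsSubmersion (sumDesc f g) := by
  rw [isSubmersion_iff] at *
  rintro (x | x)
  · obtain ⟨σ, h1, h2, h3⟩ := hf x
    exact ⟨fun y => Sum.inl (σ y), ((isSmooth_inl A B).smoothAt _).comp h1, congrArg Sum.inl h2,
      h3⟩
  · obtain ⟨σ, h1, h2, h3⟩ := hg x
    exact ⟨fun y => Sum.inr (σ y), ((isSmooth_inr A B).smoothAt _).comp h1, congrArg Sum.inr h2,
      h3⟩

theorem sum_hom_ext {A B M : BanMfd.{u}} {f g : sum A B ⟶ M}
    (hl : ∀ a, f.1 (Sum.inl a) = g.1 (Sum.inl a)) (hr : ∀ b, f.1 (Sum.inr b) = g.1 (Sum.inr b)) :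
    f = g :=
  Subtype.ext (funext (Sum.rec hl hr))

theorem sumDesc_comp {A B M N : BanMfd.{u}} (f : A ⟶ M) (g : B ⟶ M) (h : M ⟶ N) :
    sumDesc f g ≫ h = sumDesc (f ≫ h) (g ≫ h) :=
  sum_hom_ext (fun _ => rfl) fun _ => rfl

end BanMfd

/-! ### The source map of bigons, and part (II) -/

namespace SimplicialMfd

open BanMfd SSet

variable {K Y : SimplicialObject BanMfd.{u}}

theorem horn_comp_simplex_eq_iff {T : BanMfd.{u}} (x y : T ⟶ Y _⦋2⦌) :
    (Λ[2, 0].ι ≫ simplex x : (Λ[2, 0] : SSet.{u}) ⟶ _) = Λ[2, 0].ι ≫ simplex y ↔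
      x ≫ Y.δ (1 : Fin 3) = y ≫ Y.δ (1 : Fin 3) ∧
        x ≫ Y.δ (2 : Fin 3) = y ≫ Y.δ (2 : Fin 3) := by
  have key (i : Fin 3) (hi : i ≠ 0) : horn.ι.{u} 0 i hi ≫ Λ[2, 0].ι ≫ simplex x =
      horn.ι.{u} 0 i hi ≫ Λ[2, 0].ι ≫ simplex y ↔ x ≫ Y.δ i = y ≫ Y.δ i := by
    rw [horn.ι_ι_assoc, horn.ι_ι_assoc]
    refine Iff.trans ?_ (simplexEquiv Y T 1).injective.eq_iff
    exact Eq.congr (map_comp_simplex _ _) (map_comp_simplex _ _)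
  refine ⟨fun h => ⟨(key 1 (by decide)).1 (by rw [h]), (key 2 (by decide)).1 (by rw [h])⟩,
    fun h => horn.hom_ext' fun i hi => (key i hi).2 ?_⟩
  fin_cases i
  · exact absurd rfl hi
  · exact h.1
  · exact h.2

/-- The presheaf represented by the bigons. -/
def bigonFunctor (Y : SimplicialObject BanMfd.{u}) : BanMfd.{u}ᵒᵖ ⥤ Type u where
  obj T := Bigon Y T.unop
  map t := ↾Bigon.pullback t.unop

/-- The base point is the initial vertex, so a bigon carries no data beyond its 2-simplex. -/
theorem Bigon.base_eq {T : BanMfd.{u}} (β : Bigon Y T) : β.base = β.source ≫ Y.δ (1 : Fin 2) := by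
  have h1 : Y.σ (0 : Fin 1) ≫ Y.δ (1 : Fin 2) = 𝟙 _ := Y.δ_comp_σ_succ (i := 0)
  have h2 : Y.δ (2 : Fin 3) ≫ Y.δ (1 : Fin 2) = Y.δ (1 : Fin 3) ≫ Y.δ (1 : Fin 2) :=
    (Y.δ_comp_δ_self (i := 1)).symm
  rw [Bigon.source, Category.assoc, ← h2, reassoc_of% β.comm, h1, Category.comp_id]

theorem Bigon.ext_hom {T : BanMfd.{u}} {β β' : Bigon Y T} (h : β.hom = β'.hom) : β = β' := by
  have hb : β.base = β'.base := by rw [base_eq, base_eq, source, source, h]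
  obtain ⟨x, v, hx⟩ := β
  obtain ⟨x', v', hx'⟩ := β'
  obtain rfl : x = x' := h
  obtain rfl : v = v' := hb
  rfl

/-- The source of bigons. -/
def bigonSource (Y : SimplicialObject BanMfd.{u}) : bigonFunctor Y ⟶ yoneda.obj (Y _⦋1⦌) where
  app T := ↾Bigon.source
  naturality T T' t := by
    ext β
    exact Category.assoc _ _ _

/-- The target of bigons. -/
def bigonTarget (Y : SimplicialObject BanMfd.{u}) : bigonFunctor Y ⟶ yoneda.obj (Y _⦋1⦌) where
  app T := ↾Bigon.target
  naturality T T' t := by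
    ext β
    exact Category.assoc _ _ _

/-- The inclusion of the bigons. -/
def bigonHom (Y : SimplicialObject BanMfd.{u}) :
    bigonFunctor Y ⟶ homFunctor Δ[2] (points Y) where
  app T := ↾fun β => simplex β.hom
  naturality T T' t := by
    ext β
    exact simplex_comp _ t.unop β.hom

/-- A bigon with source e is a 2-simplex with the same faces d_1 and d_2 as s_0 e, that is, a filler
of the restriction of s_0 e to Λ[2,0]. Hence Kan(2,0) makes the source map a surjective submersion.
-/
theorem isPullback_bigonHom :
    IsPullback (bigonHom Y) (bigonSource Y) (homFunctorRes Λ[2, 0].ι (points Y))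
      (simplexMap (Y.σ (0 : Fin 2)) ≫ homFunctorRes Λ[2, 0].ι (points Y)) := by
  have h1 : Y.σ (0 : Fin 2) ≫ Y.δ (1 : Fin 3) = 𝟙 _ := Y.δ_comp_σ_succ (i := 0)
  have h2 : Y.σ (0 : Fin 2) ≫ Y.δ (2 : Fin 3) = Y.δ (1 : Fin 2) ≫ Y.σ (0 : Fin 1) :=
    Y.δ_comp_σ_of_gt (i := 1) (j := 0) (by decide)
  have key {T : BanMfd.{u}} (x : T ⟶ Y _⦋2⦌) (e : T ⟶ Y _⦋1⦌) :
      (Λ[2, 0].ι ≫ simplex x : (Λ[2, 0] : SSet.{u}) ⟶ _) =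
        Λ[2, 0].ι ≫ simplex (e ≫ Y.σ (0 : Fin 2)) ↔ x ≫ Y.δ (1 : Fin 3) = e ∧
          x ≫ Y.δ (2 : Fin 3) = e ≫ Y.δ (1 : Fin 2) ≫ Y.σ (0 : Fin 1) := by
    rw [horn_comp_simplex_eq_iff, Category.assoc, Category.assoc, h1, h2, Category.comp_id]
  refine isPullback_of_existsUnique ?_ fun T x e h => ?_
  · ext T β
    refine (key β.hom β.source).2 ⟨rfl, ?_⟩
    rw [β.comm, β.base_eq, Category.assoc]
  · obtain ⟨x, rfl⟩ := (simplexEquiv Y T.unop 2).surjective x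
    obtain ⟨h3, h4⟩ := (key x e).1 h
    exact ⟨⟨x, e ≫ Y.δ (1 : Fin 2), h4.trans (Category.assoc _ _ _).symm⟩, ⟨rfl, h3⟩,
      fun β hβ => Bigon.ext_hom ((simplexEquiv Y T.unop 2).injective hβ.1)⟩

theorem bigonSource_mem (hY : IsLieGroupoid 2 Y) : surjSubmersions.presheaf (bigonSource Y) :=
  MorphismProperty.of_isPullback isPullback_bigonHom (hY.extClass_horn 1 0)

/-- The projection to `X₁`. -/
def bigonPullbackFst {X₁ : BanMfd.{u}} (e : X₁ ⟶ Y _⦋1⦌) : bigonPullback e ⟶ yoneda.obj X₁ where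
  app T := ↾fun x => x.1.1

/-- The projection to the bigons. -/
def bigonPullbackSnd {X₁ : BanMfd.{u}} (e : X₁ ⟶ Y _⦋1⦌) : bigonPullback e ⟶ bigonFunctor Y where
  app T := ↾fun x => x.1.2

theorem isPullback_bigonPullback {X₁ : BanMfd.{u}} (e : X₁ ⟶ Y _⦋1⦌) :
    IsPullback (bigonPullbackFst e) (bigonPullbackSnd e) (yoneda.map e) (bigonTarget Y) :=
  isPullback_of_existsUnique (by ext T x; exact x.2) fun T x y h =>
    ⟨⟨(x, y), h⟩, ⟨rfl, rfl⟩, fun z hz => Subtype.ext (Prod.ext hz.1 hz.2)⟩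

/-- The source of bigons with target in `X₁` is a submersion if `X₁ ⟶ Y_1` is. -/
theorem isSubmersion_source (hY : IsLieGroupoid 2 Y) {X₁ Q : BanMfd.{u}} {e : X₁ ⟶ Y _⦋1⦌}
    (he : IsSubmersion e) (r : (bigonPullback e).RepresentableBy Q) :
    IsSubmersion (r.homEquiv (𝟙 Q)).1.2.source := by
  have h : submersions.presheaf (bigonPullbackSnd e ≫ bigonSource Y) :=
    MorphismProperty.comp_mem _ _ _
      (MorphismProperty.of_isPullback (isPullback_bigonPullback e) (submersions_presheaf_map he))
      -- Surjectivity is dropped here, as X₁ → Y_1 is only assumed to be a submersion.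
      (MorphismProperty.relative_monotone (fun _ _ _ h => h.2) _ (bigonSource_mem hY))
  have h' : r.toIso.hom ≫ bigonPullbackSnd e ≫ bigonSource Y =
      yoneda.map (r.homEquiv (𝟙 Q)).1.2.source ≫ 𝟙 _ := by
    refine CategoryTheory.yonedaEquiv.injective ?_
    exact (Category.id_comp _).symm
  rwa [MorphismProperty.presheaf_iff_of_representableBy r (.yoneda _) h',
    submersions_presheaf_map_iff] at h

namespace HornData

variable {f : K ⟶ Y} {D : HornData f}

/-- Surjectivity of h₁ is already attained on P; on Q, the bigon relation is the defining equation
of the fibre product. -/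
theorem Conditions.bigonSpan (hY : IsLieGroupoid 2 Y) (H : D.Conditions) :
    BigonSpan f D.Z₁ D.g₁ D.h₁ D.α where
  iso_zero := H.iso_zero
  surjSubmersion_left := H.surjSubmersion_g₁
  surjSubmersion_right := ⟨fun y => (H.surjSubmersion_h'.1 y).imp' Sum.inl fun _ h => h,
    isSubmersion_sumDesc H.surjSubmersion_h'.2 (isSubmersion_source hY H.submersion D.rQ)⟩
  acts := by
    have hQ : D.prBigon.target = (D.prX₁ ≫ D.i) ≫ f.app (op ⦋1⦌) :=
      (D.rQ.homEquiv (𝟙 D.Q)).2.symm.trans (Category.assoc _ _ _).symm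
    refine ⟨(sumDesc_comp _ _ _).trans ?_, (sumDesc_comp _ _ _).trans
      (Eq.trans ?_ (sumDesc_comp _ _ _).symm)⟩
    · exact congrArg (sumDesc · D.prBigon.source) H.acts.1
    · exact congrArg₂ sumDesc H.acts.2 hQ
  iso_two := H.iso_two

end HornData

end SimplicialMfd

theorem mainTheorem8 {K Y : SimplicialObject BanMfd.{u}}
    (hK : SimplicialMfd.IsLieGroupoid 2 K) (hY : SimplicialMfd.IsLieGroupoid 2 Y) (f : K ⟶ Y) :
    (∀ (Z₁ : BanMfd.{u}) (g₁ : Z₁ ⟶ K _⦋1⦌) (h₁ : Z₁ ⟶ Y _⦋1⦌) (α : SimplicialMfd.Bigon Y Z₁),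
      SimplicialMfd.BigonSpan f Z₁ g₁ h₁ α → SimplicialMfd.MoritaEquivalent 2 K Y) ∧
    (∀ D : SimplicialMfd.HornData f, D.Conditions →
      SimplicialMfd.BigonSpan f D.Z₁ D.g₁ D.h₁ D.α) :=
  ⟨fun Z₁ g₁ h₁ α H => H.moritaEquivalent hK hY, fun D H => H.bigonSpan hY⟩
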